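/- **Process terms.** Process terms are built from atomic actions, guards (tests of the data state; the always true guard is the empty process $\epsilon$), alternative composition $+$, sequential composition $\cdot$, parallel composition $\between$ (also written $\parallel$), process creation $\mathbf{new}$, recursion variables of a recursive specification, encapsulation $\partial_H$ and abstraction $\tau_I$. Communications are asynchronous: there is no communication merge, so $x\between y=x\parallel y$. The semantics is truly concurrent. In $x\between y$ the events of $x$ and of $y$ are causally independent (unless a causality constraint below relates them) and may occur one after the other or together in one step; in $x\cdot y$ all events of $x$ causally precede those of $y$; and $(\mathbf{new}(z_1)\parallel\cdots\parallel\mathbf{new}(z_k))\cdot y=z_1\between\cdots\between z_k\between y$. An empty parallel composition is $\epsilon$. **The actors.** Let $m,n\ge 0$. Let $s_b(d)$ and $r_b(d)$ be the actions of sending the message $d$ to, and reading it from, the mail box $b$. The mail boxes are those named after the actors $Mas$, $MapA_1,\dots,MapA_m$, $RA_1,\dots,RA_n$, and the output $O$ to the user. All messages $DI_X,DO_X$ ($X$ an actor) are distinct symbols. Every actor owns local data, and its local computations are processes built from its local atomic actions (which change only its own data, possibly nondeterministically) and guards on its own data, by $\cdot$, $+$ and $\between$; let $P_1,P_5,P_9$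 be local computations of the Master, and $Q_i$, $R_j$ local computations of $MapA_i$, $RA_j$. Assume that each of these local computations, executed alone from any data state, can still terminate whatever it has done so far. The actors are the solutions of the recursive specification (for $1\le i\le m$, $1\le j\le n$) $$MapA_i=r_{MapA_i}(DI_{MapA_i})\cdot MapA_i',\quad MapA_i'=Q_i\cdot MapA_i'',\quad MapA_i''=s_{Mas}(DO_{MapA_i})\cdot MapA_i,$$ $$RA_j=r_{RA_j}(DI_{RA_j})\cdot RA_j',\quad RA_j'=R_j\cdot RA_j'',\quad RA_j''=s_{Mas}(DO_{RA_j})\cdot RA_j,$$ $$Mas=r_{Mas}(DI_{Mas})\cdot Mas_1,\qquad Mas_1=P_1\cdot Mas_2,$$ $$Mas_2=(\mathbf{new}(MapA_1)\parallel\cdots\parallel\mathbf{new}(MapA_m))\cdot Mas_3,$$ $$Mas_3=(s_{MapA_1}(DI_{MapA_1})\parallel\cdots\parallel s_{MapA_m}(DI_{MapA_m}))\cdot Mas_4,$$ $$Mas_4=(r_{Mas}(DO_{MapA_1})\parallel\cdots\parallel r_{Mas}(DO_{MapA_m}))\cdot Mas_5,\qquad Mas_5=P_5\cdot Mas_6,$$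 $$Mas_6=(\mathbf{new}(RA_1)\parallel\cdots\parallel\mathbf{new}(RA_n))\cdot Mas_7,$$ $$Mas_7=(s_{RA_1}(DI_{RA_1})\parallel\cdots\parallel s_{RA_n}(DI_{RA_n}))\cdot Mas_8,$$ $$Mas_8=(r_{Mas}(DO_{RA_1})\parallel\cdots\parallel r_{Mas}(DO_{RA_n}))\cdot Mas_9,\qquad Mas_9=P_9\cdot Mas_{10},\qquad Mas_{10}=s_O(DO_{Mas})\cdot Mas.$$ **Asynchronous communication.** The causality constraints are $s_{MapA_i}(DI_{MapA_i})\le r_{MapA_i}(DI_{MapA_i})$, $s_{Mas}(DO_{MapA_i})\le r_{Mas}(DO_{MapA_i})$, $s_{RA_j}(DI_{RA_j})\le r_{RA_j}(DI_{RA_j})$, $s_{Mas}(DO_{RA_j})\le r_{Mas}(DO_{RA_j})$. Let $H$ be the set of all actions occurring in these constraints. The encapsulation $\partial_H$ turns an occurrence of an action of $H$ into deadlock exactly when it violates its constraint, that is, when it is a read whose number of earlier occurrences (since $\partial_H$ was entered) is not smaller than the number of earlier occurrences of the matching send; and a send causally precedes every later matching read. Let $I$ consist of $H$ and all local atomic actions;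 $\tau_I$ makes the actions in $I$ silent. **Theorem (Map-Reduce).** Let $$\mathit{Sys}=\tau_I\bigl(\partial_H(Mas\between MapA_1\between\cdots\between MapA_m\between RA_1\between\cdots\between RA_n)\bigr).$$ Then the whole actor system exhibits the desired external behaviour $$\mathit{Sys}=r_{Mas}(DI_{Mas})\cdot s_O(DO_{Mas})\cdot \mathit{Sys},$$ where $=$ holds modulo rooted branching step bisimilarity $\approx_{rbs}$, modulo rooted branching pomset bisimilarity $\approx_{rbp}$, and modulo rooted branching history-preserving bisimilarity $\approx_{rbhp}$, from every initial data state. (The data of the actors are internal: the bisimulations do not compare data states.) -/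

import Mathlib

/-! ## Process terms and their truly concurrent operational semantics -/

namespace APTC

/-- Steps of a location inside a process term: the two sides of a parallel composition and the two
sides of a sequential composition. -/
inductive Dir
  | left | right | first | next

/-- Process terms over atomic actions `A`, recursion variables `V` and data states `S`.

The communications are asynchronous, so there is no communication merge, and the whole parallel
operator `x ≬ y = x ∥ y + x ∣ y` is the parallel composition `x ∥ y`; both are written `par`.
A guard is given by the set of data states in which its test succeeds: `guard True` is the empty
event `ε`, `guard False` is the deadlock `δ`.

`encap H h x` is the encapsulation `∂_H` of `x` after the actions in the multiset `h` have been
executed in its scope; `encap H 0 x` is the term `∂_H(x)`.  `hide I x` is the abstraction `τ_I(x)`.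
`loc d x` is a bookkeeping wrapper that only occurs in residuals of transitions: it behaves as `x`
and remembers the location of `x` in the original term. -/
inductive Term (A V S : Type*)
  | act (a : A)
  | guard (φ : S → Prop)
  | alt (x y : Term A V S)
  | seq (x y : Term A V S)
  | par (x y : Term A V S)
  | new (x : Term A V S)
  | var (X : V)
  | encap (H : Set A) (h : Multiset A) (x : Term A V S)
  | hide (I : Set A) (x : Term A V S)
  | loc (d : Dir) (x : Term A V S)

/-- `x₁ ∥ ⋯ ∥ x_k`, which is `ε` for `k = 0`. -/
def Term.parList {A V S : Type*} : List (Term A V S) → Term A V S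
  | [] => .guard fun _ => True
  | [x] => x
  | x :: y :: l => .par x (Term.parList (y :: l))

/-- A recursive specification, the effect of the atomic actions on data states (`s' ∈ effect a s`),
and the causality constraints `le a b` ("`a ≤ b`") of the asynchronous communications. -/
structure Spec (A V S : Type*) where
  eqn : V → Term A V S
  effect : A → S → Set S
  le : A → A → Prop

/-- An event: the place in the term where it occurs, the executed atomic action, and whether it is
visible.  An event that is not visible is a silent event, labelled `τ`. -/
structure Event (A : Type*) where
  path : List Dir
  act : A
  vis : Bool

/-- The event `e` of a subterm, seen as an event of the surrounding term. -/
def Event.under {A : Type*} (d : Dir) (e : Event A) : Event A :=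
  { e with path := d :: e.path }

section Semantics

variable {A V S : Type*}

/-- Every action constrained to occur after a sending action `b` occurs less often than `b` did
before: the next occurrence of `a` after the history `h` has a sending action of its own that
precedes it. -/
def Respects (le : A → A → Prop) (h : Multiset A) (a : A) : Prop :=
  open Classical in ∀ b, le b a → h.count a < h.count b

/-- The history of an encapsulation after the event `e`. -/
def record (e : Event A) (h : Multiset A) : Multiset A :=
  if e.vis then e.act ::ₘ h else h

/-- `Created x z`: `x` is `new(z₁) ∥ ⋯ ∥ new(z_k)` with `k ≥ 1`, and `z` is `z₁ ≬ ⋯ ≬ z_k`. -/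
inductive Created : Term A V S → Term A V S → Prop
  | new (x) : Created (.new x) x
  | par {x x' y y'} : Created x x' → Created y y' → Created (.par x y) (.par x' y')

/-- `Eps P s x`: in the data state `s` the process `x` can terminate without executing an action,
because the guards in its way hold. -/
inductive Eps (P : Spec A V S) (s : S) : Term A V S → Prop
  | guard {φ} : φ s → Eps P s (.guard φ)
  | altL {x y} : Eps P s x → Eps P s (.alt x y)
  | altR {x y} : Eps P s y → Eps P s (.alt x y)
  | seq {x y} : Eps P s x → Eps P s y → Eps P s (.seq x y)
  | par {x y} : Eps P s x → Eps P s y → Eps P s (.par x y)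
  | new {x} : Eps P s x → Eps P s (.new x)
  | var {X} : Eps P s (P.eqn X) → Eps P s (.var X)
  | encap {H h x} : Eps P s x → Eps P s (.encap H h x)
  | hide {I x} : Eps P s x → Eps P s (.hide I x)
  | loc {d x} : Eps P s x → Eps P s (.loc d x)

/-- The residual of `x · y` after an event of `x`; `none` is successful termination `√`. -/
def seqRes (r : Option (Term A V S)) (y : Term A V S) : Term A V S :=
  match r with
  | none => .loc .next y
  | some x => .seq x y

/-- The residual of `x ≬ y` after an event of `x`. -/
def parResL (r : Option (Term A V S)) (y : Term A V S) : Term A V S :=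
  match r with
  | none => .loc .right y
  | some x => .par x y

/-- The residual of `x ≬ y` after an event of `y`. -/
def parResR (x : Term A V S) (r : Option (Term A V S)) : Term A V S :=
  match r with
  | none => .loc .left x
  | some y => .par x y

/-- `Trans P x s e r s'`: the process `x` in the data state `s` executes the event `e` and becomes
`r` (successful termination `√` if `r = none`) in the data state `s'`.

Steps and pomsets of several events are obtained from runs, see `Config`.  The rule `seqNew` says
`(new(z₁) ∥ ⋯ ∥ new(z_k)) · y = z₁ ≬ ⋯ ≬ z_k ≬ y`.  The rule `encap` turns an action of `H` into
deadlock exactly when its causality constraints are violated. -/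
inductive Trans (P : Spec A V S) :
    Term A V S → S → Event A → Option (Term A V S) → S → Prop
  | act {a s s'} : s' ∈ P.effect a s → Trans P (.act a) s ⟨[], a, true⟩ none s'
  | altL {x y s e r s'} : Trans P x s e r s' → Trans P (.alt x y) s e r s'
  | altR {x y s e r s'} : Trans P y s e r s' → Trans P (.alt x y) s e r s'
  | seqFirst {x y s e r s'} : (∀ z, ¬ Created x z) → Trans P x s e r s' →
      Trans P (.seq x y) s (e.under .first) (some (seqRes r y)) s'
  | seqNext {x y s e r s'} : (∀ z, ¬ Created x z) → Eps P s x → Trans P y s e r s' →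
      Trans P (.seq x y) s (e.under .next) (r.map (.loc .next)) s'
  | seqNew {x y z s e r s'} : Created x z → Trans P (.par z y) s e r s' →
      Trans P (.seq x y) s e r s'
  | parL {x y s e r s'} : Trans P x s e r s' →
      Trans P (.par x y) s (e.under .left) (some (parResL r y)) s'
  | parR {x y s e r s'} : Trans P y s e r s' →
      Trans P (.par x y) s (e.under .right) (some (parResR x r)) s'
  | new {x s e r s'} : Trans P x s e r s' → Trans P (.new x) s e (r.map .new) s'
  | var {X s e r s'} : Trans P (P.eqn X) s e r s' → Trans P (.var X) s e r s'
  | encap {H h x s e r s'} : Trans P x s e r s' →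
      (e.vis = true → e.act ∈ H → Respects P.le h e.act) →
      Trans P (.encap H h x) s e (r.map (.encap H (record e h))) s'
  | hideIn {I x s e r s'} : Trans P x s e r s' → e.act ∈ I →
      Trans P (.hide I x) s { e with vis := false } (r.map (.hide I)) s'
  | hideOut {I x s e r s'} : Trans P x s e r s' → e.act ∉ I →
      Trans P (.hide I x) s e (r.map (.hide I)) s'
  | loc {d x s e r s'} : Trans P x s e r s' →
      Trans P (.loc d x) s (e.under d) (r.map (.loc d)) s'

/-! ### Configurations and causality -/

/-- A configuration: the events executed so far, in some order compatible with causality, together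
with the process that remains (`none` is `√`) and the data state. -/
structure Config (A V S : Type*) where
  proc : Option (Term A V S)
  data : S
  hist : List (Event A)

/-- The empty configuration of the process `x` with data state `s`. -/
def Config.init (x : Term A V S) (s : S) : Config A V S := ⟨some x, s, []⟩

/-- The termination predicate `↓`. -/
def Config.Final (P : Spec A V S) (C : Config A V S) : Prop :=
  ∀ x, C.proc = some x → Eps P C.data x

/-- The configuration `C` is extended by the single event `e` to `C'`. -/
def Config.Next (P : Spec A V S) (C : Config A V S) (e : Event A) (C' : Config A V S) : Prop :=
  ∃ x, C.proc = some x ∧ Trans P x C.data e C'.proc C'.data ∧ C'.hist = C.hist ++ [e]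

/-- Zero or more silent transitions. -/
def Config.Taus (P : Spec A V S) : Config A V S → Config A V S → Prop :=
  Relation.ReflTransGen fun C C' => ∃ e, C.Next P e C' ∧ e.vis = false

/-- Two locations on different sides of one parallel composition. -/
def Indep (p q : List Dir) : Prop :=
  ∃ w p' q', (p = w ++ .left :: p' ∧ q = w ++ .right :: q') ∨
    (p = w ++ .right :: p' ∧ q = w ++ .left :: q')

/-- Immediate causality between the `i`-th and the `j`-th event of a history: either both belong to
one sequential thread, or the causality constraints relate their actions. -/
def Prec (P : Spec A V S) (h : List (Event A)) (i j : ℕ) : Prop :=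
  i < j ∧ ∃ e e', h[i]? = some e ∧ h[j]? = some e' ∧
    (¬ Indep e.path e'.path ∨ P.le e.act e'.act)

/-- The (strict) causal order on the events of a history. -/
def Causes (P : Spec A V S) (h : List (Event A)) : ℕ → ℕ → Prop :=
  Relation.TransGen (Prec P h)

/-- The visible events of a history. -/
def Visible (h : List (Event A)) : Set ℕ := {i | ∃ e, h[i]? = some e ∧ e.vis = true}

/-- `f` is an isomorphism of labelled partial orders from the set `U₁` of events of `h₁` to the set
`U₂` of events of `h₂`.  The values of `f` outside `U₁` are irrelevant. -/
def IsPomsetIso (P : Spec A V S) (h₁ : List (Event A)) (U₁ : Set ℕ)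
    (h₂ : List (Event A)) (U₂ : Set ℕ) (f : ℕ → ℕ) : Prop :=
  Set.BijOn f U₁ U₂ ∧
  (∀ i ∈ U₁, (h₁[i]?).map Event.act = (h₂[f i]?).map Event.act) ∧
  ∀ i ∈ U₁, ∀ j ∈ U₁, (Causes P h₁ i j ↔ Causes P h₂ (f i) (f j))

/-! ### Rooted branching pomset and step bisimilarity -/

/-- Pomset transition: the configuration is extended by a non-empty set of events. -/
def PomsetTrans (P : Spec A V S) : Config A V S → Config A V S → Prop :=
  Relation.TransGen fun C C' => ∃ e, C.Next P e C'

/-- Step: a pomset transition whose events are pairwise concurrent. -/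
def StepTrans (P : Spec A V S) (C C' : Config A V S) : Prop :=
  PomsetTrans P C C' ∧ ∀ i j, C.hist.length ≤ i → ¬ Causes P C'.hist i j

/-- The visible events by which `C'` extends `C`. -/
def NewVisible (C C' : Config A V S) : Set ℕ := {i ∈ Visible C'.hist | C.hist.length ≤ i}

/-- The sets of events by which `C₁` was extended to `C₁'` and `C₂` to `C₂'` are, up to silent
events, isomorphic as pomsets. -/
def SamePomset (P : Spec A V S) (C₁ C₁' C₂ C₂' : Config A V S) : Prop :=
  ∃ f, IsPomsetIso P C₁'.hist (NewVisible C₁ C₁') C₂'.hist (NewVisible C₂ C₂') f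

/-- Branching bisimulations with respect to the kind `T` of transitions, which is `PomsetTrans` or
`StepTrans`. -/
structure IsBranchingBisim (P : Spec A V S) (T : Config A V S → Config A V S → Prop)
    (R : Config A V S → Config A V S → Prop) : Prop where
  forth : ∀ C₁ C₂ C₁', R C₁ C₂ → T C₁ C₁' →
    (NewVisible C₁ C₁' = ∅ ∧ R C₁' C₂) ∨
    ∃ C₂₀ C₂', C₂.Taus P C₂₀ ∧ R C₁ C₂₀ ∧ PomsetTrans P C₂₀ C₂' ∧
      SamePomset P C₁ C₁' C₂₀ C₂' ∧ R C₁' C₂'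
  back : ∀ C₁ C₂ C₂', R C₁ C₂ → T C₂ C₂' →
    (NewVisible C₂ C₂' = ∅ ∧ R C₁ C₂') ∨
    ∃ C₁₀ C₁', C₁.Taus P C₁₀ ∧ R C₁₀ C₂ ∧ PomsetTrans P C₁₀ C₁' ∧
      SamePomset P C₁₀ C₁' C₂ C₂' ∧ R C₁' C₂'
  finalForth : ∀ C₁ C₂, R C₁ C₂ → C₁.Final P → ∃ C₂₀, C₂.Taus P C₂₀ ∧ R C₁ C₂₀ ∧ C₂₀.Final P
  finalBack : ∀ C₁ C₂, R C₁ C₂ → C₂.Final P → ∃ C₁₀, C₁.Taus P C₁₀ ∧ R C₁₀ C₂ ∧ C₁₀.Final P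

/-- Branching bisimilarity of configurations. -/
def BranchingBisimilar (P : Spec A V S) (T : Config A V S → Config A V S → Prop)
    (C₁ C₂ : Config A V S) : Prop :=
  ∃ R, IsBranchingBisim P T R ∧ R C₁ C₂

/-- Rooted branching bisimilarity of configurations. -/
structure RootedBranchingBisimilar (P : Spec A V S) (T : Config A V S → Config A V S → Prop)
    (C₁ C₂ : Config A V S) : Prop where
  forth : ∀ C₁', T C₁ C₁' →
    ∃ C₂', T C₂ C₂' ∧ SamePomset P C₁ C₁' C₂ C₂' ∧ BranchingBisimilar P T C₁' C₂'
  back : ∀ C₂', T C₂ C₂' →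
    ∃ C₁', T C₁ C₁' ∧ SamePomset P C₁ C₁' C₂ C₂' ∧ BranchingBisimilar P T C₁' C₂'
  final : C₁.Final P ↔ C₂.Final P

/-- Rooted branching step bisimilarity `≈_rbs` of processes, from every initial data state. -/
def RBS (P : Spec A V S) (x y : Term A V S) : Prop :=
  ∀ s, RootedBranchingBisimilar P (StepTrans P) (.init x s) (.init y s)

/-- Rooted branching pomset bisimilarity `≈_rbp` of processes. -/
def RBP (P : Spec A V S) (x y : Term A V S) : Prop :=
  ∀ s, RootedBranchingBisimilar P (PomsetTrans P) (.init x s) (.init y s)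

/-! ### Rooted branching history-preserving bisimilarity -/

/-- `f[i ↦ j]` after a visible event `e`, and `f` after a silent one. -/
def extend (e : Event A) (f : ℕ → ℕ) (i j : ℕ) : ℕ → ℕ :=
  if e.vis then Function.update f i j else f

/-- Branching history-preserving bisimulations: weakly posetal relations of triples `(C₁, f, C₂)`
with `f` an isomorphism between the visible parts of the configurations. -/
structure IsBranchingHPBisim (P : Spec A V S)
    (R : Config A V S → (ℕ → ℕ) → Config A V S → Prop) : Prop where
  iso : ∀ C₁ f C₂, R C₁ f C₂ → IsPomsetIso P C₁.hist (Visible C₁.hist) C₂.hist (Visible C₂.hist) f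
  forth : ∀ C₁ f C₂ e C₁', R C₁ f C₂ → C₁.Next P e C₁' →
    (e.vis = false ∧ R C₁' f C₂) ∨
    ∃ C₂₀ e' C₂', C₂.Taus P C₂₀ ∧ R C₁ f C₂₀ ∧ C₂₀.Next P e' C₂' ∧ e'.vis = e.vis ∧
      R C₁' (extend e f C₁.hist.length C₂₀.hist.length) C₂'
  back : ∀ C₁ f C₂ e C₂', R C₁ f C₂ → C₂.Next P e C₂' →
    (e.vis = false ∧ R C₁ f C₂') ∨
    ∃ C₁₀ e' C₁', C₁.Taus P C₁₀ ∧ R C₁₀ f C₂ ∧ C₁₀.Next P e' C₁' ∧ e'.vis = e.vis ∧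
      R C₁' (extend e f C₁₀.hist.length C₂.hist.length) C₂'
  finalForth : ∀ C₁ f C₂, R C₁ f C₂ → C₁.Final P →
    ∃ C₂₀, C₂.Taus P C₂₀ ∧ R C₁ f C₂₀ ∧ C₂₀.Final P
  finalBack : ∀ C₁ f C₂, R C₁ f C₂ → C₂.Final P →
    ∃ C₁₀, C₁.Taus P C₁₀ ∧ R C₁₀ f C₂ ∧ C₁₀.Final P

/-- Branching history-preserving bisimilarity of configurations along `f`. -/
def BranchingHPBisimilar (P : Spec A V S) (C₁ : Config A V S) (f : ℕ → ℕ) (C₂ : Config A V S) :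
    Prop :=
  ∃ R, IsBranchingHPBisim P R ∧ R C₁ f C₂

/-- Rooted branching history-preserving bisimilarity `≈_rbhp` of processes, from every initial data
state.  The isomorphism between the two empty configurations is the empty map. -/
def RBHP (P : Spec A V S) (x y : Term A V S) : Prop :=
  ∀ s,
    (∀ e C₁', (Config.init x s).Next P e C₁' →
      ∃ e' C₂', (Config.init y s).Next P e' C₂' ∧ e'.vis = e.vis ∧
        BranchingHPBisimilar P C₁' (extend e id 0 0) C₂') ∧
    (∀ e C₂', (Config.init y s).Next P e C₂' →
      ∃ e' C₁', (Config.init x s).Next P e' C₁' ∧ e'.vis = e.vis ∧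
        BranchingHPBisimilar P C₁' (extend e id 0 0) C₂') ∧
    ((Config.init x s).Final P ↔ (Config.init y s).Final P)

/-- Whatever `x` has done, from whatever initial data state, it can still terminate. -/
def CanAlwaysFinish (P : Spec A V S) (x : Term A V S) : Prop :=
  ∀ s C, Relation.ReflTransGen (fun C C' => ∃ e, Config.Next P C e C') (.init x s) C →
    ∃ C', Relation.ReflTransGen (fun C C' => ∃ e, Config.Next P C e C') C C' ∧ C'.Final P

end Semantics

end APTC

/-! ## The actor system of Map-Reduce -/

namespace MapReduce

open APTC

/-- The names of the actors: the Master, `m` Map actors and `n` Reduce actors. -/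
inductive Actor (m n : ℕ)
  | mas
  | map (i : Fin m)
  | red (j : Fin n)

/-- Mail boxes: one for every actor, named after it, and the output `O` to the user. -/
inductive Box (m n : ℕ)
  | actor (a : Actor m n)
  | out

/-- The messages `DI_a` and `DO_a`. -/
inductive Msg (m n : ℕ)
  | din (a : Actor m n)
  | dout (a : Actor m n)

/-- Atomic actions: `s_b(d)`, `r_b(d)`, and the local atomic actions of the actors. -/
inductive Act (m n : ℕ) (L : Type*)
  | send (b : Box m n) (d : Msg m n)
  | recv (b : Box m n) (d : Msg m n)
  | loc (a : Actor m n) (l : L)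

/-- Local computations: built from local atomic actions and guards (tests of the actor's own data)
by `·`, `+` and `≬`. -/
inductive Local (L D : Type*)
  | act (l : L)
  | guard (φ : D → Prop)
  | seq (p q : Local L D)
  | alt (p q : Local L D)
  | par (p q : Local L D)

/-- The recursion variables of the specification. -/
inductive Var (m n : ℕ)
  | mas | mas1 | mas2 | mas3 | mas4 | mas5 | mas6 | mas7 | mas8 | mas9 | mas10
  | map (i : Fin m) | map1 (i : Fin m) | map2 (i : Fin m)
  | red (j : Fin n) | red1 (j : Fin n) | red2 (j : Fin n)

/-- Data states: every actor has its own local data. -/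
abbrev Data (m n : ℕ) (D : Type*) := Actor m n → D

abbrev Proc (m n : ℕ) (L D : Type*) := Term (Act m n L) (Var m n) (Data m n D)

/-- The local computations of all actors.  The Master computes before creating the Map actors, before
creating the Reduce actors, and before answering the user. -/
structure Code (m n : ℕ) (L D : Type*) where
  mas1 : Local L D
  mas5 : Local L D
  mas9 : Local L D
  map : Fin m → Local L D
  red : Fin n → Local L D

section System

variable {m n : ℕ} {L D : Type*}

/-- The local computation `p` as a process executed by the actor `a`. -/
def Local.toProc (a : Actor m n) : Local L D → Proc m n L D
  | .act l => .act (.loc a l)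
  | .guard φ => .guard fun s => φ (s a)
  | .seq p q => .seq (p.toProc a) (q.toProc a)
  | .alt p q => .alt (p.toProc a) (q.toProc a)
  | .par p q => .par (p.toProc a) (q.toProc a)

/-- The process `s_b(d)`. -/
def snd (b : Box m n) (d : Msg m n) : Proc m n L D := .act (.send b d)

/-- The process `r_b(d)`. -/
def rcv (b : Box m n) (d : Msg m n) : Proc m n L D := .act (.recv b d)

/-- `x 1 ∥ ⋯ ∥ x k`. -/
def parAll {k : ℕ} (x : Fin k → Proc m n L D) : Proc m n L D := Term.parList (List.ofFn x)

/-- The recursive specification of the Master, the Map actors and the Reduce actors. -/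
def eqn (c : Code m n L D) : Var m n → Proc m n L D
  | .mas => .seq (rcv (.actor .mas) (.din .mas)) (.var .mas1)
  | .mas1 => .seq (c.mas1.toProc .mas) (.var .mas2)
  | .mas2 => .seq (parAll fun i => .new (.var (.map i))) (.var .mas3)
  | .mas3 => .seq (parAll fun i => snd (.actor (.map i)) (.din (.map i))) (.var .mas4)
  | .mas4 => .seq (parAll fun i => rcv (.actor .mas) (.dout (.map i))) (.var .mas5)
  | .mas5 => .seq (c.mas5.toProc .mas) (.var .mas6)
  | .mas6 => .seq (parAll fun j => .new (.var (.red j))) (.var .mas7)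
  | .mas7 => .seq (parAll fun j => snd (.actor (.red j)) (.din (.red j))) (.var .mas8)
  | .mas8 => .seq (parAll fun j => rcv (.actor .mas) (.dout (.red j))) (.var .mas9)
  | .mas9 => .seq (c.mas9.toProc .mas) (.var .mas10)
  | .mas10 => .seq (snd .out (.dout .mas)) (.var .mas)
  | .map i => .seq (rcv (.actor (.map i)) (.din (.map i))) (.var (.map1 i))
  | .map1 i => .seq ((c.map i).toProc (.map i)) (.var (.map2 i))
  | .map2 i => .seq (snd (.actor .mas) (.dout (.map i))) (.var (.map i))
  | .red j => .seq (rcv (.actor (.red j)) (.din (.red j))) (.var (.red1 j))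
  | .red1 j => .seq ((c.red j).toProc (.red j)) (.var (.red2 j))
  | .red2 j => .seq (snd (.actor .mas) (.dout (.red j))) (.var (.red j))

/-- The causality constraints of the asynchronous communications. -/
inductive Causality : Act m n L → Act m n L → Prop
  | mapIn (i) : Causality (.send (.actor (.map i)) (.din (.map i)))
      (.recv (.actor (.map i)) (.din (.map i)))
  | mapOut (i) : Causality (.send (.actor .mas) (.dout (.map i)))
      (.recv (.actor .mas) (.dout (.map i)))
  | redIn (j) : Causality (.send (.actor (.red j)) (.din (.red j)))
      (.recv (.actor (.red j)) (.din (.red j)))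
  | redOut (j) : Causality (.send (.actor .mas) (.dout (.red j)))
      (.recv (.actor .mas) (.dout (.red j)))

/-- Effects of actions: a local action changes only the data of its actor, a communication changes
no data. -/
def effect (eff : L → D → Set D) : Act m n L → Data m n D → Set (Data m n D)
  | .send _ _, s => {s}
  | .recv _ _, s => {s}
  | .loc a l, s => {s' | s' a ∈ eff l (s a) ∧ ∀ b, b ≠ a → s' b = s b}

/-- The recursive specification with its data environment and causality constraints. -/
def spec (eff : L → D → Set D) (c : Code m n L D) : Spec (Act m n L) (Var m n) (Data m n D) where
  eqn := eqn c
  effect := effect eff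
  le := Causality

/-- The communication actions between the Master and the other actors; those that violate the
causality constraints are blocked by `∂_H`. -/
def H : Set (Act m n L) := {a | ∃ b, Causality a b ∨ Causality b a}

/-- The internal actions: the communications between the actors and all local actions. -/
def I : Set (Act m n L) := H ∪ {a | ∃ b l, a = .loc b l}

/-- `Mas ≬ MapA_1 ≬ ⋯ ≬ MapA_m ≬ RA_1 ≬ ⋯ ≬ RA_n`. -/
def actors : Proc m n L D :=
  Term.parList (.var .mas ::
    (List.ofFn (fun i => .var (.map i)) ++ List.ofFn (fun j => .var (.red j))))

/-- `τ_I(∂_H(Mas ≬ MapA_1 ≬ ⋯ ≬ MapA_m ≬ RA_1 ≬ ⋯ ≬ RA_n))`. -/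
def system : Proc m n L D := .hide I (.encap H 0 actors)

/-- `r_Mas(DI_Mas) · s_O(DO_Mas) · x`. -/
def serve (x : Proc m n L D) : Proc m n L D :=
  .seq (rcv (.actor .mas) (.din .mas)) (.seq (snd .out (.dout .mas)) x)

end System

end MapReduce

/-! Up to silent events the system can only alternate between the request `r_Mas(DI_Mas)` and the
reply `s_O(DO_Mas)`. All visible events lie in the thread of the Master, so causality orders them
totally, and the visible pomset of a run is a chain with alternating labels. The same is true of the
right-hand side. Hence being in the same phase is already a branching bisimulation (for the
history-preserving version, together with the isomorphism of the two chains), provided that no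
configuration is final and that each one can silently reach the visible event that ends its phase.
`IsAlternating` isolates this argument; the root conditions need in addition that the first event on
either side is visible (`rbs`, `rbp`, `rbhp`).

It remains to find such an invariant for the actors (`isAlternating_serving`). Processes are cut
into threads by `Trans.exists_thread` and `Trans.of_thread`. Created actors never disappear, so
copies of each worker accumulate, and copies of one worker share its data. The invariant `SysState`
therefore counts by name: inputs under way, running copies and answers under way add up to one if
the Master awaits the answer of that worker, and to zero otherwise (`Balanced`). So superfluous
copies cannot read, two copies of one worker never compute at the same time, and an awaited answer
can always be produced.

Progress (`SysState.progress`) rests on the assumption that local computations can always finish. It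
survives interleaving because a computation sees and changes only the data of its own actor
(`IsLocal.trans`, `live_toProc`). `Go` records a path of one thread to its goal that is independent
of the data of the others. Infinite local runs do no harm: the bisimilarities ask that the visible
event be reachable, not that it be inevitable. -/

namespace APTC

/-! ### Histories whose visible events form a chain. -/

section Alternating

variable {A V S : Type*} {P : Spec A V S}

/-- No two visible events of the history are on different sides of a parallel composition. -/
def Ordered (h : List (Event A)) : Prop :=
  h.Pairwise fun e e' => e.vis = true → e'.vis = true → ¬ Indep e.path e'.path

theorem Causes.lt {h : List (Event A)} {i j : ℕ} (hc : Causes P h i j) : i < j := by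
  induction hc with
  | single h => exact h.1
  | tail _ h ih => exact ih.trans h.1

theorem Causes.lt_length {h : List (Event A)} {i j : ℕ} (hc : Causes P h i j) : j < h.length := by
  have key : ∀ {i j}, Prec P h i j → j < h.length := by
    rintro i j ⟨-, e, e', -, he', -⟩
    exact (List.getElem?_eq_some_iff.1 he').1
  cases hc with
  | single h => exact key h
  | tail _ h => exact key h

/-- Events that are not on different sides of a parallel composition are immediate causes of one
another in the order of execution, and causality never runs against that order. -/
theorem Ordered.causes_iff {h : List (Event A)} (ho : Ordered h) {i j : ℕ}
    (hi : i ∈ Visible h) (hj : j ∈ Visible h) : Causes P h i j ↔ i < j := by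
  refine ⟨Causes.lt, fun hij => .single ⟨hij, ?_⟩⟩
  obtain ⟨e, he, hev⟩ := hi
  obtain ⟨e', he', hev'⟩ := hj
  obtain ⟨hil, rfl⟩ := List.getElem?_eq_some_iff.1 he
  obtain ⟨hjl, rfl⟩ := List.getElem?_eq_some_iff.1 he'
  exact ⟨_, _, he, he', .inl (List.pairwise_iff_getElem.1 ho i j hil hjl hij hev hev')⟩

theorem lt_length_of_mem_visible {h : List (Event A)} {i : ℕ} (hi : i ∈ Visible h) :
    i < h.length := by
  obtain ⟨e, he, -⟩ := hi
  exact (List.getElem?_eq_some_iff.1 he).1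

theorem visible_nil : Visible ([] : List (Event A)) = ∅ := by
  ext i; simp [Visible]

theorem mem_visible_snoc {h : List (Event A)} {e : Event A} {i : ℕ} :
    i ∈ Visible (h ++ [e]) ↔ i ∈ Visible h ∨ (i = h.length ∧ e.vis = true) := by
  rcases lt_trichotomy i h.length with hi | rfl | hi
  · simp [Visible, List.getElem?_append_left hi, hi.ne]
  · simp [Visible]
  · simp only [Visible, Set.mem_ofPred_eq, hi.ne', false_and, or_false]
    rw [List.getElem?_eq_none (by simpa using hi), List.getElem?_eq_none hi.le]

theorem visible_snoc_silent {h : List (Event A)} {e : Event A} (he : e.vis = false) :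
    Visible (h ++ [e]) = Visible h := by
  ext i
  simp [mem_visible_snoc, he]

theorem visible_snoc_visible {h : List (Event A)} {e : Event A} (he : e.vis = true) :
    Visible (h ++ [e]) = insert h.length (Visible h) := by
  ext i
  simp [mem_visible_snoc, he, or_comm]

/-- Causality is replaced by the order of positions, which does not change when the histories are
extended; the extension lemmas below rest on this. -/
theorem isPomsetIso_iff {h₁ h₂ : List (Event A)} {U₁ U₂ : Set ℕ} {f : ℕ → ℕ}
    (o₁ : Ordered h₁) (o₂ : Ordered h₂) (hU₁ : U₁ ⊆ Visible h₁) (hU₂ : U₂ ⊆ Visible h₂) :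
    IsPomsetIso P h₁ U₁ h₂ U₂ f ↔ Set.BijOn f U₁ U₂ ∧
      (∀ i ∈ U₁, (h₁[i]?).map Event.act = (h₂[f i]?).map Event.act) ∧
      ∀ i ∈ U₁, ∀ j ∈ U₁, (i < j ↔ f i < f j) := by
  refine and_congr_right fun hb => and_congr_right fun _ => ?_
  refine forall₂_congr fun i hi => forall₂_congr fun j hj => ?_
  rw [o₁.causes_iff (hU₁ hi) (hU₁ hj), o₂.causes_iff (hU₂ (hb.1 hi)) (hU₂ (hb.1 hj))]

theorem IsPomsetIso.exists_symm {h₁ h₂ : List (Event A)} {U₁ U₂ : Set ℕ} {f : ℕ → ℕ}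
    (hf : IsPomsetIso P h₁ U₁ h₂ U₂ f) : ∃ g, IsPomsetIso P h₂ U₂ h₁ U₁ g := by
  obtain ⟨hb, hl, hc⟩ := hf
  have hinv := hb.invOn_invFunOn
  have hg : Set.BijOn (Function.invFunOn f U₁) U₂ U₁ := hb.symm hinv.symm
  refine ⟨_, hg, fun i hi => ?_, fun i hi j hj => ?_⟩
  · rw [hl _ (hg.1 hi), hinv.2 hi]
  · rw [hc _ (hg.1 hi) _ (hg.1 hj), hinv.2 hi, hinv.2 hj]

theorem IsPomsetIso.append_left {h₁ h₂ t : List (Event A)} {U₁ U₂ : Set ℕ} {f : ℕ → ℕ}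
    (hf : IsPomsetIso P h₁ U₁ h₂ U₂ f) (o₁ : Ordered (h₁ ++ t)) (o₂ : Ordered h₂)
    (hU₁ : U₁ ⊆ Visible h₁) (hU₂ : U₂ ⊆ Visible h₂) :
    IsPomsetIso P (h₁ ++ t) U₁ h₂ U₂ f := by
  have hU : U₁ ⊆ Visible (h₁ ++ t) := fun i hi => by
    obtain ⟨e, he, hv⟩ := hU₁ hi
    exact ⟨e, by rw [List.getElem?_append_left (lt_length_of_mem_visible (hU₁ hi)), he], hv⟩
  rw [isPomsetIso_iff (List.pairwise_append.1 o₁).1 o₂ hU₁ hU₂] at hf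
  rw [isPomsetIso_iff o₁ o₂ hU hU₂]
  refine ⟨hf.1, fun i hi => ?_, hf.2.2⟩
  rw [List.getElem?_append_left (lt_length_of_mem_visible (hU₁ hi)), hf.2.1 i hi]

theorem IsPomsetIso.append_right {h₁ h₂ t : List (Event A)} {U₁ U₂ : Set ℕ} {f : ℕ → ℕ}
    (hf : IsPomsetIso P h₁ U₁ h₂ U₂ f) (o₁ : Ordered h₁) (o₂ : Ordered (h₂ ++ t))
    (hU₁ : U₁ ⊆ Visible h₁) (hU₂ : U₂ ⊆ Visible h₂) :
    IsPomsetIso P h₁ U₁ (h₂ ++ t) U₂ f := by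
  have hU : U₂ ⊆ Visible (h₂ ++ t) := fun i hi => by
    obtain ⟨e, he, hv⟩ := hU₂ hi
    exact ⟨e, by rw [List.getElem?_append_left (lt_length_of_mem_visible (hU₂ hi)), he], hv⟩
  rw [isPomsetIso_iff o₁ (List.pairwise_append.1 o₂).1 hU₁ hU₂] at hf
  rw [isPomsetIso_iff o₁ o₂ hU₁ hU]
  refine ⟨hf.1, fun i hi => ?_, hf.2.2⟩
  rw [List.getElem?_append_left (lt_length_of_mem_visible (hU₂ (hf.1.1 hi))), hf.2.1 i hi]

/-- The new events come last in both histories, hence on top of both chains, and the update of `f`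
happens at a position above all of `U₁`. -/
theorem IsPomsetIso.snoc {h₁ h₂ : List (Event A)} {e₁ e₂ : Event A} {U₁ U₂ : Set ℕ} {f : ℕ → ℕ}
    (hf : IsPomsetIso P h₁ U₁ h₂ U₂ f) (o₁ : Ordered (h₁ ++ [e₁])) (o₂ : Ordered (h₂ ++ [e₂]))
    (hU₁ : U₁ ⊆ Visible h₁) (hU₂ : U₂ ⊆ Visible h₂)
    (hv₁ : e₁.vis = true) (hv₂ : e₂.vis = true) (ha : e₁.act = e₂.act) :
    IsPomsetIso P (h₁ ++ [e₁]) (insert h₁.length U₁) (h₂ ++ [e₂]) (insert h₂.length U₂)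
      (Function.update f h₁.length h₂.length) := by
  rw [isPomsetIso_iff (List.pairwise_append.1 o₁).1 (List.pairwise_append.1 o₂).1 hU₁ hU₂] at hf
  rw [isPomsetIso_iff o₁ o₂ (by rw [visible_snoc_visible hv₁]; exact Set.insert_subset_insert hU₁)
    (by rw [visible_snoc_visible hv₂]; exact Set.insert_subset_insert hU₂)]
  obtain ⟨hb, hl, hc⟩ := hf
  have l₁ : ∀ i ∈ U₁, i < h₁.length := fun i hi => lt_length_of_mem_visible (hU₁ hi)
  have l₂ : ∀ i ∈ U₁, f i < h₂.length := fun i hi => lt_length_of_mem_visible (hU₂ (hb.1 hi))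
  have hu : ∀ i ∈ U₁, Function.update f h₁.length h₂.length i = f i := fun i hi =>
    Function.update_of_ne (l₁ i hi).ne _ _
  refine ⟨?_, ?_, ?_⟩
  · refine ⟨?_, ?_, ?_⟩
    · rintro i (rfl | hi)
      · simp
      · rw [hu i hi]; exact .inr (hb.1 hi)
    · rintro i (rfl | hi) j (rfl | hj) hij
      · rfl
      · rw [hu j hj, Function.update_self] at hij; exact absurd hij (l₂ j hj).ne'
      · rw [hu i hi, Function.update_self] at hij; exact absurd hij (l₂ i hi).ne
      · rw [hu i hi, hu j hj] at hij; exact hb.2.1 hi hj hij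
    · rintro k (rfl | hk)
      · exact ⟨_, .inl rfl, Function.update_self ..⟩
      · obtain ⟨i, hi, rfl⟩ := hb.2.2 hk
        exact ⟨i, .inr hi, hu i hi⟩
  · rintro i (rfl | hi)
    · simp [ha]
    · rw [hu i hi, List.getElem?_append_left (l₁ i hi), List.getElem?_append_left (l₂ i hi), hl i hi]
  · rintro i (rfl | hi) j (rfl | hj)
    · simp
    · rw [hu j hj, Function.update_self]
      have := l₁ j hj; have := l₂ j hj; omega
    · rw [hu i hi, Function.update_self]
      have := l₁ i hi; have := l₂ i hi; omega
    · rw [hu i hi, hu j hj]; exact hc i hi j hj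

/-! ### Processes that alternate between two visible actions -/

/-- Runs: sequences of transitions of configurations. -/
def Config.Reach (P : Spec A V S) : Config A V S → Config A V S → Prop :=
  Relation.ReflTransGen fun C C' => ∃ e, C.Next P e C'

theorem Config.Reach.prefix {C C' : Config A V S} (h : C.Reach P C') : C.hist <+: C'.hist := by
  induction h with
  | refl => exact List.prefix_rfl
  | tail _ h ih =>
    obtain ⟨e, x, -, -, hh⟩ := h
    rw [hh]; exact ih.trans (List.prefix_append _ _)

theorem Config.Taus.reach {C C' : Config A V S} (h : C.Taus P C') : C.Reach P C' :=
  Relation.ReflTransGen.mono (fun _ _ ⟨e, h, _⟩ => ⟨e, h⟩) _ _ h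

theorem Config.Taus.visible {C C' : Config A V S} (h : C.Taus P C') :
    Visible C'.hist = Visible C.hist := by
  induction h with
  | refl => rfl
  | tail _ h ih =>
    obtain ⟨e, ⟨x, -, -, hh⟩, hv⟩ := h
    rw [hh, visible_snoc_silent hv, ih]

/-- An invariant of configurations in two phases, each of which has exactly one visible action,
which ends it and which can always be reached. -/
structure IsAlternating (P : Spec A V S) (lab : Bool → A)
    (Inv : Bool → Config A V S → Prop) : Prop where
  ordered : ∀ {b C}, Inv b C → Ordered C.hist
  step : ∀ {b C e C'}, Inv b C → C.Next P e C' →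
    (e.vis = false ∧ Inv b C') ∨ (e.vis = true ∧ e.act = lab b ∧ Inv (!b) C')
  progress : ∀ {b C}, Inv b C → ∃ C₀ e C', C.Taus P C₀ ∧ C₀.Next P e C' ∧ e.vis = true
  not_final : ∀ {b C}, Inv b C → ¬ C.Final P

namespace IsAlternating

variable {lab : Bool → A} {Inv : Bool → Config A V S → Prop}

theorem taus (hI : IsAlternating P lab Inv) {b C C'} (hC : Inv b C) (h : C.Taus P C') :
    Inv b C' := by
  induction h with
  | refl => exact hC
  | tail _ h ih =>
    obtain ⟨e, hn, hv⟩ := h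
    rcases hI.step ih hn with h | h
    · exact h.2
    · simp [hv] at h

theorem exists_visible (hI : IsAlternating P lab Inv) {b C} (hC : Inv b C) :
    ∃ C₀ e C', C.Taus P C₀ ∧ Inv b C₀ ∧ C₀.Next P e C' ∧ e.vis = true ∧ e.act = lab b ∧
      Inv (!b) C' := by
  obtain ⟨C₀, e, C', ht, hn, hv⟩ := hI.progress hC
  have h₀ := hI.taus hC ht
  rcases hI.step h₀ hn with h | h
  · simp [hv] at h
  · exact ⟨C₀, e, C', ht, h₀, hn, h.1, h.2.1, h.2.2⟩

/-! ### The visible pomset by which a run extends a configuration. -/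

theorem newVisible_subset {C C' : Config A V S} : NewVisible C C' ⊆ Visible C'.hist :=
  fun _ h => h.1

theorem newVisible_snoc_silent {C C' C'' : Config A V S} {e : Event A}
    (hh : C''.hist = C'.hist ++ [e]) (hv : e.vis = false) : NewVisible C C'' = NewVisible C C' := by
  simp only [NewVisible, hh, visible_snoc_silent hv]

theorem newVisible_snoc_visible {C C' C'' : Config A V S} {e : Event A}
    (hh : C''.hist = C'.hist ++ [e]) (hv : e.vis = true) (hl : C.hist.length ≤ C'.hist.length) :
    NewVisible C C'' = insert C'.hist.length (NewVisible C C') := by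
  ext i
  simp only [NewVisible, hh, visible_snoc_visible hv, Set.mem_ofPred_eq, Set.mem_insert_iff]
  constructor
  · rintro ⟨rfl | h1, h2⟩
    · exact .inl rfl
    · exact .inr ⟨h1, h2⟩
  · rintro (rfl | h)
    · exact ⟨.inl rfl, hl⟩
    · exact ⟨.inr h.1, h.2⟩

theorem newVisible_self (C : Config A V S) : NewVisible C C = ∅ := by
  ext i
  simp only [NewVisible, Set.mem_ofPred_eq, Set.mem_empty_iff_false, iff_false, not_and, not_le]
  exact lt_length_of_mem_visible

theorem samePomset_self (C₁ C₂ : Config A V S) : SamePomset P C₁ C₁ C₂ C₂ := by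
  refine ⟨id, ?_⟩
  rw [newVisible_self, newVisible_self]
  exact ⟨Set.bijOn_empty _, by simp, by simp⟩

theorem samePomset_snoc_silent {C₁ C₂ C₁' C₂' C₁'' : Config A V S} {e : Event A}
    (h : SamePomset P C₁ C₁' C₂ C₂') (o₁ : Ordered C₁''.hist) (o₂ : Ordered C₂'.hist)
    (hh : C₁''.hist = C₁'.hist ++ [e]) (hv : e.vis = false) : SamePomset P C₁ C₁'' C₂ C₂' := by
  obtain ⟨f, hf⟩ := h
  refine ⟨f, ?_⟩
  rw [newVisible_snoc_silent hh hv]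
  rw [hh] at o₁ ⊢
  exact hf.append_left o₁ o₂ newVisible_subset newVisible_subset

theorem samePomset_taus_right {C₁ C₂ C₁' C₂' C₂'' : Config A V S}
    (h : SamePomset P C₁ C₁' C₂ C₂') (o₁ : Ordered C₁'.hist) (o₂ : Ordered C₂''.hist)
    (ht : C₂'.Taus P C₂'') : SamePomset P C₁ C₁' C₂ C₂'' := by
  obtain ⟨f, hf⟩ := h
  refine ⟨f, ?_⟩
  have : NewVisible C₂ C₂'' = NewVisible C₂ C₂' := by simp only [NewVisible, ht.visible]
  rw [this]
  obtain ⟨t, ht⟩ := ht.reach.prefix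
  rw [← ht] at o₂ ⊢
  exact hf.append_right o₁ o₂ newVisible_subset newVisible_subset

theorem samePomset_snoc_visible {C₁ C₂ C₁' C₂' C₁'' C₂'' : Config A V S} {e₁ e₂ : Event A}
    (h : SamePomset P C₁ C₁' C₂ C₂') (o₁ : Ordered C₁''.hist) (o₂ : Ordered C₂''.hist)
    (hh₁ : C₁''.hist = C₁'.hist ++ [e₁]) (hh₂ : C₂''.hist = C₂'.hist ++ [e₂])
    (hv₁ : e₁.vis = true) (hv₂ : e₂.vis = true) (ha : e₁.act = e₂.act)
    (hl₁ : C₁.hist.length ≤ C₁'.hist.length) (hl₂ : C₂.hist.length ≤ C₂'.hist.length) :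
    SamePomset P C₁ C₁'' C₂ C₂'' := by
  obtain ⟨f, hf⟩ := h
  refine ⟨Function.update f C₁'.hist.length C₂'.hist.length, ?_⟩
  rw [newVisible_snoc_visible hh₁ hv₁ hl₁, newVisible_snoc_visible hh₂ hv₂ hl₂]
  rw [hh₁] at o₁ ⊢
  rw [hh₂] at o₂ ⊢
  exact hf.snoc o₁ o₂ newVisible_subset newVisible_subset hv₁ hv₂ ha

/-- Every run of one configuration is matched by a run of the other one in the same phase. -/
theorem exists_run (hI : IsAlternating P lab Inv) {b C₁ C₂ C₁'} (h₁ : Inv b C₁) (h₂ : Inv b C₂)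
    (hr : C₁.Reach P C₁') : ∃ b' C₂', C₂.Reach P C₂' ∧ Inv b' C₁' ∧ Inv b' C₂' ∧
      SamePomset P C₁ C₁' C₂ C₂' ∧
      ((NewVisible C₁ C₁' = ∅ ∧ b' = b) ∨ PomsetTrans P C₂ C₂') := by
  induction hr with
  | refl => exact ⟨b, C₂, .refl, h₁, h₂, samePomset_self _ _, .inl ⟨newVisible_self _, rfl⟩⟩
  | @tail C₁' C₁'' hr hn ih =>
    obtain ⟨e, hn⟩ := hn
    obtain ⟨b', C₂', hr₂, h₁', h₂', hs, hd⟩ := ih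
    obtain ⟨-, -, -, hh⟩ := id hn
    -- A silent event is answered by no event at all. A visible one is answered by a silent run to
    -- the end of the phase and the visible event there, whose label is the same because the phases
    -- agree.
    rcases hI.step h₁' hn with ⟨hv, h₁''⟩ | ⟨hv, ha, h₁''⟩
    · refine ⟨b', C₂', hr₂, h₁'', h₂',
        samePomset_snoc_silent hs (hI.ordered h₁'') (hI.ordered h₂') hh hv, ?_⟩
      rwa [newVisible_snoc_silent hh hv]
    · obtain ⟨C₂₀, e', C₂'', ht, h₂₀, hn', hv', ha', h₂''⟩ := hI.exists_visible h₂'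
      obtain ⟨-, -, -, hh'⟩ := id hn'
      have hr₂₀ : C₂.Reach P C₂₀ := hr₂.trans ht.reach
      refine ⟨!b', C₂'', hr₂₀.tail ⟨e', hn'⟩, h₁'', h₂'', ?_, .inr ?_⟩
      · exact samePomset_snoc_visible
          (samePomset_taus_right hs (hI.ordered h₁') (hI.ordered h₂₀) ht) (hI.ordered h₁'')
          (hI.ordered h₂'') hh hh' hv hv' (ha.trans ha'.symm) (Config.Reach.prefix hr).length_le
          hr₂₀.prefix.length_le
      · exact Relation.TransGen.tail' hr₂₀ ⟨e', hn'⟩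

theorem samePomset_symm {C₁ C₂ C₁' C₂' : Config A V S} (h : SamePomset P C₁ C₁' C₂ C₂') :
    SamePomset P C₂ C₂' C₁ C₁' :=
  h.elim fun _ hf => hf.exists_symm

/-! ### Being in the same phase is a branching bisimulation. -/

/-- Steps and pomsets are treated together: the answer to a transition of kind `T` may be any pomset
transition, so it only matters that `T` consists of runs. -/
theorem isBranchingBisim (hI : IsAlternating P lab Inv) {T : Config A V S → Config A V S → Prop}
    (hT : ∀ C C', T C C' → PomsetTrans P C C') :
    IsBranchingBisim P T fun C₁ C₂ => ∃ b, Inv b C₁ ∧ Inv b C₂ where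
  forth := by
    rintro C₁ C₂ C₁' ⟨b, h₁, h₂⟩ ht
    obtain ⟨b', C₂', -, h₁', h₂', hs, ⟨hd, rfl⟩ | hd⟩ :=
      hI.exists_run h₁ h₂ (hT _ _ ht).to_reflTransGen
    · exact .inl ⟨hd, _, h₁', h₂⟩
    · exact .inr ⟨C₂, C₂', .refl, ⟨b, h₁, h₂⟩, hd, hs, b', h₁', h₂'⟩
  back := by
    rintro C₁ C₂ C₂' ⟨b, h₁, h₂⟩ ht
    obtain ⟨b', C₁', -, h₂', h₁', hs, ⟨hd, rfl⟩ | hd⟩ :=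
      hI.exists_run h₂ h₁ (hT _ _ ht).to_reflTransGen
    · exact .inl ⟨hd, _, h₁, h₂'⟩
    · exact .inr ⟨C₁, C₁', .refl, ⟨b, h₁, h₂⟩, hd, samePomset_symm hs, b', h₁', h₂'⟩
  finalForth := fun _ _ ⟨_, h₁, _⟩ hf => absurd hf (hI.not_final h₁)
  finalBack := fun _ _ ⟨_, _, h₂⟩ hf => absurd hf (hI.not_final h₂)

/-- The phase does not determine the length of a history, so the relation also carries the
isomorphism of the chains. Silent events leave it alone and visible ones prolong it at the top. -/
theorem isBranchingHPBisim (hI : IsAlternating P lab Inv) :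
    IsBranchingHPBisim P fun C₁ f C₂ => (∃ b, Inv b C₁ ∧ Inv b C₂) ∧
      IsPomsetIso P C₁.hist (Visible C₁.hist) C₂.hist (Visible C₂.hist) f where
  iso := fun _ _ _ h => h.2
  forth := by
    rintro C₁ f C₂ e C₁' ⟨⟨b, h₁, h₂⟩, hf⟩ hn
    obtain ⟨-, -, -, hh⟩ := id hn
    rcases hI.step h₁ hn with ⟨hv, h₁'⟩ | ⟨hv, ha, h₁'⟩
    · have o := hI.ordered h₁'
      refine .inl ⟨hv, ⟨b, h₁', h₂⟩, ?_⟩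
      rw [hh] at o ⊢
      rw [visible_snoc_silent hv]
      exact hf.append_left o (hI.ordered h₂) subset_rfl subset_rfl
    · obtain ⟨C₀, e', C₂', ht, h₀, hn', hv', ha', h₂'⟩ := hI.exists_visible h₂
      obtain ⟨-, -, -, hh'⟩ := id hn'
      have hf₀ : IsPomsetIso P C₁.hist (Visible C₁.hist) C₀.hist (Visible C₀.hist) f := by
        have o := hI.ordered h₀
        rw [ht.visible]
        obtain ⟨t, ht⟩ := ht.reach.prefix
        rw [← ht] at o ⊢
        exact hf.append_right (hI.ordered h₁) o subset_rfl subset_rfl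
      refine .inr ⟨C₀, e', C₂', ht, ⟨⟨b, h₁, h₀⟩, hf₀⟩, hn', hv'.trans hv.symm,
        ⟨!b, h₁', h₂'⟩, ?_⟩
      have o₁ := hI.ordered h₁'
      have o₂ := hI.ordered h₂'
      simp only [hh, hh', extend, hv, if_true] at o₁ o₂ ⊢
      rw [visible_snoc_visible hv, visible_snoc_visible hv']
      exact hf₀.snoc o₁ o₂ subset_rfl subset_rfl hv hv' (ha.trans ha'.symm)
  back := by
    rintro C₁ f C₂ e C₂' ⟨⟨b, h₁, h₂⟩, hf⟩ hn
    obtain ⟨-, -, -, hh⟩ := id hn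
    rcases hI.step h₂ hn with ⟨hv, h₂'⟩ | ⟨hv, ha, h₂'⟩
    · have o := hI.ordered h₂'
      refine .inl ⟨hv, ⟨b, h₁, h₂'⟩, ?_⟩
      rw [hh] at o ⊢
      rw [visible_snoc_silent hv]
      exact hf.append_right (hI.ordered h₁) o subset_rfl subset_rfl
    · obtain ⟨C₀, e', C₁', ht, h₀, hn', hv', ha', h₁'⟩ := hI.exists_visible h₁
      obtain ⟨-, -, -, hh'⟩ := id hn'
      have hf₀ : IsPomsetIso P C₀.hist (Visible C₀.hist) C₂.hist (Visible C₂.hist) f := by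
        have o := hI.ordered h₀
        rw [ht.visible]
        obtain ⟨t, ht⟩ := ht.reach.prefix
        rw [← ht] at o ⊢
        exact hf.append_left o (hI.ordered h₂) subset_rfl subset_rfl
      refine .inr ⟨C₀, e', C₁', ht, ⟨⟨b, h₀, h₂⟩, hf₀⟩, hn', hv'.trans hv.symm,
        ⟨!b, h₁', h₂'⟩, ?_⟩
      have o₁ := hI.ordered h₁'
      have o₂ := hI.ordered h₂'
      simp only [hh, hh', extend, hv, if_true] at o₁ o₂ ⊢
      rw [visible_snoc_visible hv, visible_snoc_visible hv']
      exact hf₀.snoc o₁ o₂ subset_rfl subset_rfl hv' hv (ha'.trans ha.symm)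
  finalForth := fun _ _ _ ⟨⟨_, h₁, _⟩, _⟩ hf => absurd hf (hI.not_final h₁)
  finalBack := fun _ _ _ ⟨⟨_, _, h₂⟩, _⟩ hf => absurd hf (hI.not_final h₂)

/-! ### The root conditions. -/

/-- A configuration that has to begin with a visible event can do so at once. -/
theorem exists_first (hI : IsAlternating P lab Inv) {b C} (hC : Inv b C)
    (hv : ∀ e C', C.Next P e C' → e.vis = true) :
    ∃ e C', C.Next P e C' ∧ e.vis = true ∧ e.act = lab b ∧ Inv (!b) C' := by
  obtain ⟨C₀, e, C', ht, -, hn, h⟩ := hI.exists_visible hC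
  rcases ht.cases_head with rfl | ⟨C₁, ⟨e', hn', hv'⟩, -⟩
  · exact ⟨e, C', hn, h⟩
  · simp [hv _ _ hn'] at hv'

theorem first (hI : IsAlternating P lab Inv) {b C e C'} (hC : Inv b C)
    (hv : ∀ e C', C.Next P e C' → e.vis = true) (hn : C.Next P e C') :
    e.vis = true ∧ e.act = lab b ∧ Inv (!b) C' := by
  rcases hI.step hC hn with h | h
  · simp [hv _ _ hn] at h
  · exact h

/-- The first event of the run is visible, which excludes the case of `exists_run` in which nothing
has to be matched. -/
theorem rooted_pomset_forth (hI : IsAlternating P lab Inv) {C₁ C₂ C₁' : Config A V S}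
    {b : Bool} (h₁ : Inv b C₁) (h₂ : Inv b C₂) (hv : ∀ e C', C₁.Next P e C' → e.vis = true)
    (ht : PomsetTrans P C₁ C₁') : ∃ C₂', PomsetTrans P C₂ C₂' ∧ SamePomset P C₁ C₁' C₂ C₂' ∧
      ∃ b, Inv b C₁' ∧ Inv b C₂' := by
  obtain ⟨b', C₂', -, h₁', h₂', hs, ⟨hd, -⟩ | hd⟩ := hI.exists_run h₁ h₂ ht.to_reflTransGen
  · exfalso
    obtain ⟨C, ⟨e, hn⟩, hr⟩ := Relation.TransGen.head'_iff.1 ht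
    obtain ⟨-, -, -, hh⟩ := id hn
    obtain ⟨t, ht⟩ := Config.Reach.prefix hr
    have : C₁.hist.length ∈ NewVisible C₁ C₁' := by
      refine ⟨⟨e, ?_, hv _ _ hn⟩, le_rfl⟩
      simp [← ht, hh]
    rw [hd] at this
    exact this
  · exact ⟨C₂', hd, hs, b', h₁', h₂'⟩

/-- Two visible events are causally related, so a step that begins with a visible event contains no
other one. A single visible event of the other side matches it, whatever silent events it contains
besides. -/
theorem rooted_step_forth (hI : IsAlternating P lab Inv) {C₁ C₂ C₁' : Config A V S}
    {b : Bool} (h₁ : Inv b C₁) (h₂ : Inv b C₂) (hv₁ : ∀ e C', C₁.Next P e C' → e.vis = true)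
    (hv₂ : ∀ e C', C₂.Next P e C' → e.vis = true)
    (ht : StepTrans P C₁ C₁') : ∃ C₂', StepTrans P C₂ C₂' ∧ SamePomset P C₁ C₁' C₂ C₂' ∧
      ∃ b, Inv b C₁' ∧ Inv b C₂' := by
  obtain ⟨C, ⟨e, hn⟩, hr⟩ := Relation.TransGen.head'_iff.1 ht.1
  obtain ⟨hv, ha, hC⟩ := hI.first h₁ hv₁ hn
  obtain ⟨e', C₂', hn', hv', ha', h₂'⟩ := hI.exists_first h₂ hv₂
  obtain ⟨-, -, -, hh⟩ := id hn
  obtain ⟨-, -, -, hh'⟩ := id hn'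
  have hstep : StepTrans P C₂ C₂' := by
    refine ⟨.single ⟨e', hn'⟩, fun i j hi hc => ?_⟩
    have := hc.lt
    have := hc.lt_length
    simp [hh'] at this
    omega
  have hs : SamePomset P C₁ C C₂ C₂' :=
    samePomset_snoc_visible (samePomset_self C₁ C₂) (hI.ordered hC) (hI.ordered h₂') hh hh' hv hv'
      (ha.trans ha'.symm) le_rfl le_rfl
  refine ⟨C₂', hstep, ?_⟩
  have hconc := ht.2
  clear ht
  -- The remaining events of the step are added one at a time; all of them have to be silent, so the
  -- phase stays `!b`.
  suffices SamePomset P C₁ C₁' C₂ C₂' ∧ Inv (!b) C₁' from ⟨this.1, _, this.2, h₂'⟩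
  induction hr with
  | refl => exact ⟨hs, hC⟩
  | @tail D D' hr hd ih =>
    obtain ⟨d, hd⟩ := hd
    obtain ⟨-, -, -, hhd⟩ := id hd
    obtain ⟨t, ht⟩ := Config.Reach.prefix hr
    have hvis : C₁.hist.length ∈ Visible D'.hist := ⟨e, by simp [hhd, ← ht, hh], hv⟩
    have hlen : C₁.hist.length < D.hist.length := by simp [← ht, hh]
    -- Immediate causality depends only on the two entries concerned, so concurrency of the whole
    -- step passes to its initial parts, as the induction requires.
    have hmono : ∀ i j, Causes P D.hist i j → Causes P D'.hist i j := by
      intro i j hc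
      refine Relation.TransGen.mono ?_ _ _ hc
      rintro i j ⟨hij, a, a', h, h', hc⟩
      refine ⟨hij, a, a', ?_, ?_, hc⟩
      · rw [hhd, List.getElem?_append_left (List.getElem?_eq_some_iff.1 h).1, h]
      · rw [hhd, List.getElem?_append_left (List.getElem?_eq_some_iff.1 h').1, h']
    obtain ⟨ih₁, ih₂⟩ := ih fun i j hi hc => hconc i j hi (hmono i j hc)
    rcases hI.step ih₂ hd with ⟨hdv, h⟩ | ⟨hdv, -, h⟩
    · exact ⟨samePomset_snoc_silent ih₁ (hI.ordered h) (hI.ordered h₂') hhd hdv, h⟩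
    -- A second visible event would be caused by the first one, which stands at position
    -- `C₁.hist.length`.
    · refine absurd (((hI.ordered h).causes_iff hvis ?_).2 hlen) (hconc _ _ le_rfl)
      rw [hhd, visible_snoc_visible hdv]
      exact .inl rfl

variable {x y : Term A V S} {b : Bool}

theorem rbp (hI : IsAlternating P lab Inv) (hx : ∀ s, Inv b (.init x s))
    (hy : ∀ s, Inv b (.init y s)) (hvx : ∀ s e C', (Config.init x s).Next P e C' → e.vis = true)
    (hvy : ∀ s e C', (Config.init y s).Next P e C' → e.vis = true) : RBP P x y := fun s =>
  have hB := hI.isBranchingBisim (T := PomsetTrans P) fun _ _ => id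
  { forth := fun C₁' ht => by
      obtain ⟨C₂', ht', hs, hb⟩ := hI.rooted_pomset_forth (hx s) (hy s) (hvx s) ht
      exact ⟨C₂', ht', hs, _, hB, hb⟩
    back := fun C₂' ht => by
      obtain ⟨C₁', ht', hs, b, h₂, h₁⟩ := hI.rooted_pomset_forth (hy s) (hx s) (hvy s) ht
      exact ⟨C₁', ht', samePomset_symm hs, _, hB, b, h₁, h₂⟩
    final := iff_of_false (hI.not_final (hx s)) (hI.not_final (hy s)) }

theorem rbs (hI : IsAlternating P lab Inv) (hx : ∀ s, Inv b (.init x s))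
    (hy : ∀ s, Inv b (.init y s)) (hvx : ∀ s e C', (Config.init x s).Next P e C' → e.vis = true)
    (hvy : ∀ s e C', (Config.init y s).Next P e C' → e.vis = true) : RBS P x y := fun s =>
  have hB := hI.isBranchingBisim (T := StepTrans P) fun _ _ h => h.1
  { forth := fun C₁' ht => by
      obtain ⟨C₂', ht', hs, hb⟩ := hI.rooted_step_forth (hx s) (hy s) (hvx s) (hvy s) ht
      exact ⟨C₂', ht', hs, _, hB, hb⟩
    back := fun C₂' ht => by
      obtain ⟨C₁', ht', hs, b, h₂, h₁⟩ := hI.rooted_step_forth (hy s) (hx s) (hvy s) (hvx s) ht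
      exact ⟨C₁', ht', samePomset_symm hs, _, hB, b, h₁, h₂⟩
    final := iff_of_false (hI.not_final (hx s)) (hI.not_final (hy s)) }

theorem rbhp (hI : IsAlternating P lab Inv) (hx : ∀ s, Inv b (.init x s))
    (hy : ∀ s, Inv b (.init y s)) (hvx : ∀ s e C', (Config.init x s).Next P e C' → e.vis = true)
    (hvy : ∀ s e C', (Config.init y s).Next P e C' → e.vis = true) : RBHP P x y := by
  intro s
  -- Any first event of one side matches any first event of the other: both are visible and carry
  -- the label of the common phase.
  have key : ∀ {e e' C₁' C₂'}, (Config.init x s).Next P e C₁' → (Config.init y s).Next P e' C₂' →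
      BranchingHPBisimilar P C₁' (extend e id 0 0) C₂' := by
    intro e e' C₁' C₂' hn hn'
    obtain ⟨hv, ha, h₁⟩ := hI.first (hx s) (hvx s) hn
    obtain ⟨hv', ha', h₂⟩ := hI.first (hy s) (hvy s) hn'
    obtain ⟨-, -, -, hh⟩ := hn
    obtain ⟨-, -, -, hh'⟩ := hn'
    refine ⟨_, hI.isBranchingHPBisim, ⟨_, h₁, h₂⟩, ?_⟩
    have o₁ := hI.ordered h₁
    have o₂ := hI.ordered h₂
    simp only [hh, hh', extend, hv, if_true] at o₁ o₂ ⊢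
    rw [visible_snoc_visible hv, visible_snoc_visible hv']
    refine IsPomsetIso.snoc ?_ o₁ o₂ subset_rfl subset_rfl hv hv' (ha.trans ha'.symm)
    simp only [Config.init, visible_nil]
    exact ⟨Set.bijOn_empty _, by simp, by simp⟩
  refine ⟨fun e C₁' hn => ?_, fun e C₂' hn => ?_,
    iff_of_false (hI.not_final (hx s)) (hI.not_final (hy s))⟩
  · obtain ⟨e', C₂', hn', hv', -⟩ := hI.exists_first (hy s) (hvy s)
    exact ⟨e', C₂', hn', hv'.trans (hvx s _ _ hn).symm, key hn hn'⟩
  · obtain ⟨e', C₁', hn', hv', -⟩ := hI.exists_first (hx s) (hvx s)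
    have := key hn' hn
    refine ⟨e', C₁', hn', hv'.trans (hvy s _ _ hn).symm, ?_⟩
    simpa only [extend, hv', hvy s _ _ hn] using this

end IsAlternating

end Alternating

end APTC

namespace APTC

/-! ### Threads of a process -/

section Threads

variable {A V S : Type*} {P : Spec A V S}

/-- A multiset of located processes, moved below the location `w`. -/
def shift (w : List Dir) (M : Multiset (List Dir × Term A V S)) :
    Multiset (List Dir × Term A V S) :=
  M.map fun p => (w ++ p.1, p.2)

theorem shift_nil (M : Multiset (List Dir × Term A V S)) : shift [] M = M := by
  simp [shift]

theorem shift_zero (w : List Dir) : shift w (0 : Multiset (List Dir × Term A V S)) = 0 := rfl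

theorem shift_add (w : List Dir) (M N : Multiset (List Dir × Term A V S)) :
    shift w (M + N) = shift w M + shift w N := Multiset.map_add ..

theorem shift_singleton (w v : List Dir) (c : Term A V S) : shift w {(v, c)} = {(w ++ v, c)} := rfl

theorem shift_cons (w v : List Dir) (c : Term A V S) (M : Multiset (List Dir × Term A V S)) :
    shift w ((v, c) ::ₘ M) = (w ++ v, c) ::ₘ shift w M := Multiset.map_cons ..

theorem shift_shift (w v : List Dir) (M : Multiset (List Dir × Term A V S)) :
    shift w (shift v M) = shift (w ++ v) M := by
  simp [shift]

theorem mem_shift {w v : List Dir} {c : Term A V S} {M : Multiset (List Dir × Term A V S)} :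
    (v, c) ∈ shift w M ↔ ∃ v', (v', c) ∈ M ∧ v = w ++ v' := by
  simp only [shift, Multiset.mem_map, Prod.exists, Prod.mk.injEq]
  constructor
  · rintro ⟨a, b, h, rfl, rfl⟩; exact ⟨a, h, rfl⟩
  · rintro ⟨a, h, rfl⟩; exact ⟨a, c, h, rfl, rfl⟩

/-- The sequential components of a parallel composition, with their locations. -/
def Term.threads : Term A V S → Multiset (List Dir × Term A V S)
  | .par x y => shift [.left] x.threads + shift [.right] y.threads
  | .loc d x => shift [d] x.threads
  | .act a => {([], .act a)}
  | .guard φ => {([], .guard φ)}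
  | .alt x y => {([], .alt x y)}
  | .seq x y => {([], .seq x y)}
  | .new x => {([], .new x)}
  | .var X => {([], .var X)}
  | .encap H h x => {([], .encap H h x)}
  | .hide I x => {([], .hide I x)}

/-- The threads of a residual. -/
def threadsO (r : Option (Term A V S)) : Multiset (List Dir × Term A V S) := r.elim 0 Term.threads

theorem threadsO_some (x : Term A V S) : threadsO (some x) = x.threads := rfl

theorem threadsO_map_loc (d : Dir) (r : Option (Term A V S)) :
    threadsO (r.map (.loc d)) = shift [d] (threadsO r) := by
  cases r <;> rfl

/-- When one side terminates, the wrapper `loc` preserves the address of the other side, so the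
formula is the same for termination and for a proper residual. -/
theorem threads_parResL (r : Option (Term A V S)) (y : Term A V S) :
    (parResL r y).threads = shift [.left] (threadsO r) + shift [.right] y.threads := by
  cases r <;> simp [parResL, threadsO, Term.threads, shift_zero]

theorem threads_parResR (x : Term A V S) (r : Option (Term A V S)) :
    (parResR x r).threads = shift [.left] x.threads + shift [.right] (threadsO r) := by
  cases r <;> simp [parResR, threadsO, Term.threads, shift_zero]

theorem Eps.thread {s : S} {T : Term A V S} (h : Eps P s T) {w : List Dir} {c : Term A V S}
    (hc : (w, c) ∈ T.threads) : Eps P s c := by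
  induction T generalizing w with
  | par x y ihx ihy =>
    rcases h with ⟨⟩
    rename_i hx hy
    simp only [Term.threads, Multiset.mem_add, mem_shift] at hc
    rcases hc with ⟨v, hv, -⟩ | ⟨v, hv, -⟩
    · exact ihx hx hv
    · exact ihy hy hv
  | loc d x ih =>
    rcases h with ⟨⟩
    rename_i hx
    simp only [Term.threads, mem_shift] at hc
    obtain ⟨v, hv, -⟩ := hc
    exact ih hx hv
  | _ =>
    simp only [Term.threads, Multiset.mem_singleton, Prod.mk.injEq] at hc
    rw [hc.2]; exact h

/-- An event seen from further outside. -/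
def Event.below (w : List Dir) (e : Event A) : Event A := { e with path := w ++ e.path }

/-- The events of a process are the events of its threads. -/
theorem Trans.exists_thread {T : Term A V S} {s : S} {e : Event A} {r : Option (Term A V S)} {s' : S}
    (h : Trans P T s e r s') : ∃ w c e' r', (w, c) ∈ T.threads ∧ e = e'.below w ∧
      Trans P c s e' r' s' ∧ threadsO r + {(w, c)} = shift w (threadsO r') + T.threads := by
  induction T generalizing e r with
  | par x y ihx ihy =>
    cases h with
    | parL h =>
      obtain ⟨w, c, e', r', hc, rfl, ht, hr⟩ := ihx h
      refine ⟨.left :: w, c, e', r', ?_, rfl, ht, ?_⟩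
      · simpa [Term.threads, mem_shift] using hc
      · have := congrArg (shift [.left]) hr
        rw [shift_add, shift_add, shift_singleton, shift_shift] at this
        rw [threadsO_some, threads_parResL, add_right_comm]
        erw [this]
        rw [Term.threads, add_assoc]; rfl
    | parR h =>
      obtain ⟨w, c, e', r', hc, rfl, ht, hr⟩ := ihy h
      refine ⟨.right :: w, c, e', r', ?_, rfl, ht, ?_⟩
      · simpa [Term.threads, mem_shift] using hc
      · have := congrArg (shift [.right]) hr
        rw [shift_add, shift_add, shift_singleton, shift_shift] at this
        rw [threadsO_some, threads_parResR, add_assoc]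
        erw [this]
        rw [Term.threads, add_left_comm]; rfl
  | loc d x ih =>
    cases h with
    | loc h =>
      obtain ⟨w, c, e', r', hc, rfl, ht, hr⟩ := ih h
      refine ⟨d :: w, c, e', r', ?_, rfl, ht, ?_⟩
      · simpa [Term.threads, mem_shift] using hc
      · have := congrArg (shift [d]) hr
        rw [shift_add, shift_add, shift_singleton, shift_shift] at this
        rw [threadsO_map_loc]
        exact this
  -- Every other term is a single thread, located at the root.
  | _ =>
    refine ⟨[], _, e, r, ?_, rfl, h, ?_⟩
    · simp [Term.threads]
    · rw [shift_nil]; rfl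

/-- The events of a thread are events of the process. -/
theorem Trans.of_thread {T : Term A V S} {w : List Dir} {c : Term A V S} (hc : (w, c) ∈ T.threads)
    {s : S} {e : Event A} {r : Option (Term A V S)} {s' : S} (h : Trans P c s e r s') :
    ∃ r', Trans P T s (e.below w) r' s' ∧
      threadsO r' + {(w, c)} = shift w (threadsO r) + T.threads := by
  induction T generalizing w with
  | par x y ihx ihy =>
    simp only [Term.threads, Multiset.mem_add, mem_shift] at hc
    rcases hc with ⟨v, hv, rfl⟩ | ⟨v, hv, rfl⟩
    · obtain ⟨r', ht, hr⟩ := ihx hv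
      refine ⟨_, .parL ht, ?_⟩
      have := congrArg (shift [.left]) hr
      rw [shift_add, shift_add, shift_singleton, shift_shift] at this
      rw [threadsO_some, threads_parResL, add_right_comm, this, Term.threads, add_assoc]
    · obtain ⟨r', ht, hr⟩ := ihy hv
      refine ⟨_, .parR ht, ?_⟩
      have := congrArg (shift [.right]) hr
      rw [shift_add, shift_add, shift_singleton, shift_shift] at this
      rw [threadsO_some, threads_parResR, add_assoc, this, Term.threads, add_left_comm]
  | loc d x ih =>
    simp only [Term.threads, mem_shift] at hc
    obtain ⟨v, hv, rfl⟩ := hc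
    obtain ⟨r', ht, hr⟩ := ih hv
    refine ⟨_, .loc ht, ?_⟩
    have := congrArg (shift [d]) hr
    rw [shift_add, shift_add, shift_singleton, shift_shift] at this
    rw [threadsO_map_loc, this, Term.threads]
  | _ =>
    simp only [Term.threads, Multiset.mem_singleton, Prod.mk.injEq] at hc
    obtain ⟨rfl, rfl⟩ := hc
    exact ⟨r, h, by rw [shift_nil]; rfl⟩

/-! ### Parallel compositions of actions -/

/-- The actions of a parallel composition of actions. -/
def Term.todo : Term A V S → Multiset A
  | .act a => {a}
  | .par x y => x.todo + y.todo
  | .loc _ x => x.todo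
  | _ => 0

/-- Residuals of parallel compositions of actions. -/
def Term.Flat : Term A V S → Prop
  | .act _ => True
  | .guard φ => ∀ s, φ s
  | .par x y => x.Flat ∧ y.Flat
  | .loc _ x => x.Flat
  | _ => False

theorem Term.Flat.not_created {x : Term A V S} (hx : x.Flat) (z : Term A V S) : ¬ Created x z := by
  intro h
  induction h with
  | new => exact hx
  | par _ _ ih _ => exact ih hx.1

/-- The bracketing and the wrappers are irrelevant: for what is still to be done, the residual is
described by the multiset `todo`, which loses exactly the executed action. -/
theorem Term.Flat.trans {x : Term A V S} (hx : x.Flat) {s : S} {e : Event A}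
    {r : Option (Term A V S)} {s' : S} (h : Trans P x s e r s') :
    e.vis = true ∧ s' ∈ P.effect e.act s ∧ (∀ y, r = some y → y.Flat) ∧
      x.todo = e.act ::ₘ r.elim 0 Term.todo := by
  induction h with
  | act h => exact ⟨rfl, h, by simp, rfl⟩
  | @parL x y s e r s' h ih =>
    obtain ⟨h1, h2, h3, h4⟩ := ih hx.1
    refine ⟨h1, h2, ?_, ?_⟩
    · rintro _ ⟨⟩
      cases r with
      | none => exact hx.2
      | some x' => exact ⟨h3 _ rfl, hx.2⟩
    · cases r <;> simp [Term.todo, h4, parResL, Event.under]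
  | @parR x y s e r s' h ih =>
    obtain ⟨h1, h2, h3, h4⟩ := ih hx.2
    refine ⟨h1, h2, ?_, ?_⟩
    · rintro _ ⟨⟩
      cases r with
      | none => exact hx.1
      | some x' => exact ⟨hx.1, h3 _ rfl⟩
    · cases r <;> simp [Term.todo, h4, parResR, Event.under]
      rw [add_comm, Multiset.singleton_add]
  | @loc d x s e r s' h ih =>
    obtain ⟨h1, h2, h3, h4⟩ := ih hx
    refine ⟨h1, h2, ?_, ?_⟩
    · cases r with
      | none => simp
      | some x' => rintro _ ⟨⟩; exact h3 x' rfl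
    · cases r <;> simp [Term.todo, h4, Event.under]
  | _ => exact hx.elim

theorem Term.exists_trans_of_mem_todo {x : Term A V S} {a : A} (ha : a ∈ x.todo) :
    ∃ e r, e.act = a ∧ ∀ s s', s' ∈ P.effect a s → Trans P x s e r s' := by
  induction x with
  | act b =>
    simp only [Term.todo, Multiset.mem_singleton] at ha
    subst ha
    exact ⟨_, _, rfl, fun _ _ hs => .act hs⟩
  | par x y ihx ihy =>
    rcases Multiset.mem_add.1 ha with h | h
    · obtain ⟨e, r, he, h⟩ := ihx h
      exact ⟨e.under .left, _, he, fun s s' hs => .parL (h s s' hs)⟩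
    · obtain ⟨e, r, he, h⟩ := ihy h
      exact ⟨e.under .right, _, he, fun s s' hs => .parR (h s s' hs)⟩
  | loc d x ih =>
    obtain ⟨e, r, he, h⟩ := ih ha
    exact ⟨e.under d, _, he, fun s s' hs => .loc (h s s' hs)⟩
  | _ => simp [Term.todo] at ha

/-- The only guards admitted in a flat term always hold, so nothing but a pending action can prevent
termination. -/
theorem Term.Flat.eps_iff {x : Term A V S} (hx : x.Flat) {s : S} : Eps P s x ↔ x.todo = 0 := by
  induction x with
  | act a =>
    refine iff_of_false (fun h => nomatch h) (by simp [Term.todo])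
  | guard φ => exact iff_of_true (.guard (hx s)) rfl
  | par x y ihx ihy =>
    simp only [Term.todo, add_eq_zero, ← ihx hx.1, ← ihy hx.2]
    exact ⟨fun h => by cases h with | par a b => exact ⟨a, b⟩, fun h => .par h.1 h.2⟩
  | loc d x ih =>
    simp only [Term.todo, ← ih hx]
    exact ⟨fun h => by cases h with | loc a => exact a, .loc⟩
  | _ => exact hx.elim

theorem flat_parList_act (l : List A) :
    (Term.parList (l.map .act) : Term A V S).Flat ∧
      (Term.parList (l.map .act) : Term A V S).todo = l := by
  induction l with
  | nil => exact ⟨fun _ => trivial, rfl⟩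
  | cons a l ih =>
    cases l with
    | nil => exact ⟨trivial, rfl⟩
    | cons b l =>
      refine ⟨⟨trivial, ih.1⟩, ?_⟩
      change {a} + Term.todo (Term.parList _) = _
      erw [ih.2]; rfl

/-- The list has to be non-empty: the empty composition is `ε`, which creates nothing and is passed
as a guard. -/
theorem created_parList_new {a : Term A V S} {l : List (Term A V S)} {z : Term A V S} :
    Created (Term.parList ((a :: l).map .new)) z ↔ z = Term.parList (a :: l) := by
  induction l generalizing a z with
  | nil =>
    constructor
    · rintro ⟨⟩; rfl
    · rintro rfl; exact .new _
  | cons b l ih =>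
    constructor
    · intro h
      cases h with
      | par h1 h2 =>
        cases h1
        rw [ih.1 h2]; rfl
    · rintro rfl
      exact .par (.new _) (ih.2 rfl)

theorem map_snd_shift (w : List Dir) (M : Multiset (List Dir × Term A V S)) :
    (shift w M).map Prod.snd = M.map Prod.snd := by
  simp [shift]

theorem map_snd_threads_parList {a : Term A V S} {l : List (Term A V S)}
    (h : ∀ x ∈ a :: l, x.threads = {([], x)}) :
    (Term.parList (a :: l)).threads.map Prod.snd = (a :: l : List _) := by
  induction l generalizing a with
  | nil => simp [Term.parList, h a (by simp)]
  | cons b l ih =>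
    have := ih fun x hx => h x (List.mem_cons_of_mem _ hx)
    simp only [Term.parList, Term.threads, Multiset.map_add, map_snd_shift, this,
      h a (by simp)]
    rfl

end Threads

end APTC

namespace MapReduce

open APTC

/-! ## The actors -/

section Actors

variable {m n : ℕ} {L D : Type*}

/-- The Map and Reduce actors. -/
abbrev Worker (m n : ℕ) := Fin m ⊕ Fin n

/-- The name of a worker. -/
def who : Worker m n → Actor m n
  | .inl i => .map i
  | .inr j => .red j

theorem who_injective : Function.Injective (who : Worker m n → Actor m n) := by
  rintro (i | i) (j | j) h <;> simp_all [who]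

theorem who_ne_mas (w : Worker m n) : who w ≠ .mas := by
  cases w <;> simp [who]

/-- The local computation of a worker. -/
def Code.work (c : Code m n L D) : Worker m n → Local L D := Sum.elim c.map c.red

/-- The recursion variable of a worker that waits for a message. -/
def resting : Worker m n → Var m n
  | .inl i => .map i
  | .inr j => .red j

/-- The recursion variable of a worker that has got a message. -/
def working : Worker m n → Var m n
  | .inl i => .map1 i
  | .inr j => .red1 j

/-- The recursion variable of a worker that is going to answer. -/
def answering : Worker m n → Var m n
  | .inl i => .map2 i
  | .inr j => .red2 j

/-- The Master sends the input of a worker. -/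
def sendIn (w : Worker m n) : Act m n L := .send (.actor (who w)) (.din (who w))

/-- A worker reads its input. -/
def recvIn (w : Worker m n) : Act m n L := .recv (.actor (who w)) (.din (who w))

/-- A worker sends its output. -/
def sendOut (w : Worker m n) : Act m n L := .send (.actor .mas) (.dout (who w))

/-- The Master reads the output of a worker. -/
def recvOut (w : Worker m n) : Act m n L := .recv (.actor .mas) (.dout (who w))

/-- The visible actions: the request that ends the idle phase `false`, and the reply that ends the
busy phase `true`. -/
def external : Bool → Act m n L
  | false => .recv (.actor .mas) (.din .mas)
  | true => .send .out (.dout .mas)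

/-- Map and Reduce actors follow the same protocol, so the four families of constraints become two,
uniformly in the worker. -/
theorem causality_iff {a b : Act m n L} : Causality a b ↔
    ∃ w, (a = sendIn w ∧ b = recvIn w) ∨ (a = sendOut w ∧ b = recvOut w) := by
  constructor
  · rintro (i | i | j | j)
    · exact ⟨.inl i, .inl ⟨rfl, rfl⟩⟩
    · exact ⟨.inl i, .inr ⟨rfl, rfl⟩⟩
    · exact ⟨.inr j, .inl ⟨rfl, rfl⟩⟩
    · exact ⟨.inr j, .inr ⟨rfl, rfl⟩⟩
  · rintro ⟨i | j, ⟨rfl, rfl⟩ | ⟨rfl, rfl⟩⟩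
    · exact .mapIn i
    · exact .mapOut i
    · exact .redIn j
    · exact .redOut j

theorem sendIn_injective : Function.Injective (sendIn : Worker m n → Act m n L) := by
  intro w w' h
  simp only [sendIn, Act.send.injEq, Box.actor.injEq] at h
  exact who_injective h.1

theorem recvIn_injective : Function.Injective (recvIn : Worker m n → Act m n L) := by
  intro w w' h
  simp only [recvIn, Act.recv.injEq, Box.actor.injEq] at h
  exact who_injective h.1

theorem sendOut_injective : Function.Injective (sendOut : Worker m n → Act m n L) := by
  intro w w' h
  simp only [sendOut, Act.send.injEq, Msg.dout.injEq] at h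
  exact who_injective h.2

theorem recvOut_injective : Function.Injective (recvOut : Worker m n → Act m n L) := by
  intro w w' h
  simp only [recvOut, Act.recv.injEq, Msg.dout.injEq] at h
  exact who_injective h.2

/-- A read has exactly one matching send, so the quantifier in `Respects` reduces to one comparison.
-/
theorem respects_recvIn {h : Multiset (Act m n L)} {w : Worker m n} :
    Respects Causality h (recvIn w) ↔
      open Classical in h.count (recvIn w) < h.count (sendIn w) := by
  classical
  constructor
  · intro hr
    convert hr (sendIn w) (causality_iff.2 ⟨w, .inl ⟨rfl, rfl⟩⟩)
  · intro hr b hb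
    obtain ⟨w', ⟨rfl, h⟩ | ⟨rfl, h⟩⟩ := causality_iff.1 hb
    · obtain rfl := recvIn_injective h
      convert hr
    · simp only [recvIn, recvOut, Act.recv.injEq] at h
      simp at h

theorem respects_recvOut {h : Multiset (Act m n L)} {w : Worker m n} :
    Respects Causality h (recvOut w) ↔
      open Classical in h.count (recvOut w) < h.count (sendOut w) := by
  classical
  constructor
  · intro hr
    convert hr (sendOut w) (causality_iff.2 ⟨w, .inr ⟨rfl, rfl⟩⟩)
  · intro hr b hb
    obtain ⟨w', ⟨rfl, h⟩ | ⟨rfl, h⟩⟩ := causality_iff.1 hb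
    · simp only [recvIn, recvOut, Act.recv.injEq] at h
      simp at h
    · obtain rfl := recvOut_injective h
      convert hr

theorem respects_send {h : Multiset (Act m n L)} {b d} : Respects Causality h (.send b d) := by
  intro a ha
  obtain ⟨w', ⟨rfl, h⟩ | ⟨rfl, h⟩⟩ := causality_iff.1 ha <;> cases h

theorem mem_H_iff {a : Act m n L} :
    a ∈ H ↔ ∃ w, a = sendIn w ∨ a = recvIn w ∨ a = sendOut w ∨ a = recvOut w := by
  simp only [H, Set.mem_ofPred_eq, causality_iff]
  constructor
  · rintro ⟨b, ⟨w, ⟨rfl, -⟩ | ⟨rfl, -⟩⟩ | ⟨w, ⟨-, rfl⟩ | ⟨-, rfl⟩⟩⟩ <;> exact ⟨w, by simp⟩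
  · rintro ⟨w, rfl | rfl | rfl | rfl⟩
    · exact ⟨recvIn w, .inl ⟨w, .inl ⟨rfl, rfl⟩⟩⟩
    · exact ⟨sendIn w, .inr ⟨w, .inl ⟨rfl, rfl⟩⟩⟩
    · exact ⟨recvOut w, .inl ⟨w, .inr ⟨rfl, rfl⟩⟩⟩
    · exact ⟨sendOut w, .inr ⟨w, .inr ⟨rfl, rfl⟩⟩⟩

theorem sendIn_mem_H (w : Worker m n) : (sendIn w : Act m n L) ∈ H := mem_H_iff.2 ⟨w, by simp⟩

theorem recvIn_mem_H (w : Worker m n) : (recvIn w : Act m n L) ∈ H := mem_H_iff.2 ⟨w, by simp⟩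

theorem sendOut_mem_H (w : Worker m n) : (sendOut w : Act m n L) ∈ H := mem_H_iff.2 ⟨w, by simp⟩

theorem recvOut_mem_H (w : Worker m n) : (recvOut w : Act m n L) ∈ H := mem_H_iff.2 ⟨w, by simp⟩

theorem external_notMem_I (b : Bool) : (external b : Act m n L) ∉ I := by
  simp only [I, Set.mem_union, mem_H_iff, Set.mem_ofPred_eq]
  rintro (⟨w, h⟩ | ⟨b', l, h⟩)
  · cases b <;> simp [external, sendIn, recvIn, sendOut, recvOut] at h
    exact who_ne_mas w h.symm
  · cases b <;> simp [external] at h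

theorem loc_mem_I (a : Actor m n) (l : L) : (.loc a l : Act m n L) ∈ I := .inr ⟨a, l, rfl⟩

/-! ### Local computations -/

variable {eff : L → D → Set D} {c : Code m n L D}

/-- Residuals of local computations of the actor `a`. -/
def IsLocal (a : Actor m n) : Proc m n L D → Prop
  | .act b => ∃ l, b = .loc a l
  | .guard φ => ∀ s t, s a = t a → φ s → φ t
  | .alt x y => IsLocal a x ∧ IsLocal a y
  | .seq x y => IsLocal a x ∧ IsLocal a y
  | .par x y => IsLocal a x ∧ IsLocal a y
  | .loc _ x => IsLocal a x
  | _ => False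

theorem isLocal_toProc (a : Actor m n) (p : Local L D) : IsLocal a (p.toProc a) := by
  induction p with
  | act l => exact ⟨l, rfl⟩
  | guard φ => intro s t h hs; simpa only [h] using hs
  | _ => exact ⟨‹_›, ‹_›⟩

theorem IsLocal.not_created {a : Actor m n} {x : Proc m n L D} (hx : IsLocal a x)
    (z : Proc m n L D) : ¬ Created x z := by
  intro h
  induction h with
  | new => exact hx
  | par _ _ ih _ => exact ih hx.1

theorem IsLocal.eps {a : Actor m n} {x : Proc m n L D} (hx : IsLocal a x) {s t : Data m n D}
    (hst : s a = t a) (h : Eps (spec eff c) s x) : Eps (spec eff c) t x := by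
  induction h with
  | guard h => exact .guard (hx _ _ hst h)
  | altL _ ih => exact .altL (ih hx.1)
  | altR _ ih => exact .altR (ih hx.2)
  | seq _ _ ih₁ ih₂ => exact .seq (ih₁ hx.1) (ih₂ hx.2)
  | par _ _ ih₁ ih₂ => exact .par (ih₁ hx.1) (ih₂ hx.2)
  | loc _ ih => exact .loc (ih hx)
  | _ => exact hx.elim

/-- The last clause is a frame property: the transition can be replayed with any data of the other
actors. Through it a computation that can finish alone can also finish inside the system. -/
theorem IsLocal.trans {a : Actor m n} {x : Proc m n L D} (hx : IsLocal a x) {s : Data m n D}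
    {e : Event (Act m n L)} {r : Option (Proc m n L D)} {s' : Data m n D}
    (h : Trans (spec eff c) x s e r s') :
    (∀ y, r = some y → IsLocal a y) ∧ (∃ l, e.act = .loc a l) ∧ e.vis = true ∧
      (∀ b, b ≠ a → s' b = s b) ∧
      ∀ t t', t a = s a → t' a = s' a → (∀ b, b ≠ a → t' b = t b) →
        Trans (spec eff c) x t e r t' := by
  induction h with
  | act h =>
    obtain ⟨l, rfl⟩ := hx
    refine ⟨by simp, ⟨l, rfl⟩, rfl, h.2, fun t t' h₁ h₂ h₃ => .act ⟨?_, h₃⟩⟩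
    rw [h₁, h₂]; exact h.1
  | altL _ ih =>
    obtain ⟨h₁, h₂, h₃, h₄, h₅⟩ := ih hx.1
    exact ⟨h₁, h₂, h₃, h₄, fun t t' a₁ a₂ a₃ => .altL (h₅ t t' a₁ a₂ a₃)⟩
  | altR _ ih =>
    obtain ⟨h₁, h₂, h₃, h₄, h₅⟩ := ih hx.2
    exact ⟨h₁, h₂, h₃, h₄, fun t t' a₁ a₂ a₃ => .altR (h₅ t t' a₁ a₂ a₃)⟩
  | @seqFirst _ _ _ _ r _ hn _ ih =>
    obtain ⟨h₁, h₂, h₃, h₄, h₅⟩ := ih hx.1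
    refine ⟨?_, h₂, h₃, h₄, fun t t' a₁ a₂ a₃ => .seqFirst hn (h₅ t t' a₁ a₂ a₃)⟩
    rintro _ ⟨⟩
    cases r with
    | none => exact hx.2
    | some y => exact ⟨h₁ y rfl, hx.2⟩
  | @seqNext _ _ _ _ r _ hn he _ ih =>
    obtain ⟨h₁, h₂, h₃, h₄, h₅⟩ := ih hx.2
    refine ⟨?_, h₂, h₃, h₄,
      fun t t' a₁ a₂ a₃ => .seqNext hn (hx.1.eps a₁.symm he) (h₅ t t' a₁ a₂ a₃)⟩
    cases r with
    | none => simp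
    | some y => rintro _ ⟨⟩; exact h₁ y rfl
  | seqNew hc _ _ => exact (hx.1.not_created _ hc).elim
  | @parL _ _ _ _ r _ _ ih =>
    obtain ⟨h₁, h₂, h₃, h₄, h₅⟩ := ih hx.1
    refine ⟨?_, h₂, h₃, h₄, fun t t' a₁ a₂ a₃ => .parL (h₅ t t' a₁ a₂ a₃)⟩
    rintro _ ⟨⟩
    cases r with
    | none => exact hx.2
    | some y => exact ⟨h₁ y rfl, hx.2⟩
  | @parR _ _ _ _ r _ _ ih =>
    obtain ⟨h₁, h₂, h₃, h₄, h₅⟩ := ih hx.2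
    refine ⟨?_, h₂, h₃, h₄, fun t t' a₁ a₂ a₃ => .parR (h₅ t t' a₁ a₂ a₃)⟩
    rintro _ ⟨⟩
    cases r with
    | none => exact hx.1
    | some y => exact ⟨hx.1, h₁ y rfl⟩
  | @loc _ _ _ _ r _ _ ih =>
    obtain ⟨h₁, h₂, h₃, h₄, h₅⟩ := ih hx
    refine ⟨?_, h₂, h₃, h₄, fun t t' a₁ a₂ a₃ => .loc (h₅ t t' a₁ a₂ a₃)⟩
    cases r with
    | none => simp
    | some y => rintro _ ⟨⟩; exact h₁ y rfl
  | _ => exact hx.elim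

theorem exists_data_update (a : Actor m n) (s : Data m n D) (d : D) :
    ∃ s' : Data m n D, s' a = d ∧ ∀ b, b ≠ a → s' b = s b := by
  classical
  exact ⟨Function.update s a d, Function.update_self .., fun b hb => Function.update_of_ne hb _ _⟩

variable (eff c) in
/-- A transition of a local computation of `a`, which depends on the data of `a` only. -/
def LocalStep (a : Actor m n) (p q : Option (Proc m n L D) × D) : Prop :=
  ∃ x e s s', p.1 = some x ∧ s a = p.2 ∧ s' a = q.2 ∧ Trans (spec eff c) x s e q.1 s'

variable (eff c) in
/-- The local computation can terminate. -/
def LocalFinal (a : Actor m n) (p : Option (Proc m n L D) × D) : Prop :=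
  ∀ x, p.1 = some x → ∃ s : Data m n D, s a = p.2 ∧ Eps (spec eff c) s x

variable (eff c) in
/-- The residual `x` of a local computation of `a` can terminate from the local data `d`, whatever
it does before. -/
def Live (a : Actor m n) (x : Proc m n L D) (d : D) : Prop :=
  IsLocal a x ∧ ∀ q, Relation.ReflTransGen (LocalStep eff c a) (some x, d) q →
    ∃ q', Relation.ReflTransGen (LocalStep eff c a) q q' ∧ LocalFinal eff c a q'

theorem Live.trans {a : Actor m n} {x : Proc m n L D} {s : Data m n D} (hx : Live eff c a x (s a))
    {e : Event (Act m n L)} {y : Proc m n L D} {s' : Data m n D}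
    (h : Trans (spec eff c) x s e (some y) s') : Live eff c a y (s' a) :=
  ⟨(hx.1.trans h).1 y rfl, fun q hq =>
    hx.2 q (.head ⟨x, e, s, s', rfl, rfl, rfl, h⟩ hq)⟩

/-- In a sequence of `LocalStep`s the data of the other actors may change arbitrarily from one step
to the next. The frame property turns it into a run of the process alone from a constant data state;
the hypothesis prolongs that run to termination, and the continuation is projected back to local
data. -/
theorem live_toProc {a : Actor m n} {p : Local L D}
    (h : CanAlwaysFinish (spec eff c) (p.toProc a)) (d : D) : Live eff c a (p.toProc a) d := by
  refine ⟨isLocal_toProc a p, fun q hq => ?_⟩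
  have key : ∃ C, (Config.init (p.toProc a) fun _ => d).Reach (spec eff c) C ∧
      C.proc = q.1 ∧ C.data a = q.2 ∧ ∀ y, q.1 = some y → IsLocal a y := by
    induction hq with
    | refl =>
      refine ⟨_, .refl, rfl, rfl, ?_⟩
      rintro _ ⟨⟩
      exact isLocal_toProc a p
    | @tail q q' _ hs ih =>
      obtain ⟨C, hr, h₁, h₂, h₃⟩ := ih
      obtain ⟨x, e, s, s', hx, hs, hs', ht⟩ := hs
      obtain ⟨g₁, -, -, -, g₅⟩ := (h₃ x hx).trans ht
      obtain ⟨t, ht₁, ht₂⟩ := exists_data_update a C.data (s' a)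
      refine ⟨⟨q'.1, t, C.hist ++ [e]⟩, hr.tail ⟨e, x, h₁.trans hx, ?_, rfl⟩, rfl,
        ht₁.trans hs', g₁⟩
      exact g₅ _ _ (h₂.trans hs.symm) ht₁ ht₂
  obtain ⟨C, hr, h₁, h₂, -⟩ := key
  obtain ⟨C', hr', hf⟩ := h _ C hr
  refine ⟨(C'.proc, C'.data a), ?_, fun x hx => ⟨C'.data, rfl, hf x hx⟩⟩
  have := hr'.lift (r := fun C C' => ∃ e, Config.Next (spec eff c) C e C')
    (p := LocalStep eff c a) (fun C => (C.proc, C.data a))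
    fun C C' ⟨e, x, hx, ht, _⟩ => ⟨x, e, C.data, C'.data, hx, rfl, rfl, ht⟩
  simpa only [Function.onFun, h₁, h₂] using this

/-! ### Reaching an action -/

variable (eff c) in
/-- The thread `x` of the actor `a` with local data `d` can reach the action `g`, if the environment
lets it execute the actions in `K`. -/
inductive Go (a : Actor m n) (K : Set (Act m n L)) (g : Act m n L) : Proc m n L D → D → Prop
  | goal {x d} : (∀ s : Data m n D, s a = d →
      ∃ e r s', Trans (spec eff c) x s e r s' ∧ e.act = g) → Go a K g x d
  | step {x d y d' k} : k ∈ K → (∀ w, y ≠ .var (resting w)) →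
      (∀ s : Data m n D, s a = d → ∃ e r s' v, Trans (spec eff c) x s e r s' ∧ s' a = d' ∧
        e.act = k ∧ (v, y) ∈ threadsO r) → Go a K g y d' → Go a K g x d

variable {a : Actor m n} {K : Set (Act m n L)} {g : Act m n L}

/-- `Go` inspects only the first transition of the thread, so it is enough to imitate that one. The
imitation may leave additional threads behind, as the creation of actors does. -/
theorem Go.mono {x y : Proc m n L D} {d : D} (hx : Go eff c a K g x d)
    (h : ∀ s e r s', s a = d → Trans (spec eff c) x s e r s' →
      ∃ e' r' v, Trans (spec eff c) y s e' r' s' ∧ e'.act = e.act ∧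
        ∀ p ∈ shift v (threadsO r), p ∈ threadsO r') : Go eff c a K g y d := by
  cases hx with
  | goal hg =>
    refine .goal fun s hs => ?_
    obtain ⟨e, r, s', ht, he⟩ := hg s hs
    obtain ⟨e', r', v, ht', he', -⟩ := h s e r s' hs ht
    exact ⟨e', r', s', ht', he'.trans he⟩
  | step hk hw hst hg =>
    refine .step hk hw (fun s hs => ?_) hg
    obtain ⟨e, r, s', v, ht, hs', he, hv⟩ := hst s hs
    obtain ⟨e', r', v', ht', he', hr⟩ := h s e r s' hs ht
    exact ⟨e', r', s', v' ++ v, ht', hs', he'.trans he, hr _ (mem_shift.2 ⟨v, hv, rfl⟩)⟩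

theorem Go.var {X : Var m n} {d : D} (h : Go eff c a K g (eqn c X) d) :
    Go eff c a K g (.var X) d :=
  h.mono fun _ e r _ _ ht => ⟨e, r, [], .var ht, rfl, by simp [shift_nil]⟩

theorem Go.skip {x y : Proc m n L D} {d : D} (hx : ∀ z, ¬ Created x z)
    (he : ∀ s : Data m n D, s a = d → Eps (spec eff c) s x) (h : Go eff c a K g y d) :
    Go eff c a K g (.seq x y) d :=
  h.mono fun s _ _ _ hs ht => ⟨_, _, [.next], .seqNext hx (he s hs) ht, rfl, by
    simp [threadsO_map_loc]⟩

/-- Liveness provides a terminating run of the computation, and the path to `g` is built along it,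
backwards from its end. The condition on `k` is there because `Go.step` never follows a resting
worker. -/
theorem Go.compute {k : Var m n} (hK : ∀ l, .loc a l ∈ K) (hk : ∀ w, k ≠ resting w)
    (h : ∀ d, Go eff c a K g (.var k) d) {x : Proc m n L D} {d : D} (hx : Live eff c a x d) :
    Go eff c a K g (.seq x (.var k)) d := by
  obtain ⟨q, hq, hf⟩ := hx.2 _ .refl
  have key : ∀ p, Relation.ReflTransGen (LocalStep eff c a) p q → ∀ x, p.1 = some x →
      IsLocal a x → Go eff c a K g (.seq x (.var k)) p.2 := by
    intro p hp
    induction hp using Relation.ReflTransGen.head_induction_on with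
    | refl =>
      intro x hx hl
      obtain ⟨s, hs, he⟩ := hf x hx
      exact .skip hl.not_created (fun t ht => hl.eps (hs.trans ht.symm) he) (h _)
    | @head p p' hs _ ih =>
      intro x hx hl
      obtain ⟨x', e, s, s', hx', hs, hs', ht⟩ := hs
      obtain rfl : x = x' := Option.some_injective _ (hx.symm.trans hx')
      obtain ⟨h₁, ⟨l, hel⟩, -, -, h₅⟩ := hl.trans ht
      have htr : ∀ t : Data m n D, t a = p.2 → ∃ t', t' a = p'.2 ∧
          Trans (spec eff c) (.seq x (.var k)) t (e.under .first)
            (some (seqRes p'.1 (.var k))) t' := by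
        intro t hta
        obtain ⟨t', ht', htb⟩ := exists_data_update a t p'.2
        exact ⟨t', ht', .seqFirst hl.not_created
          (h₅ t t' (hta.trans hs.symm) (ht'.trans hs'.symm) htb)⟩
      -- The computation may end with this event, which leaves the thread `k` itself; otherwise the
      -- induction hypothesis applies to the residual.
      rcases hr : p'.1 with _ | y
      · refine .step (hK l) (y := .var k) ?_ (fun t hta => ?_) (h p'.2)
        · simpa using hk
        · obtain ⟨t', ht', htt⟩ := htr t hta
          exact ⟨_, _, t', [.next], htt, ht', hel, by
            simp [hr, seqRes, threadsO_some, Term.threads, shift_singleton]⟩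
      · refine .step (hK l) (y := .seq y (.var k)) (by simp) (fun t hta => ?_)
          (ih y hr (h₁ y hr))
        obtain ⟨t', ht', htt⟩ := htr t hta
        exact ⟨_, _, t', [], htt, ht', hel, by
          simp [hr, seqRes, threadsO_some, Term.threads]⟩
  exact key _ hq x rfl hx.1

/-- Induction on the number of pending actions. They can be executed in any order, without changing
the data. -/
theorem Go.flat {k : Var m n} (hk : ∀ w, k ≠ resting w)
    (h : ∀ d, Go eff c a K g (.var k) d) {x : Proc m n L D} {d : D} (hx : x.Flat)
    (hxK : ∀ b ∈ x.todo, b ∈ K ∧ ∀ s : Data m n D, s ∈ effect eff b s) :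
    Go eff c a K g (.seq x (.var k)) d := by
  obtain ⟨N, hN⟩ : ∃ N, x.todo.card = N := ⟨_, rfl⟩
  induction N generalizing x with
  | zero =>
    exact .skip hx.not_created (fun s _ => hx.eps_iff.2 (Multiset.card_eq_zero.1 hN)) (h d)
  | succ N ih =>
    obtain ⟨b, hb⟩ := Multiset.card_pos_iff_exists_mem.1 (by omega : 0 < x.todo.card)
    obtain ⟨e, r, rfl, ht⟩ := Term.exists_trans_of_mem_todo (P := spec eff c) hb
    have ht : ∀ s, Trans (spec eff c) x s e r s := fun s => ht s s ((hxK _ hb).2 s)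
    obtain ⟨-, -, hr, hd⟩ := hx.trans (ht fun _ => d)
    cases r with
    | none =>
      refine .step (hxK _ hb).1 (y := .var k) ?_ (fun t hta => ?_) (h d)
      · simpa using hk
      · exact ⟨_, _, t, [.next], .seqFirst hx.not_created (ht t), hta, rfl, by
          simp [seqRes, threadsO_some, Term.threads, shift_singleton]⟩
    | some y =>
      refine .step (hxK _ hb).1 (y := .seq y (.var k)) (by simp) (fun t hta => ?_)
        (ih (hr y rfl) (fun b hb => hxK b ?_) ?_)
      · exact ⟨_, _, t, [], .seqFirst hx.not_created (ht t), hta, rfl, by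
          simp [seqRes, threadsO_some, Term.threads]⟩
      · rw [hd]; exact Multiset.mem_cons_of_mem hb
      · rw [hd] at hN; simpa using hN

end Actors

end MapReduce

namespace MapReduce

open APTC

section Threads

variable {m n : ℕ} {L D : Type*} {eff : L → D → Set D} {c : Code m n L D}

/-! ### The threads of the workers -/

theorem eqn_resting (w : Worker m n) :
    eqn c (resting w) = .seq (.act (recvIn w)) (.var (working w)) := by
  cases w <;> rfl

theorem eqn_working (w : Worker m n) :
    eqn c (working w) = .seq ((c.work w).toProc (who w)) (.var (answering w)) := by
  cases w <;> rfl

theorem eqn_answering (w : Worker m n) :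
    eqn c (answering w) = .seq (.act (sendOut w)) (.var (resting w)) := by
  cases w <;> rfl

theorem not_created_act {A V S : Type*} {a : A} (z : Term A V S) : ¬ Created (.act a) z := nofun

theorem act_seq_trans {A V S : Type*} {P : Spec A V S} {a : A} {y : Term A V S} {s : S} {e : Event A}
    {r : Option (Term A V S)} {s' : S} (h : Trans P (.seq (.act a) y) s e r s') :
    e = ⟨[.first], a, true⟩ ∧ s' ∈ P.effect a s ∧ r = some (.loc .next y) := by
  cases h with
  | seqFirst _ h => cases h with | act h => exact ⟨rfl, h, rfl⟩
  | seqNext _ h => cases h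
  | seqNew h => cases h

theorem resting_trans {w : Worker m n} {s : Data m n D} {e : Event (Act m n L)}
    {r : Option (Proc m n L D)} {s' : Data m n D}
    (h : Trans (spec eff c) (.var (resting w)) s e r s') :
    e.vis = true ∧ e.act = recvIn w ∧ s' = s ∧ threadsO r = {([.next], .var (working w))} := by
  cases h with
  | var h =>
    change Trans _ (eqn c _) _ _ _ _ at h
    rw [eqn_resting] at h
    obtain ⟨rfl, hs, rfl⟩ := act_seq_trans h
    exact ⟨rfl, rfl, hs, rfl⟩

/-- Threads of a worker between reading its input and sending its output. -/
def Running (w : Worker m n) (x : Proc m n L D) : Prop :=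
  x = .var (working w) ∨ x = .var (answering w) ∨ ∃ y, x = .seq y (.var (answering w))

variable (eff c) in
/-- The local computation in progress in a thread of a worker can terminate. -/
def RunLive (w : Worker m n) (x : Proc m n L D) (d : D) : Prop :=
  ∀ y X, x = .seq y (.var X) → Live eff c (who w) y d

theorem working_ne_resting (w w' : Worker m n) : working w ≠ resting w' := by
  cases w <;> cases w' <;> simp [working, resting]

theorem answering_ne_resting (w w' : Worker m n) : answering w ≠ resting w' := by
  cases w <;> cases w' <;> simp [answering, resting]

theorem answering_ne_working (w w' : Worker m n) : answering w ≠ working w' := by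
  cases w <;> cases w' <;> simp [answering, working]

theorem working_injective : Function.Injective (working : Worker m n → Var m n) := by
  rintro (i | i) (j | j) h <;> simp_all [working]

theorem answering_injective : Function.Injective (answering : Worker m n → Var m n) := by
  rintro (i | i) (j | j) h <;> simp_all [answering]

theorem Running.ne_resting {w : Worker m n} {x : Proc m n L D} (h : Running w x) (w' : Worker m n) :
    x ≠ .var (resting w') := by
  rcases h with rfl | rfl | ⟨y, rfl⟩
  · simpa using working_ne_resting w w'
  · simpa using answering_ne_resting w w'
  · simp

/-- The variable that constitutes or ends a running thread reveals the name of the worker. -/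
theorem Running.unique {w w' : Worker m n} {x : Proc m n L D} (h : Running w x)
    (h' : Running w' x) : w = w' := by
  rcases h with rfl | rfl | ⟨y, rfl⟩ <;> rcases h' with h' | h' | ⟨y', h'⟩ <;>
    simp only [Term.var.injEq, Term.seq.injEq, reduceCtorEq] at h'
  · exact working_injective h'
  · exact (answering_ne_working _ _ h'.symm).elim
  · exact (answering_ne_working _ _ h').elim
  · exact answering_injective h'
  · exact answering_injective h'.2

/-- What a running thread of a worker can do. -/
def RunOut (eff : L → D → Set D) (c : Code m n L D) (w : Worker m n) (s : Data m n D)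
    (e : Event (Act m n L)) (r : Option (Proc m n L D)) (s' : Data m n D) : Prop :=
  e.vis = true ∧ ∃ v x, threadsO r = {(v, x)} ∧
    ((e.act = sendOut w ∧ s' = s ∧ x = .var (resting w)) ∨
      ((∃ l, e.act = .loc (who w) l) ∧ (∀ b, b ≠ who w → s' b = s b) ∧
        Running w x ∧ RunLive eff c w x (s' (who w))))

theorem answering_trans {w : Worker m n} {s : Data m n D} {e : Event (Act m n L)}
    {r : Option (Proc m n L D)} {s' : Data m n D}
    (h : Trans (spec eff c) (.var (answering w)) s e r s') : RunOut eff c w s e r s' := by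
  cases h with
  | var h =>
    change Trans _ (eqn c _) _ _ _ _ at h
    rw [eqn_answering] at h
    obtain ⟨rfl, hs, rfl⟩ := act_seq_trans h
    exact ⟨rfl, _, _, rfl, .inl ⟨rfl, hs, rfl⟩⟩

/-- The computation may be able to terminate without an event, and then the event is already the
sending of the answer. -/
theorem computing_trans {w : Worker m n} {x : Proc m n L D} {s : Data m n D}
    (hx : Live eff c (who w) x (s (who w))) {e : Event (Act m n L)}
    {r : Option (Proc m n L D)} {s' : Data m n D}
    (h : Trans (spec eff c) (.seq x (.var (answering w))) s e r s') : RunOut eff c w s e r s' := by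
  cases h with
  | @seqFirst _ _ _ _ r _ _ h =>
    obtain ⟨h₁, ⟨l, hl⟩, h₃, h₄, -⟩ := hx.1.trans h
    cases r with
    | none =>
      exact ⟨h₃, [.next], .var (answering w), rfl,
        .inr ⟨⟨l, hl⟩, h₄, .inr (.inl rfl), by simp [RunLive]⟩⟩
    | some y =>
      refine ⟨h₃, [], .seq y (.var (answering w)), rfl,
        .inr ⟨⟨l, hl⟩, h₄, .inr (.inr ⟨y, rfl⟩), ?_⟩⟩
      rintro _ _ ⟨⟩
      exact hx.trans h
  | @seqNext _ _ _ _ r _ _ _ h =>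
    obtain ⟨h₁, v, x, h₂, h₃⟩ := answering_trans h
    exact ⟨h₁, .next :: v, x, by rw [threadsO_map_loc, h₂]; rfl, h₃⟩
  | seqNew hc => exact (hx.1.not_created _ hc).elim

theorem Running.trans (hlive : ∀ w d, Live eff c (who w) ((c.work w).toProc (who w)) d)
    {w : Worker m n} {x : Proc m n L D} {s : Data m n D} (hx : Running w x)
    (hl : RunLive eff c w x (s (who w))) {e : Event (Act m n L)}
    {r : Option (Proc m n L D)} {s' : Data m n D}
    (h : Trans (spec eff c) x s e r s') : RunOut eff c w s e r s' := by
  rcases hx with rfl | rfl | ⟨y, rfl⟩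
  · cases h with
    | var h =>
      change Trans _ (eqn c _) _ _ _ _ at h
      rw [eqn_working] at h
      exact computing_trans (hlive w _) h
  · exact answering_trans h
  · exact computing_trans (hl _ _ rfl) h

theorem Running.go (hlive : ∀ w d, Live eff c (who w) ((c.work w).toProc (who w)) d)
    {w : Worker m n} {x : Proc m n L D} {d : D} (hx : Running w x) (hl : RunLive eff c w x d) :
    Go eff c (who w) (Set.range (.loc (who w))) (sendOut w) x d := by
  have h₂ : ∀ d, Go eff c (who w) (Set.range (.loc (who w))) (sendOut w)
      (.var (answering w)) d := by
    refine fun d => .var (.goal fun s _ => ?_)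
    rw [eqn_answering]
    exact ⟨_, _, s, .seqFirst not_created_act (.act rfl), rfl⟩
  have h₁ : ∀ {x d}, Live eff c (who w) x d →
      Go eff c (who w) (Set.range (.loc (who w))) (sendOut w) (.seq x (.var (answering w))) d :=
    fun hx => Go.compute (K := Set.range (.loc (who w))) (fun l => Set.mem_range_self l)
      (answering_ne_resting w) h₂ hx
  rcases hx with rfl | rfl | ⟨y, rfl⟩
  · refine .var ?_
    rw [eqn_working]
    exact h₁ (hlive w d)
  · exact h₂ d
  · exact h₁ (hl _ _ rfl)

/-! ### The thread of the Master -/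

/-- The Map actors. -/
def mapWorkers (m n : ℕ) : List (Worker m n) := List.ofFn .inl

/-- The Reduce actors. -/
def redWorkers (m n : ℕ) : List (Worker m n) := List.ofFn .inr

theorem nodup_mapWorkers : (mapWorkers m n).Nodup := List.nodup_ofFn.2 Sum.inl_injective

theorem nodup_redWorkers : (redWorkers m n).Nodup := List.nodup_ofFn.2 Sum.inr_injective

/-- The variables of the busy Master, with the workers whose answers it has still to read. -/
inductive Stage : Var m n → Multiset (Worker m n) → Prop
  | mas1 : Stage .mas1 0
  | mas2 : Stage .mas2 0
  | mas3 : Stage .mas3 0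
  | mas4 : Stage .mas4 (mapWorkers m n)
  | mas5 : Stage .mas5 0
  | mas6 : Stage .mas6 0
  | mas7 : Stage .mas7 0
  | mas8 : Stage .mas8 (redWorkers m n)
  | mas9 : Stage .mas9 0
  | mas10 : Stage .mas10 0

theorem Stage.nodup {X : Var m n} {W : Multiset (Worker m n)} (h : Stage X W) : W.Nodup := by
  cases h <;> first | exact Multiset.nodup_zero | exact nodup_mapWorkers | exact nodup_redWorkers

theorem Stage.ne_resting {X : Var m n} {W : Multiset (Worker m n)} (h : Stage X W)
    (w : Worker m n) : X ≠ resting w := by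
  cases h <;> cases w <;> simp [resting]

variable (eff c) in
/-- The thread of the Master with local data `d`, in the idle phase `false` or the busy phase `true`,
when it has still to read the answers of the workers in `W` to the inputs that it has sent. -/
inductive Master (d : D) : Proc m n L D → Bool → Multiset (Worker m n) → Prop
  | idle : Master d (.var .mas) false 0
  | var {X W} : Stage X W → Master d (.var X) true W
  | compute {x X} : Live eff c .mas x d → Stage X 0 → Master d (.seq x (.var X)) true 0
  | ask {x X W R} : x.Flat → x.todo = R.map sendIn → Stage X (W + R) →
      Master d (.seq x (.var X)) true W
  | collect {x X W} : x.Flat → x.todo = W.map recvOut → W.Nodup → Stage X 0 →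
      Master d (.seq x (.var X)) true W

theorem Master.nodup {d : D} {x : Proc m n L D} {b : Bool} {W : Multiset (Worker m n)}
    (h : Master eff c d x b W) : W.Nodup := by
  cases h with
  | idle => exact Multiset.nodup_zero
  | var h => exact h.nodup
  | compute => exact Multiset.nodup_zero
  | ask _ _ h => exact (Multiset.nodup_add.1 h.nodup).1
  | collect _ _ h => exact h

/-- The effect of the actions of the Master on the data, the phase and the awaited workers. -/
inductive MasterStep (s : Data m n D) : Bool → Multiset (Worker m n) → Act m n L →
    Data m n D → Bool → Multiset (Worker m n) → Prop
  | visible {b} : MasterStep s b 0 (external b) s (!b) 0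
  | ask {w W} : MasterStep s true W (sendIn w) s true (w ::ₘ W)
  | collect {w W} : MasterStep s true (w ::ₘ W) (recvOut w) s true W
  | compute {l W s'} : (∀ b, b ≠ .mas → s' b = s b) →
      MasterStep s true W (.loc .mas l) s' true W

/-- An event at the first place and a later one in sequence at the second place. -/
def Before (p q : List Dir) : Prop := ∃ u p' q', p = u ++ .first :: p' ∧ q = u ++ .next :: q'

theorem Before.append_left {p q : List Dir} (h : Before p q) (w : List Dir) :
    Before (w ++ p) (w ++ q) := by
  obtain ⟨u, p', q', rfl, rfl⟩ := h
  exact ⟨w ++ u, p', q', by simp, by simp⟩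

theorem Before.append_right {p q : List Dir} (h : Before p q) (w : List Dir) :
    Before p (q ++ w) := by
  obtain ⟨u, p', q', rfl, rfl⟩ := h
  exact ⟨u, p', q' ++ w, by simp, by simp⟩

/-- At the place where the two locations part, one goes `first` and the other `next`, whereas
independence would need `left` and `right` there. -/
theorem Before.not_indep {p q : List Dir} (h : Before p q) : ¬ Indep p q := by
  obtain ⟨u, p', q', rfl, rfl⟩ := h
  rintro ⟨w, p₁, q₁, h⟩
  induction u generalizing w with
  | nil =>
    cases w with
    | nil => simp at h
    | cons d w =>
      simp only [List.cons_append, List.nil_append, List.cons.injEq] at h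
      rcases h with ⟨⟨rfl, -⟩, ⟨h, -⟩⟩ | ⟨⟨rfl, -⟩, ⟨h, -⟩⟩ <;> cases h
  | cons d u ih =>
    cases w with
    | nil => 
      simp only [List.cons_append, List.nil_append, List.cons.injEq] at h
      rcases h with ⟨⟨rfl, -⟩, ⟨h, -⟩⟩ | ⟨⟨rfl, -⟩, ⟨h, -⟩⟩ <;> cases h
    | cons d' w =>
      simp only [List.cons_append, List.cons.injEq] at h
      exact ih w (by tauto)

/-- What the thread of the Master can do: a worker created by it reads an input that was not sent,
or the Master executes one of its actions. -/
def MasterOut (eff : L → D → Set D) (c : Code m n L D) (s : Data m n D) (b : Bool)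
    (W : Multiset (Worker m n)) (e : Event (Act m n L)) (r : Option (Proc m n L D))
    (s' : Data m n D) : Prop :=
  e.vis = true ∧ ((∃ w, w ∉ W ∧ e.act = recvIn w) ∨
    ∃ b' W' v x N, threadsO r = (v, x) ::ₘ N ∧ (∀ p ∈ N, ∃ w, p.2 = .var (resting w)) ∧
      Master eff c (s' .mas) x b' W' ∧ MasterStep s b W e.act s' b' W' ∧
      (b' ≠ b → Before e.path v))

variable {s : Data m n D} {e : Event (Act m n L)} {r : Option (Proc m n L D)} {s' : Data m n D}

theorem MasterOut.next {b : Bool} {W : Multiset (Worker m n)}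
    (h : MasterOut eff c s b W e r s') :
    MasterOut eff c s b W (e.under .next) (r.map (.loc .next)) s' := by
  refine ⟨h.1, h.2.imp id ?_⟩
  rintro ⟨b', W', v, x, N, hr, hN, h⟩
  refine ⟨b', W', .next :: v, x, shift [.next] N, ?_, ?_, h.1, h.2.1, fun hb => ?_⟩
  · rw [threadsO_map_loc, hr, shift_cons]; rfl
  · rintro ⟨v, y⟩ hp
    obtain ⟨v', hp, -⟩ := mem_shift.1 hp
    exact hN (v', y) hp
  · exact (h.2.2 hb).append_left [.next]

theorem exists_of_map_eq_cons {α β : Type*} {f : α → β} {s : Multiset α} {b : β} {t : Multiset β}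
    (h : s.map f = b ::ₘ t) : ∃ a s', s = a ::ₘ s' ∧ f a = b ∧ s'.map f = t := by
  obtain ⟨a, ha, rfl⟩ := Multiset.mem_map.1 (h ▸ Multiset.mem_cons_self b t)
  obtain ⟨s', rfl⟩ := Multiset.exists_cons_of_mem ha
  exact ⟨a, s', rfl, rfl, by simpa using h⟩

/-- The hypothesis `hk` on the continuation covers a computation that can terminate without an
event. The two lemmas that follow need theirs for a flat composition with nothing left to do. -/
theorem compute_trans {x : Proc m n L D} {X : Var m n} (hx : Live eff c .mas x (s .mas))
    (hX : Stage X 0)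
    (hk : ∀ {e r s'}, Trans (spec eff c) (.var X) s e r s' → MasterOut eff c s true 0 e r s')
    (h : Trans (spec eff c) (.seq x (.var X)) s e r s') : MasterOut eff c s true 0 e r s' := by
  cases h with
  | @seqFirst _ _ _ e r _ _ h =>
    obtain ⟨-, ⟨l, hl⟩, h₃, h₄, -⟩ := hx.1.trans h
    refine ⟨h₃, .inr ?_⟩
    have hs : MasterStep s true 0 (Event.under .first e).act s' true 0 := by
      rw [Event.under, hl]; exact .compute h₄
    cases r with
    | none => exact ⟨true, 0, [.next], _, 0, rfl, by simp, .var hX, hs, by simp⟩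
    | some y => exact ⟨true, 0, [], _, 0, rfl, by simp, .compute (hx.trans h) hX, hs, by simp⟩
  | seqNext _ _ h => exact (hk h).next
  | seqNew hc => exact (hx.1.not_created _ hc).elim

theorem ask_trans {x : Proc m n L D} {X : Var m n} {W R : Multiset (Worker m n)} (hx : x.Flat)
    (hd : x.todo = R.map sendIn) (hX : Stage X (W + R))
    (hk : ∀ {e r s'}, Trans (spec eff c) (.var X) s e r s' → MasterOut eff c s true (W + R) e r s')
    (h : Trans (spec eff c) (.seq x (.var X)) s e r s') : MasterOut eff c s true W e r s' := by
  cases h with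
  | @seqFirst _ _ _ e r _ _ h =>
    obtain ⟨h₁, h₂, h₃, h₄⟩ := hx.trans h
    rw [hd] at h₄
    obtain ⟨w, R', rfl, hw, hR⟩ := exists_of_map_eq_cons h₄
    have hss : s' = s := by
      rw [← hw] at h₂; exact h₂
    subst hss
    refine ⟨h₁, .inr ?_⟩
    have hs : MasterStep s' true W (Event.under .first e).act s' true (w ::ₘ W) := by
      rw [Event.under, ← hw]; exact .ask
    -- The worker just asked moves from `R` to the awaited ones; the sum, on which the stage
    -- depends, is unchanged.
    rw [Multiset.add_cons, ← Multiset.cons_add] at hX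
    cases r with
    | none =>
      rw [Multiset.map_eq_zero.1 hR, add_zero] at hX
      exact ⟨true, _, [.next], _, 0, rfl, by simp, .var hX, hs, by simp⟩
    | some y =>
      exact ⟨true, _, [], _, 0, rfl, by simp, .ask (h₃ y rfl) hR.symm hX, hs, by simp⟩
  | seqNext _ he h =>
    rw [hx.eps_iff, hd, Multiset.map_eq_zero] at he
    subst he
    rw [add_zero] at hk
    exact (hk h).next
  | seqNew hc => exact (hx.not_created _ hc).elim

theorem collect_trans {x : Proc m n L D} {X : Var m n} {W : Multiset (Worker m n)} (hx : x.Flat)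
    (hd : x.todo = W.map recvOut) (hW : W.Nodup) (hX : Stage X 0)
    (hk : ∀ {e r s'}, Trans (spec eff c) (.var X) s e r s' → MasterOut eff c s true 0 e r s')
    (h : Trans (spec eff c) (.seq x (.var X)) s e r s') : MasterOut eff c s true W e r s' := by
  cases h with
  | @seqFirst _ _ _ e r _ _ h =>
    obtain ⟨h₁, h₂, h₃, h₄⟩ := hx.trans h
    rw [hd] at h₄
    obtain ⟨w, W', rfl, hw, hR⟩ := exists_of_map_eq_cons h₄
    have hss : s' = s := by
      rw [← hw] at h₂; exact h₂
    subst hss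
    refine ⟨h₁, .inr ?_⟩
    have hs : MasterStep s' true (w ::ₘ W') (Event.under .first e).act s' true W' := by
      rw [Event.under, ← hw]; exact .collect
    cases r with
    | none =>
      obtain rfl := Multiset.map_eq_zero.1 hR
      exact ⟨true, _, [.next], _, 0, rfl, by simp, .var hX, hs, by simp⟩
    | some y =>
      exact ⟨true, _, [], _, 0, rfl, by simp,
        .collect (h₃ y rfl) hR.symm (Multiset.nodup_cons.1 hW).2 hX, hs, by simp⟩
  | seqNext _ he h =>
    rw [hx.eps_iff, hd, Multiset.map_eq_zero] at he
    subst he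
    exact (hk h).next
  | seqNew hc => exact (hx.not_created _ hc).elim

/-- Creation is not an event of its own; it takes effect with the first event of the created
composition. That event is either the read of a created worker, of which the Master awaits nothing
at this point, or an event of the Master, which now continues on the right while the new workers
rest on the left. The empty composition is skipped. -/
theorem create_trans {l : List (Worker m n)} {X : Var m n}
    (hk : ∀ {e r s'}, Trans (spec eff c) (.var X) s e r s' → MasterOut eff c s true 0 e r s')
    (h : Trans (spec eff c)
      (.seq (Term.parList ((l.map fun w => .var (resting w)).map .new)) (.var X)) s e r s') :
    MasterOut eff c s true 0 e r s' := by
  cases l with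
  | nil =>
    cases h with
    | seqFirst _ h => cases h
    | seqNext _ _ h => exact (hk h).next
    | seqNew hc => cases hc
  | cons w l =>
    cases h with
    | seqFirst hc => exact (hc _ (created_parList_new.2 rfl)).elim
    | seqNext hc => exact (hc _ (created_parList_new.2 rfl)).elim
    | seqNew hc h =>
      obtain rfl := created_parList_new.1 hc
      have hl : ∀ x ∈ (.var (resting w) : Proc m n L D) :: l.map fun w => .var (resting w),
          ∃ w, x = .var (resting w) := by
        intro x hx
        rcases List.mem_cons.1 hx with rfl | hx
        · exact ⟨w, rfl⟩
        · obtain ⟨w, -, rfl⟩ := List.mem_map.1 hx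
          exact ⟨w, rfl⟩
      have hz := map_snd_threads_parList (a := (.var (resting w) : Proc m n L D))
        (l := l.map fun w => .var (resting w)) (by
          intro x hx
          obtain ⟨w, rfl⟩ := hl x hx
          rfl)
      have hz' : ∀ p ∈ (Term.parList ((.var (resting w) : Proc m n L D) ::
          l.map fun w => .var (resting w))).threads, ∃ w, p.2 = .var (resting w) := by
        intro p hp
        have := Multiset.mem_map_of_mem Prod.snd hp
        rw [hz, Multiset.mem_coe] at this
        exact hl _ this
      -- Giving the composition a name keeps the case distinction on the transition from looking
      -- inside it.
      generalize hzz : Term.parList ((.var (resting w) : Proc m n L D) ::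
        l.map fun w => .var (resting w)) = z at hz'
      replace h : Trans (spec eff c) (.par z (.var X)) s e r s' := hzz ▸ h
      cases h with
      | parL h =>
        obtain ⟨v, x, e, r, hx, rfl, ht, -⟩ := h.exists_thread
        obtain ⟨w, rfl : x = _⟩ := hz' _ hx
        obtain ⟨h₁, h₂, -⟩ := resting_trans ht
        exact ⟨h₁, .inl ⟨w, by simp, h₂⟩⟩
      | parR h =>
        obtain ⟨h₁, h₂⟩ := hk h
        refine ⟨h₁, h₂.imp id ?_⟩
        rintro ⟨b', W', v, x, N, hr, hN, h⟩
        refine ⟨b', W', .right :: v, x, shift [.right] N + shift [.left] z.threads, ?_, ?_, h.1, h.2.1,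
          fun hb => ?_⟩
        · rw [threadsO_some, threads_parResR, hr, shift_cons, add_comm, Multiset.cons_add]; rfl
        · rintro ⟨v, y⟩ hp
          rcases Multiset.mem_add.1 hp with hp | hp <;> obtain ⟨v', hp, -⟩ := mem_shift.1 hp
          · exact hN (v', y) hp
          · exact hz' (v', y) hp
        · exact (h.2.2 hb).append_left [.right]

theorem external_trans {X Y : Var m n} {b : Bool} (hX : eqn c X = .seq (.act (external b)) (.var Y))
    (hY : ∀ d, Master eff c d (.var Y) (!b) 0) (h : Trans (spec eff c) (.var X) s e r s') :
    MasterOut eff c s b 0 e r s' := by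
  cases h with
  | var h =>
    change Trans _ (eqn c _) _ _ _ _ at h
    rw [hX] at h
    obtain ⟨rfl, hs, rfl⟩ := act_seq_trans h
    have hss : s' = s := by cases b <;> exact hs
    subst hss
    exact ⟨rfl, .inr ⟨!b, 0, [.next], _, 0, rfl, by simp, hY _, .visible, fun _ =>
      ⟨[], [], [], rfl, rfl⟩⟩⟩

theorem eqn_mas2 : eqn c .mas2 = .seq (Term.parList
    (((mapWorkers m n).map fun w => .var (resting w)).map .new)) (.var .mas3) := by
  simp [eqn, parAll, mapWorkers, List.map_ofFn]; rfl

theorem eqn_mas3 : eqn c .mas3 = .seq (Term.parList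
    (((mapWorkers m n).map sendIn).map .act)) (.var .mas4) := by
  simp [eqn, parAll, mapWorkers, List.map_ofFn]; rfl

theorem eqn_mas4 : eqn c .mas4 = .seq (Term.parList
    (((mapWorkers m n).map recvOut).map .act)) (.var .mas5) := by
  simp [eqn, parAll, mapWorkers, List.map_ofFn]; rfl

theorem eqn_mas6 : eqn c .mas6 = .seq (Term.parList
    (((redWorkers m n).map fun w => .var (resting w)).map .new)) (.var .mas7) := by
  simp [eqn, parAll, redWorkers, List.map_ofFn]; rfl

theorem eqn_mas7 : eqn c .mas7 = .seq (Term.parList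
    (((redWorkers m n).map sendIn).map .act)) (.var .mas8) := by
  simp [eqn, parAll, redWorkers, List.map_ofFn]; rfl

theorem eqn_mas8 : eqn c .mas8 = .seq (Term.parList
    (((redWorkers m n).map recvOut).map .act)) (.var .mas9) := by
  simp [eqn, parAll, redWorkers, List.map_ofFn]; rfl

variable (eff c) in
/-- Every local computation of the Master can terminate, whatever it does before. -/
structure MasterLive : Prop where
  mas1 (d) : Live eff c .mas (c.mas1.toProc .mas) d
  mas5 (d) : Live eff c .mas (c.mas5.toProc .mas) d
  mas9 (d) : Live eff c .mas (c.mas9.toProc .mas) d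

/-- The variables are treated backwards. Computations and empty compositions may terminate without
an event, so the first event of a variable may belong to any later one, but not beyond `mas10`,
which begins with an action. -/
theorem Stage.trans (hm : MasterLive eff c) {X : Var m n} {W : Multiset (Worker m n)}
    (hX : Stage X W) {e : Event (Act m n L)} {r : Option (Proc m n L D)} {s' : Data m n D}
    (h : Trans (spec eff c) (.var X) s e r s') : MasterOut eff c s true W e r s' := by
  have unfold : ∀ {X : Var m n} {e r s'}, Trans (spec eff c) (.var X) s e r s' →
      Trans (spec eff c) (eqn c X) s e r s' := fun h => by cases h with | var h => exact h
  have ask : ∀ {l : List (Worker m n)} {X : Var m n} {e r s'}, Stage X l →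
      (∀ {e r s'}, Trans (spec eff c) (.var X) s e r s' → MasterOut eff c s true l e r s') →
      Trans (spec eff c) (.seq (Term.parList ((l.map sendIn).map .act)) (.var X)) s e r s' →
      MasterOut eff c s true 0 e r s' := fun {l _ _ _ _} hX hk h =>
    ask_trans (R := l) (flat_parList_act _).1 (flat_parList_act _).2 (by rwa [zero_add])
      (by rwa [zero_add]) h
  have collect : ∀ {l : List (Worker m n)} {X : Var m n} {e r s'}, l.Nodup → Stage X 0 →
      (∀ {e r s'}, Trans (spec eff c) (.var X) s e r s' → MasterOut eff c s true 0 e r s') →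
      Trans (spec eff c) (.seq (Term.parList ((l.map recvOut).map .act)) (.var X)) s e r s' →
      MasterOut eff c s true l e r s' := fun {l _ _ _ _} hl hX hk h =>
    collect_trans (flat_parList_act _).1 (flat_parList_act _).2 hl hX hk h
  have h10 : ∀ {e r s'}, Trans (spec eff c) (.var .mas10) s e r s' →
      MasterOut eff c s true 0 e r s' := fun h =>
    external_trans (b := true) (Y := .mas) rfl (fun _ => .idle) h
  have h9 : ∀ {e r s'}, Trans (spec eff c) (.var .mas9) s e r s' →
      MasterOut eff c s true 0 e r s' := fun h =>
    compute_trans (hm.mas9 _) .mas10 h10 (unfold h)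
  have h8 : ∀ {e r s'}, Trans (spec eff c) (.var .mas8) s e r s' →
      MasterOut eff c s true (redWorkers m n) e r s' := fun h =>
    collect nodup_redWorkers .mas9 h9 (eqn_mas8 ▸ unfold h)
  have h7 : ∀ {e r s'}, Trans (spec eff c) (.var .mas7) s e r s' →
      MasterOut eff c s true 0 e r s' := fun h => ask .mas8 h8 (eqn_mas7 ▸ unfold h)
  have h6 : ∀ {e r s'}, Trans (spec eff c) (.var .mas6) s e r s' →
      MasterOut eff c s true 0 e r s' := fun h => create_trans h7 (eqn_mas6 ▸ unfold h)
  have h5 : ∀ {e r s'}, Trans (spec eff c) (.var .mas5) s e r s' →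
      MasterOut eff c s true 0 e r s' := fun h =>
    compute_trans (hm.mas5 _) .mas6 h6 (unfold h)
  have h4 : ∀ {e r s'}, Trans (spec eff c) (.var .mas4) s e r s' →
      MasterOut eff c s true (mapWorkers m n) e r s' := fun h =>
    collect nodup_mapWorkers .mas5 h5 (eqn_mas4 ▸ unfold h)
  have h3 : ∀ {e r s'}, Trans (spec eff c) (.var .mas3) s e r s' →
      MasterOut eff c s true 0 e r s' := fun h => ask .mas4 h4 (eqn_mas3 ▸ unfold h)
  have h2 : ∀ {e r s'}, Trans (spec eff c) (.var .mas2) s e r s' →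
      MasterOut eff c s true 0 e r s' := fun h => create_trans h3 (eqn_mas2 ▸ unfold h)
  cases hX with
  | mas1 => exact compute_trans (hm.mas1 _) .mas2 h2 (unfold h)
  | mas2 => exact h2 h
  | mas3 => exact h3 h
  | mas4 => exact h4 h
  | mas5 => exact h5 h
  | mas6 => exact h6 h
  | mas7 => exact h7 h
  | mas8 => exact h8 h
  | mas9 => exact h9 h
  | mas10 => exact h10 h

theorem Master.trans (hm : MasterLive eff c) {x : Proc m n L D} {b : Bool}
    {W : Multiset (Worker m n)} (hx : Master eff c (s .mas) x b W)
    (h : Trans (spec eff c) x s e r s') : MasterOut eff c s b W e r s' := by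
  cases hx with
  | idle => exact external_trans (b := false) (Y := .mas1) rfl (fun _ => .var .mas1) h
  | var hX => exact hX.trans hm h
  | compute hl hX => exact compute_trans hl hX (hX.trans hm) h
  | ask hf hd hX => exact ask_trans hf hd hX (hX.trans hm) h
  | collect hf hd hW hX => exact collect_trans hf hd hW hX (hX.trans hm) h

/-- The actions of the busy Master before its reply. -/
def masterActs : Set (Act m n L) := {a | (∃ w, a = sendIn w ∨ a = recvOut w) ∨ ∃ l, a = .loc .mas l}

/-- Paths to the reply are composed backwards from `mas10`, one variable at a time. -/
theorem Stage.go (hm : MasterLive eff c) {X : Var m n} {W : Multiset (Worker m n)}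
    (hX : Stage X W) (d : D) : Go eff c .mas masterActs (external true) (.var X) d := by
  let G (x : Proc m n L D) : Prop := ∀ d, Go eff c .mas masterActs (external true) x d
  have compute : ∀ {X : Var m n} {W : Multiset (Worker m n)} {x}, Stage X W →
      (∀ d, Live eff c .mas x d) → G (.var X) → G (.seq x (.var X)) := fun hX hx h d =>
    Go.compute (fun l => .inr ⟨l, rfl⟩) hX.ne_resting h (hx d)
  have ask : ∀ {X : Var m n} {W : Multiset (Worker m n)} {l : List (Worker m n)}, Stage X W →
      G (.var X) → G (.seq (Term.parList ((l.map sendIn).map .act)) (.var X)) := by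
    refine fun hX h d => Go.flat hX.ne_resting h (flat_parList_act _).1 ?_
    rw [(flat_parList_act _).2]
    intro b hb
    obtain ⟨w, -, rfl⟩ := List.mem_map.1 (Multiset.mem_coe.1 hb)
    exact ⟨.inl ⟨w, .inl rfl⟩, fun s => rfl⟩
  have collect : ∀ {X : Var m n} {W : Multiset (Worker m n)} {l : List (Worker m n)}, Stage X W →
      G (.var X) → G (.seq (Term.parList ((l.map recvOut).map .act)) (.var X)) := by
    refine fun hX h d => Go.flat hX.ne_resting h (flat_parList_act _).1 ?_
    rw [(flat_parList_act _).2]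
    intro b hb
    obtain ⟨w, -, rfl⟩ := List.mem_map.1 (Multiset.mem_coe.1 hb)
    exact ⟨.inl ⟨w, .inr rfl⟩, fun s => rfl⟩
  have create : ∀ {X : Var m n} {l : List (Worker m n)}, G (.var X) →
      G (.seq (Term.parList ((l.map fun w => .var (resting w)).map .new)) (.var X)) := by
    intro X l h d
    cases l with
    | nil => exact .skip nofun (fun _ _ => .guard trivial) (h d)
    | cons w l =>
      refine (h d).mono fun s e r s' _ ht =>
        ⟨_, _, [.right], .seqNew (created_parList_new.2 rfl) (.parR ht), rfl, fun p hp => ?_⟩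
      rw [threadsO_some, threads_parResR]
      exact Multiset.mem_add.2 (.inr hp)
  have var : ∀ {X : Var m n} {x}, eqn c X = x → G x → G (.var X) := fun hX h d =>
    .var (hX ▸ h d)
  have h10 : G (.var .mas10) := fun d =>
    .var (.goal fun s _ => ⟨_, _, s, .seqFirst not_created_act (.act rfl), rfl⟩)
  have h9 : G (.var .mas9) := var rfl (compute .mas10 hm.mas9 h10)
  have h8 : G (.var .mas8) := var eqn_mas8 (collect .mas9 h9)
  have h7 : G (.var .mas7) := var eqn_mas7 (ask .mas8 h8)
  have h6 : G (.var .mas6) := var eqn_mas6 (create h7)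
  have h5 : G (.var .mas5) := var rfl (compute .mas6 hm.mas5 h6)
  have h4 : G (.var .mas4) := var eqn_mas4 (collect .mas5 h5)
  have h3 : G (.var .mas3) := var eqn_mas3 (ask .mas4 h4)
  have h2 : G (.var .mas2) := var eqn_mas2 (create h3)
  cases hX with
  | mas1 => exact var (X := .mas1) rfl (compute .mas2 hm.mas1 h2) d
  | mas2 => exact h2 d
  | mas3 => exact h3 d
  | mas4 => exact h4 d
  | mas5 => exact h5 d
  | mas6 => exact h6 d
  | mas7 => exact h7 d
  | mas8 => exact h8 d
  | mas9 => exact h9 d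
  | mas10 => exact h10 d

theorem Master.go (hm : MasterLive eff c) {x : Proc m n L D} {b : Bool}
    {W : Multiset (Worker m n)} {d : D} (hx : Master eff c d x b W) :
    Go eff c .mas masterActs (external b) x d := by
  cases hx with
  | idle => exact .var (.goal fun s _ => ⟨_, _, s, .seqFirst not_created_act (.act rfl), rfl⟩)
  | var hX => exact hX.go hm d
  | compute hl hX => exact Go.compute (fun l => .inr ⟨l, rfl⟩) hX.ne_resting (hX.go hm) hl
  | ask hf hd hX =>
    refine Go.flat hX.ne_resting (hX.go hm) hf ?_
    rw [hd]
    intro b hb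
    obtain ⟨w, -, rfl⟩ := Multiset.mem_map.1 hb
    exact ⟨.inl ⟨w, .inl rfl⟩, fun s => rfl⟩
  | collect hf hd hW hX =>
    refine Go.flat hX.ne_resting (hX.go hm) hf ?_
    rw [hd]
    intro b hb
    obtain ⟨w, -, rfl⟩ := Multiset.mem_map.1 hb
    exact ⟨.inl ⟨w, .inr rfl⟩, fun s => rfl⟩

/-- In sequence with everything the busy Master does stands the action that begins `mas10`, and an
action cannot terminate without an event. -/
theorem Master.not_eps {x : Proc m n L D} {b : Bool} {W : Multiset (Worker m n)} {d : D}
    (hx : Master eff c d x b W) : ¬ Eps (spec eff c) s x := by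
  have unfold : ∀ {X : Var m n} {x y}, eqn c X = .seq x y → ¬ Eps (spec eff c) s y →
      ¬ Eps (spec eff c) s (.var X) := by
    intro X x y hX hy h
    cases h with
    | var h =>
      change Eps _ s (eqn c X) at h
      rw [hX] at h
      cases h with | seq _ h => exact hy h
  have act : ∀ {X : Var m n} {a y}, eqn c X = .seq (.act a) y →
      ¬ Eps (spec eff c) s (.var X) := by
    intro X x y hX h
    cases h with
    | var h =>
      change Eps _ s (eqn c X) at h
      rw [hX] at h
      cases h with | seq h _ => cases h
  have h10 : ¬ Eps (spec eff c) s (.var .mas10) := act rfl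
  have h9 : ¬ Eps (spec eff c) s (.var .mas9) := unfold rfl h10
  have h8 : ¬ Eps (spec eff c) s (.var .mas8) := unfold rfl h9
  have h7 : ¬ Eps (spec eff c) s (.var .mas7) := unfold rfl h8
  have h6 : ¬ Eps (spec eff c) s (.var .mas6) := unfold rfl h7
  have h5 : ¬ Eps (spec eff c) s (.var .mas5) := unfold rfl h6
  have h4 : ¬ Eps (spec eff c) s (.var .mas4) := unfold rfl h5
  have h3 : ¬ Eps (spec eff c) s (.var .mas3) := unfold rfl h4
  have h2 : ¬ Eps (spec eff c) s (.var .mas2) := unfold rfl h3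
  have h1 : ¬ Eps (spec eff c) s (.var .mas1) := unfold rfl h2
  have stage : ∀ {X : Var m n} {W}, Stage X W → ¬ Eps (spec eff c) s (.var X) := by
    intro X W hX
    cases hX <;> assumption
  have seq : ∀ {X : Var m n} {W x}, Stage X W → ¬ Eps (spec eff c) s (.seq x (.var X)) := by
    intro X W x hX h
    cases h with | seq _ h => exact stage hX h
  cases hx with
  | idle => exact act rfl
  | var hX => exact stage hX
  | compute _ hX => exact seq hX
  | ask _ _ hX => exact seq hX
  | collect _ _ _ hX => exact seq hX

end Threads

end MapReduce

namespace MapReduce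

open APTC

section Configurations

variable {m n : ℕ} {L D : Type*} {eff : L → D → Set D} {c : Code m n L D}

/-! ### Messages on their way -/

/-- The number of occurrences of `a` in the history `h`. -/
noncomputable def occ (a : Act m n L) (h : Multiset (Act m n L)) : ℕ := open Classical in h.count a

/-- The number of running threads of the worker `w`. -/
noncomputable def running (w : Worker m n) (M : Multiset (List Dir × Proc m n L D)) : ℕ :=
  open Classical in M.countP fun p => Running w p.2

open Classical in
theorem occ_cons (a b : Act m n L) (h : Multiset (Act m n L)) :
    occ a (b ::ₘ h) = occ a h + if a = b then 1 else 0 := by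
  simp only [occ, Multiset.count_cons]

open Classical in
theorem running_cons (w : Worker m n) (p : List Dir × Proc m n L D)
    (M : Multiset (List Dir × Proc m n L D)) :
    running w (p ::ₘ M) = running w M + if Running w p.2 then 1 else 0 := by
  simp only [running, Multiset.countP_cons]

theorem running_pos {w : Worker m n} {M : Multiset (List Dir × Proc m n L D)} :
    0 < running w M ↔ ∃ p ∈ M, Running w p.2 := by
  simp only [running, Multiset.countP_pos]

theorem not_running_resting (w w' : Worker m n) :
    ¬ Running w (.var (resting w') : Proc m n L D) :=
  fun h => h.ne_resting w' rfl

theorem running_of_resting {w : Worker m n} {M : Multiset (List Dir × Proc m n L D)}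
    (h : ∀ p ∈ M, ∃ w, p.2 = .var (resting w)) : running w M = 0 := by
  rw [← Nat.le_zero, ← not_lt, running_pos]
  rintro ⟨p, hp, hr⟩
  obtain ⟨w', hw⟩ := h p hp
  exact hr.ne_resting w' hw

theorem running_add (w : Worker m n) (M N : Multiset (List Dir × Proc m n L D)) :
    running w (M + N) = running w M + running w N := by
  simp only [running, Multiset.countP_add]

theorem Running.iff_eq {w w' : Worker m n} {x : Proc m n L D} (h : Running w x) :
    Running w' x ↔ w' = w :=
  ⟨fun h' => h'.unique h, fun e => e ▸ h⟩

section Distinct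

variable (w w' : Worker m n)

theorem sendIn_inj : (sendIn w : Act m n L) = sendIn w' ↔ w = w' := sendIn_injective.eq_iff
theorem recvIn_inj : (recvIn w : Act m n L) = recvIn w' ↔ w = w' := recvIn_injective.eq_iff
theorem sendOut_inj : (sendOut w : Act m n L) = sendOut w' ↔ w = w' := sendOut_injective.eq_iff
theorem recvOut_inj : (recvOut w : Act m n L) = recvOut w' ↔ w = w' := recvOut_injective.eq_iff
theorem sendIn_ne_sendOut : (sendIn w : Act m n L) ≠ sendOut w' := by simp [sendIn, sendOut]
theorem recvIn_ne_recvOut : (recvIn w : Act m n L) ≠ recvOut w' := by simp [recvIn, recvOut]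
theorem sendIn_ne_recvIn : (sendIn w : Act m n L) ≠ recvIn w' := nofun
theorem sendIn_ne_recvOut : (sendIn w : Act m n L) ≠ recvOut w' := nofun
theorem sendOut_ne_recvIn : (sendOut w : Act m n L) ≠ recvIn w' := nofun
theorem sendOut_ne_recvOut : (sendOut w : Act m n L) ≠ recvOut w' := nofun

end Distinct

/-- For every worker, the messages on their way and its running threads are accounted for: there is
exactly one of them if the Master waits for its answer, and none otherwise. -/
def Balanced (h : Multiset (Act m n L)) (M : Multiset (List Dir × Proc m n L D))
    (W : Multiset (Worker m n)) : Prop :=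
  ∀ w, ∃ i o, occ (sendIn w) h = occ (recvIn w) h + i ∧ occ (sendOut w) h = occ (recvOut w) h + o ∧
    i + running w M + o = W.count w

variable {h : Multiset (Act m n L)} {M : Multiset (List Dir × Proc m n L D)}
  {W : Multiset (Worker m n)}

theorem Balanced.cons_of_notMem (hb : Balanced h M W) {a : Act m n L} (ha : a ∉ H) :
    Balanced (a ::ₘ h) M W := by
  intro w
  obtain ⟨i, o, h₁, h₂, h₃⟩ := hb w
  have : ∀ b, b ∈ H → occ b (a ::ₘ h) = occ b h := fun b hb => by
    rw [occ_cons, if_neg (fun e : b = a => ha (e ▸ hb)), add_zero]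
  refine ⟨i, o, ?_, ?_, h₃⟩
  · rwa [this _ (sendIn_mem_H w), this _ (recvIn_mem_H w)]
  · rwa [this _ (sendOut_mem_H w), this _ (recvOut_mem_H w)]

theorem Balanced.add_resting (hb : Balanced h M W) {N : Multiset (List Dir × Proc m n L D)}
    (hN : ∀ p ∈ N, ∃ w, p.2 = .var (resting w)) : Balanced h (N + M) W := by
  intro w
  rw [running_add, running_of_resting hN, zero_add]
  exact hb w

theorem Balanced.ask (hb : Balanced h M W) (w : Worker m n) :
    Balanced (sendIn w ::ₘ h) M (w ::ₘ W) := by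
  intro w'
  obtain ⟨i, o, h₁, h₂, h₃⟩ := hb w'
  simp only [occ_cons, sendIn_inj, (sendIn_ne_recvIn _ _).symm, (sendIn_ne_sendOut _ _).symm,
    (sendIn_ne_recvOut _ _).symm, if_false, Multiset.count_cons]
  by_cases hw : w' = w
  · exact ⟨i + 1, o, by simp [hw] at *; omega, by omega, by simp [hw] at *; omega⟩
  · exact ⟨i, o, by simpa [hw] using h₁, by omega, by simpa [hw] using h₃⟩

theorem Balanced.collect {w : Worker m n} (hb : Balanced h M (w ::ₘ W))
    (hr : occ (recvOut w) h < occ (sendOut w) h) : Balanced (recvOut w ::ₘ h) M W := by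
  intro w'
  obtain ⟨i, o, h₁, h₂, h₃⟩ := hb w'
  simp only [occ_cons, recvOut_inj, sendIn_ne_recvOut, recvIn_ne_recvOut,
    sendOut_ne_recvOut, if_false, Multiset.count_cons] at h₃ ⊢
  by_cases hw : w' = w
  · subst hw
    simp only [if_true] at h₃ ⊢
    -- The subtraction is a true one: `hr` says that an answer is under way, so `o` is positive.
    exact ⟨i, o - 1, by omega, by omega, by omega⟩
  · exact ⟨i, o, by omega, by simpa [hw] using h₂, by simpa [hw] using h₃⟩

theorem Balanced.recv {w : Worker m n} {u u' : List Dir}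
    (hb : Balanced h ((u, .var (resting w)) ::ₘ M) W)
    (hr : occ (recvIn w) h < occ (sendIn w) h) :
    Balanced (recvIn w ::ₘ h) ((u', .var (working w)) ::ₘ M) W := by
  intro w'
  obtain ⟨i, o, h₁, h₂, h₃⟩ := hb w'
  have hrun : Running w (.var (working w) : Proc m n L D) := .inl rfl
  simp only [occ_cons, recvIn_inj, sendIn_ne_recvIn, (recvIn_ne_recvOut _ _).symm,
    sendOut_ne_recvIn, if_false, running_cons, not_running_resting, hrun.iff_eq] at h₃ ⊢
  by_cases hw : w' = w
  · subst hw
    simp only [if_true] at h₃ ⊢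
    -- The input under way, which exists by `hr`, is exchanged for a running copy of the worker.
    exact ⟨i - 1, o, by omega, by omega, by omega⟩
  · exact ⟨i, o, by simpa [hw] using h₁, by omega, by simpa [hw] using h₃⟩

theorem Balanced.send {w : Worker m n} {u u' : List Dir} {x : Proc m n L D} (hx : Running w x)
    (hb : Balanced h ((u, x) ::ₘ M) W) :
    Balanced (sendOut w ::ₘ h) ((u', .var (resting w)) ::ₘ M) W := by
  intro w'
  obtain ⟨i, o, h₁, h₂, h₃⟩ := hb w'
  simp only [occ_cons, sendOut_inj, sendIn_ne_sendOut, (sendOut_ne_recvIn _ _).symm,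
    (sendOut_ne_recvOut _ _).symm, if_false, running_cons, not_running_resting, hx.iff_eq] at h₃ ⊢
  by_cases hw : w' = w
  · subst hw
    simp only [if_true] at h₃ ⊢
    exact ⟨i, o + 1, by omega, by omega, by omega⟩
  · exact ⟨i, o, by omega, by simpa [hw] using h₂, by simpa [hw] using h₃⟩

theorem Balanced.congr {w : Worker m n} {u u' : List Dir} {x y : Proc m n L D} (hx : Running w x)
    (hy : Running w y) (hb : Balanced h ((u, x) ::ₘ M) W) : Balanced h ((u', y) ::ₘ M) W := by
  intro w'
  simpa only [running_cons, hx.iff_eq, hy.iff_eq] using hb w'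

/-! ### Transitions of the system -/

/-- The process `x` at the location `q`. -/
def locs : List Dir → Proc m n L D → Proc m n L D
  | [], x => x
  | d :: q, x => .loc d (locs q x)

/-- The process `τ_I(∂_H(T))` at the location `q`, after the history `h`. -/
def sysTerm (q : List Dir) (h : Multiset (Act m n L)) (T : Proc m n L D) : Proc m n L D :=
  locs q (.hide I (.encap H h T))

/-- An event as seen from outside `τ_I`, located below `q`. -/
noncomputable def outer (q : List Dir) (e : Event (Act m n L)) : Event (Act m n L) :=
  open Classical in ⟨q ++ e.path, e.act, e.vis && decide (e.act ∉ I)⟩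

theorem outer_vis_of_mem {q : List Dir} {e : Event (Act m n L)} (he : e.act ∈ I) :
    (outer q e).vis = false := by simp [outer, he]

theorem outer_vis_of_notMem {q : List Dir} {e : Event (Act m n L)} (he : e.act ∉ I) :
    (outer q e).vis = e.vis := by simp [outer, he]

/-- Encapsulation lies inside abstraction, so the history and the constraints concern the event
before hiding; only its visibility and location differ outside. -/
theorem sysTerm_trans {q : List Dir} {T : Proc m n L D} {s s' : Data m n D}
    {e : Event (Act m n L)} {r : Option (Proc m n L D)} :
    Trans (spec eff c) (sysTerm q h T) s e r s' ↔
      ∃ e₀ r₀, Trans (spec eff c) T s e₀ r₀ s' ∧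
        (e₀.vis = true → e₀.act ∈ H → Respects Causality h e₀.act) ∧
        e = outer q e₀ ∧ r = r₀.map (sysTerm q (record e₀ h)) := by
  induction q generalizing e r with
  | nil =>
    constructor
    · intro ht
      cases ht with
      | hideIn ht hI =>
        cases ht with
        | @encap _ _ _ _ _ r₀ _ ht hR =>
          exact ⟨_, r₀, ht, hR, by simp [outer, hI], by cases r₀ <;> rfl⟩
      | hideOut ht hI =>
        cases ht with
        | @encap _ _ _ _ _ r₀ _ ht hR =>
          exact ⟨_, r₀, ht, hR, by simp [outer, hI], by cases r₀ <;> rfl⟩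
    · rintro ⟨e₀, r₀, ht, hR, rfl, rfl⟩
      have he := Trans.encap (H := H) ht hR
      have hr : r₀.map (sysTerm [] (record e₀ h)) =
          (r₀.map (.encap H (record e₀ h))).map (.hide I) := by cases r₀ <;> rfl
      rw [hr]
      by_cases hI : e₀.act ∈ I
      · have ho : outer [] e₀ = { e₀ with vis := false } := by simp [outer, hI]
        rw [ho]
        exact .hideIn he hI
      · have ho : outer [] e₀ = e₀ := by simp [outer, hI]
        rw [ho]
        exact .hideOut he hI
  | cons d q ih =>
    constructor
    · intro ht
      cases ht with
      | loc ht =>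
        obtain ⟨e₀, r₀, ht₀, hR, rfl, rfl⟩ := ih.1 ht
        exact ⟨e₀, r₀, ht₀, hR, rfl, by cases r₀ <;> rfl⟩
    · rintro ⟨e₀, r₀, ht, hR, rfl, rfl⟩
      have hr : r₀.map (sysTerm (d :: q) (record e₀ h)) =
          (r₀.map (sysTerm q (record e₀ h))).map (.loc d) := by cases r₀ <;> rfl
      rw [hr]
      exact .loc (ih.2 ⟨e₀, r₀, ht, hR, rfl, rfl⟩)

theorem not_eps_sysTerm {q : List Dir} {T : Proc m n L D} {s : Data m n D} {v : List Dir}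
    {x : Proc m n L D} (hx : (v, x) ∈ T.threads) (hs : ¬ Eps (spec eff c) s x) :
    ¬ Eps (spec eff c) s (sysTerm q h T) := by
  induction q with
  | nil =>
    intro he
    cases he with | hide he => cases he with | encap he => exact hs (he.thread hx)
  | cons d q ih =>
    intro he
    cases he with | loc he => exact ih he

variable (eff c) in
/-- The configuration `C` is extended to `C'` by the event `e` of the thread `y` at the location `u`
of `T`. -/
structure ThreadStep (q : List Dir) (h : Multiset (Act m n L)) (T : Proc m n L D)
    (C C' : Config (Act m n L) (Var m n) (Data m n D)) (u : List Dir) (y : Proc m n L D)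
    (e : Event (Act m n L)) (r : Option (Proc m n L D)) : Prop where
  mem : (u, y) ∈ T.threads
  trans : Trans (spec eff c) y C.data e r C'.data
  respects : e.vis = true → e.act ∈ H → Respects Causality h e.act
  hist : C'.hist = C.hist ++ [outer q (e.below u)]
  proc : ∃ r', C'.proc = r'.map (sysTerm q (record e h)) ∧
    threadsO r' + {(u, y)} = shift u (threadsO r) + T.threads

variable {q : List Dir} {T : Proc m n L D} {C C' : Config (Act m n L) (Var m n) (Data m n D)}
  {u : List Dir} {y : Proc m n L D} {e : Event (Act m n L)} {r : Option (Proc m n L D)}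

theorem exists_threadStep (hC : C.proc = some (sysTerm q h T)) {e : Event (Act m n L)}
    (hn : C.Next (spec eff c) e C') :
    ∃ u y e₀ r, ThreadStep eff c q h T C C' u y e₀ r ∧ e = outer q (e₀.below u) := by
  obtain ⟨X, hX, ht, hh⟩ := hn
  obtain rfl := Option.some_injective _ (hC.symm.trans hX)
  obtain ⟨e₁, r₁, ht₁, hR, rfl, hr⟩ := sysTerm_trans.1 ht
  obtain ⟨u, y, e₀, r, hm, rfl, ht₀, hth⟩ := ht₁.exists_thread
  exact ⟨u, y, e₀, r, ⟨hm, ht₀, hR, hh, r₁, hr, hth⟩, rfl⟩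

theorem exists_next (hC : C.proc = some (sysTerm q h T)) (hm : (u, y) ∈ T.threads)
    {s' : Data m n D} (ht : Trans (spec eff c) y C.data e r s')
    (hR : e.act ∈ H → Respects Causality h e.act) :
    ∃ C', C.Next (spec eff c) (outer q (e.below u)) C' ∧
      ThreadStep eff c q h T C C' u y e r ∧ C'.data = s' := by
  obtain ⟨r', ht', hr'⟩ := ht.of_thread hm
  refine ⟨⟨r'.map (sysTerm q (record e h)), s', C.hist ++ [outer q (e.below u)]⟩,
    ⟨_, hC, sysTerm_trans.2 ⟨_, r', ht', fun _ => hR, rfl, rfl⟩, rfl⟩,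
    ⟨hm, ht, fun _ => hR, rfl, r', rfl, hr'⟩, rfl⟩

theorem ThreadStep.exists_proc (hs : ThreadStep eff c q h T C C' u y e r) {v : List Dir}
    {x : Proc m n L D} {N M : Multiset (List Dir × Proc m n L D)}
    (hr : threadsO r = (v, x) ::ₘ N) (hT : T.threads = (u, y) ::ₘ M) :
    ∃ T', C'.proc = some (sysTerm q (record e h) T') ∧
      T'.threads = (u ++ v, x) ::ₘ (shift u N + M) := by
  obtain ⟨r', hp, hth⟩ := hs.proc
  -- The thread that moved is cancelled on both sides. The remaining equation also excludes `√`,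
  -- since `x` is among the threads left.
  rw [hr, hT, shift_cons, ← Multiset.singleton_add (u, y) M, add_left_comm, add_comm,
    add_right_inj] at hth
  cases r' with
  | none => exact absurd hth.symm (by simp [threadsO])
  | some T' => exact ⟨T', hp, by rw [← Multiset.cons_add]; exact hth⟩

/-! ### The invariant of the system and its preservation. -/

variable (eff c) in
/-- The configurations of the system: the Master, the other threads `M`, and the messages on their
way. -/
structure SysState (C : Config (Act m n L) (Var m n) (Data m n D)) (b : Bool) (q : List Dir)
    (h : Multiset (Act m n L)) (v : List Dir) (x : Proc m n L D)
    (M : Multiset (List Dir × Proc m n L D)) (W : Multiset (Worker m n)) : Prop where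
  proc : ∃ T, C.proc = some (sysTerm q h T) ∧ T.threads = (v, x) ::ₘ M
  master : Master eff c (C.data .mas) x b W
  workers : ∀ p ∈ M, (∃ w, p.2 = .var (resting w)) ∨
    ∃ w, Running w p.2 ∧ RunLive eff c w p.2 (C.data (who w))
  exists_worker : ∀ w, ∃ p ∈ M, p.2 = .var (resting w) ∨ Running w p.2
  balanced : Balanced h M W
  ordered : Ordered C.hist
  before : ∀ e ∈ C.hist, e.vis = true → Before e.path (q ++ v)

variable {b : Bool} {v : List Dir} {x : Proc m n L D}

theorem ordered_snoc {l : List (Event (Act m n L))} (hl : Ordered l) {e : Event (Act m n L)}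
    (he : e.vis = true → ∀ e' ∈ l, e'.vis = true → ¬ Indep e'.path e.path) :
    Ordered (l ++ [e]) := by
  refine List.pairwise_append.2 ⟨hl, List.pairwise_singleton _ _, ?_⟩
  intro e' he' e'' he'' hv hv'
  obtain rfl := List.mem_singleton.1 he''
  exact he hv' e' he' hv

theorem MasterStep.mem_I {s s' : Data m n D} {a : Act m n L} {W' : Multiset (Worker m n)}
    (h : MasterStep s b W a s' b W') : a ∈ I := by
  cases b <;> cases h
  · exact .inl (sendIn_mem_H _)
  · exact .inl (recvOut_mem_H _)
  · exact loc_mem_I _ _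

theorem MasterStep.eq_external {s s' : Data m n D} {a : Act m n L} {b' : Bool}
    {W' : Multiset (Worker m n)} (h : MasterStep s b W a s' b' W') (hb : b' ≠ b) :
    a = external b ∧ b' = !b := by
  cases h <;> simp at hb ⊢

theorem record_of_vis {A : Type*} {e : Event A} {h : Multiset A} (he : e.vis = true) :
    record e h = e.act ::ₘ h := if_pos he

theorem loc_notMem_H (a : Actor m n) (l : L) : (.loc a l : Act m n L) ∉ H := by
  rw [mem_H_iff]
  rintro ⟨w, h | h | h | h⟩ <;> cases h

theorem external_notMem_H (b : Bool) : (external b : Act m n L) ∉ H :=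
  fun h => external_notMem_I b (.inl h)

theorem MasterStep.balanced {s s' : Data m n D} {a : Act m n L} {b' : Bool}
    {W' : Multiset (Worker m n)} (hs : MasterStep s b W a s' b' W') (hb : Balanced h M W)
    (hR : a ∈ H → Respects Causality h a) : Balanced (a ::ₘ h) M W' := by
  cases hs with
  | visible => exact hb.cons_of_notMem (external_notMem_H _)
  | ask => exact hb.ask _
  | collect =>
    exact hb.collect (respects_recvOut.1 (hR (recvOut_mem_H _)))
  | compute => exact hb.cons_of_notMem (loc_notMem_H _ _)

theorem MasterStep.data {s s' : Data m n D} {a : Act m n L} {b' : Bool}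
    {W' : Multiset (Worker m n)} (hs : MasterStep s b W a s' b' W') (w : Worker m n) :
    s' (who w) = s (who w) := by
  cases hs with
  | compute h => exact h _ (who_ne_mas w)
  | _ => rfl

/-- An event of the Master. -/
theorem SysState.master_step (hm : MasterLive eff c) (hC : SysState eff c C b q h v x M W)
    (hT : T.threads = (v, x) ::ₘ M) (hs : ThreadStep eff c q h T C C' v x e r) :
    ∃ b' v' x' M' W', SysState eff c C' b' q (e.act ::ₘ h) v' x' M' W' ∧
      MasterStep C.data b W e.act C'.data b' W' ∧
      (∀ u y, (u, y) ∈ threadsO r → (∀ w, y ≠ .var (resting w)) → y = x') ∧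
      (((outer q (e.below v)).vis = false ∧ b' = b) ∨
        ((outer q (e.below v)).vis = true ∧ e.act = external b ∧ b' = !b)) := by
  obtain ⟨hv, ⟨w, hw, he⟩ | ⟨b', W', v', x', N, hr, hN, hM, hst, hbef⟩⟩ := hC.master.trans hm hs.trans
  -- A created worker would read an input. The Master awaits nothing from it, so the balance leaves
  -- no input under way and the encapsulation blocks the read.
  · exfalso
    have hR := hs.respects hv (by rw [he]; exact recvIn_mem_H w)
    rw [he] at hR
    have hlt : occ (recvIn w) h < occ (sendIn w) h := respects_recvIn.1 hR
    obtain ⟨i, o, h₁, h₂, h₃⟩ := hC.balanced w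
    rw [Multiset.count_eq_zero.2 hw] at h₃
    omega
  · obtain ⟨T', hp, hT'⟩ := hs.exists_proc hr hT
    rw [record_of_vis hv] at hp
    have hN' : ∀ p ∈ shift v N, ∃ w, p.2 = .var (resting w) := by
      rintro ⟨u, y⟩ hp
      obtain ⟨u', hu, -⟩ := mem_shift.1 hp
      exact hN (u', y) hu
    have hvis : ((outer q (e.below v)).vis = false ∧ b' = b) ∨
        ((outer q (e.below v)).vis = true ∧ e.act = external b ∧ b' = !b) := by
      by_cases hb : b' = b
      · subst hb
        exact .inl ⟨outer_vis_of_mem (e := e.below v) hst.mem_I, rfl⟩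
      · obtain ⟨ha, hb'⟩ := hst.eq_external hb
        refine .inr ⟨?_, ha, hb'⟩
        rw [outer_vis_of_notMem]
        · exact hv
        · change e.act ∉ I
          rw [ha]; exact external_notMem_I b
    refine ⟨b', v ++ v', x', shift v N + M, W', ⟨⟨T', hp, hT'⟩, hM, ?_, ?_, ?_, ?_, ?_⟩, hst, ?_,
      hvis⟩
    · intro p hp
      rcases Multiset.mem_add.1 hp with hp | hp
      · exact .inl (hN' p hp)
      · refine (hC.workers p hp).imp id ?_
        rintro ⟨w, h₁, h₂⟩
        exact ⟨w, h₁, by rwa [hst.data w]⟩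
    · intro w
      obtain ⟨p, hp, hw⟩ := hC.exists_worker w
      exact ⟨p, Multiset.mem_add.2 (.inr hp), hw⟩
    · exact (hst.balanced hC.balanced (hs.respects hv)).add_resting hN'
    · rw [hs.hist]
      -- The location of the new event extends that of the Master, to which all earlier visible
      -- events are sequentially prior.
      refine ordered_snoc hC.ordered fun _ e' he' hv' => Before.not_indep ?_
      change Before e'.path (q ++ (v ++ e.path))
      rw [← List.append_assoc]
      exact (hC.before e' he' hv').append_right _
    · rw [hs.hist]
      intro e' he' hv'
      rw [← List.append_assoc]
      rcases List.mem_append.1 he' with he' | he'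
      · exact (hC.before e' he' hv').append_right _
      · obtain rfl := List.mem_singleton.1 he'
        -- The new event is visible, so it changes the phase, and then the Master continues in
        -- sequence after it.
        have hb : b' ≠ b := by
          rcases hvis with h | ⟨-, -, h⟩
          · simp [hv'] at h
          · rw [h]; cases b <;> simp
        have := (hbef hb).append_left (q ++ v)
        simpa only [outer, Event.below, List.append_assoc] using this
    · intro u y hy hne
      rw [hr] at hy
      rcases Multiset.mem_cons.1 hy with hy | hy
      · exact congrArg Prod.snd hy
      · obtain ⟨w, hw⟩ := hN _ hy
        exact (hne w hw).elim

/-- The part common to all events of workers: one thread is exchanged for one thread, silently, and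
without touching the Master. -/
theorem SysState.worker_update {M₀ : Multiset (List Dir × Proc m n L D)}
    (hC : SysState eff c C b q h v x ((u, y) ::ₘ M₀) W)
    (hT : T.threads = (v, x) ::ₘ (u, y) ::ₘ M₀) (hs : ThreadStep eff c q h T C C' u y e r)
    (hv : e.vis = true) {v' : List Dir} {y' : Proc m n L D} (hr : threadsO r = {(v', y')})
    (hI : e.act ∈ I) (hmas : C'.data .mas = C.data .mas)
    (hother : ∀ w, Running w y ∨ C'.data (who w) = C.data (who w))
    (hy : ∀ w, (y = .var (resting w) ∨ Running w y) → y' = .var (resting w) ∨ Running w y')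
    (hy' : (∃ w, y' = .var (resting w)) ∨ ∃ w, Running w y' ∧ RunLive eff c w y' (C'.data (who w)))
    (hb : Balanced (e.act ::ₘ h) ((u ++ v', y') ::ₘ M₀) W) :
    SysState eff c C' b q (e.act ::ₘ h) v x ((u ++ v', y') ::ₘ M₀) W ∧
      (outer q (e.below u)).vis = false := by
  have hvis := outer_vis_of_mem (q := q) (e := e.below u) hI
  obtain ⟨T', hp, hT'⟩ := hs.exists_proc (N := 0) hr (hT.trans (Multiset.cons_swap _ _ _))
  rw [shift_zero, zero_add, Multiset.cons_swap] at hT'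
  rw [record_of_vis hv] at hp
  refine ⟨⟨⟨T', hp, hT'⟩, by rw [hmas]; exact hC.master, ?_, ?_, hb, ?_, ?_⟩, hvis⟩
  · intro p hp
    rcases Multiset.mem_cons.1 hp with rfl | hp
    · exact hy'
    · refine (hC.workers p (Multiset.mem_cons_of_mem hp)).imp id ?_
      rintro ⟨w, h₁, h₂⟩
      refine ⟨w, h₁, ?_⟩
      -- Copies of `w` share their data, so a second running copy could lose its liveness through
      -- this event. There is none: the balance allows at most one, because `W` has no repetitions.
      rcases hother w with hw | hw
      · exfalso
        obtain ⟨i, o, -, -, h₃⟩ := hC.balanced w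
        have h₄ := Multiset.nodup_iff_count_le_one.1 hC.master.nodup w
        have h₅ : 0 < running w M₀ := running_pos.2 ⟨p, hp, h₁⟩
        rw [running_cons, if_pos hw] at h₃
        omega
      · rwa [hw]
  · intro w
    obtain ⟨p, hp, hw⟩ := hC.exists_worker w
    rcases Multiset.mem_cons.1 hp with rfl | hp
    · exact ⟨_, Multiset.mem_cons_self _ _, hy w hw⟩
    · exact ⟨p, Multiset.mem_cons_of_mem hp, hw⟩
  · rw [hs.hist]
    exact ordered_snoc hC.ordered fun h => by simp [hvis] at h
  · rw [hs.hist]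
    intro e' he' hv'
    rcases List.mem_append.1 he' with he' | he'
    · exact hC.before e' he' hv'
    · obtain rfl := List.mem_singleton.1 he'
      simp [hvis] at hv'

/-- An event of a resting worker. -/
theorem SysState.resting_step {w : Worker m n} {M₀ : Multiset (List Dir × Proc m n L D)}
    (hC : SysState eff c C b q h v x ((u, .var (resting w)) ::ₘ M₀) W)
    (hT : T.threads = (v, x) ::ₘ (u, .var (resting w)) ::ₘ M₀)
    (hs : ThreadStep eff c q h T C C' u (.var (resting w)) e r) :
    ∃ u', SysState eff c C' b q (recvIn w ::ₘ h) v x ((u', .var (working w)) ::ₘ M₀) W ∧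
      C'.data = C.data ∧ (outer q (e.below u)).vis = false := by
  obtain ⟨hv, ha, hd, hr⟩ := resting_trans hs.trans
  have hH : (recvIn w : Act m n L) ∈ H := recvIn_mem_H w
  have hR := hs.respects hv (by rwa [ha])
  rw [ha] at hR
  refine ⟨u ++ [.next], ?_⟩
  have := hC.worker_update hT hs hv hr (by rw [ha]; exact .inl hH) (by rw [hd])
    (fun w => .inr (by rw [hd])) ?_ (.inr ⟨w, .inl rfl, by simp [RunLive]⟩) ?_
  · rw [ha] at this
    exact ⟨this.1, hd, this.2⟩
  · rintro w' (hw | hw)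
    · obtain rfl : w = w' := by
        simp only [Term.var.injEq] at hw
        cases w <;> cases w' <;> simp_all [resting]
      exact .inr (.inl rfl)
    · exact (not_running_resting _ _ hw).elim
  · rw [ha]
    exact hC.balanced.recv (respects_recvIn.1 hR)

/-- An event of a running worker. -/
theorem SysState.running_step {w : Worker m n} {M₀ : Multiset (List Dir × Proc m n L D)}
    (hlive : ∀ w d, Live eff c (who w) ((c.work w).toProc (who w)) d)
    (hC : SysState eff c C b q h v x ((u, y) ::ₘ M₀) W) (hy : Running w y)
    (hT : T.threads = (v, x) ::ₘ (u, y) ::ₘ M₀) (hs : ThreadStep eff c q h T C C' u y e r) :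
    ∃ u' y' v', SysState eff c C' b q (e.act ::ₘ h) v x ((u', y') ::ₘ M₀) W ∧
      C'.data .mas = C.data .mas ∧ (outer q (e.below u)).vis = false ∧
      threadsO r = {(v', y')} ∧ (e.act = sendOut w ∨ (∃ l, e.act = .loc (who w) l) ∧
        Running w y' ∧ RunLive eff c w y' (C'.data (who w))) := by
  have hl : RunLive eff c w y (C.data (who w)) := by
    rcases hC.workers (u, y) (Multiset.mem_cons_self _ _) with ⟨w', hw⟩ | ⟨w', h₁, h₂⟩
    · exact (hy.ne_resting w' hw).elim
    · obtain rfl := hy.unique h₁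
      exact h₂
  have hyw : ∀ w', (y = .var (resting w') ∨ Running w' y) → w' = w := by
    rintro w' (hw | hw)
    · exact (hy.ne_resting w' hw).elim
    · exact hw.unique hy
  obtain ⟨hv, v', y', hr, ⟨ha, hd, rfl⟩ | ⟨⟨l, ha⟩, hd, hy', hl'⟩⟩ := hy.trans hlive hl hs.trans
  · have := hC.worker_update hT hs hv hr (by rw [ha]; exact .inl (sendOut_mem_H w))
      (by rw [hd]) (fun w => .inr (by rw [hd]))
      (fun w' hw => .inl (by rw [hyw w' hw])) (.inl ⟨w, rfl⟩)
      (by rw [ha]; exact hC.balanced.send hy)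
    exact ⟨_, _, v', this.1, by rw [hd], this.2, hr, .inl ha⟩
  · have hmas := hd .mas (who_ne_mas w).symm
    have := hC.worker_update hT hs hv hr (by rw [ha]; exact loc_mem_I _ _) hmas
      (fun w' => by
        by_cases hw : w' = w
        · exact .inl (hw ▸ hy)
        · exact .inr (hd _ (fun e => hw (who_injective e))))
      (fun w' hw => .inr (by rw [hyw w' hw]; exact hy')) (.inr ⟨w, hy', hl'⟩)
      ((hC.balanced.congr hy hy').cons_of_notMem (by rw [ha]; exact loc_notMem_H _ _))
    exact ⟨_, _, v', this.1, hmas, this.2, hr, .inr ⟨⟨l, ha⟩, hy', hl'⟩⟩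

/-- Every event of the system is silent or the visible one of its phase. -/
theorem SysState.step (hm : MasterLive eff c)
    (hlive : ∀ w d, Live eff c (who w) ((c.work w).toProc (who w)) d)
    (hC : SysState eff c C b q h v x M W) {e : Event (Act m n L)}
    (hn : C.Next (spec eff c) e C') : ∃ b' h' v' x' M' W', SysState eff c C' b' q h' v' x' M' W' ∧
      ((e.vis = false ∧ b' = b) ∨ (e.vis = true ∧ e.act = external b ∧ b' = !b)) := by
  obtain ⟨T, hp, hT⟩ := hC.proc
  obtain ⟨u, y, e₀, r, hs, rfl⟩ := exists_threadStep hp hn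
  have hmem := hs.mem
  rw [hT] at hmem
  rcases Multiset.mem_cons.1 hmem with heq | hmem
  · obtain ⟨rfl, rfl⟩ := Prod.mk.inj heq
    obtain ⟨b', v', x', M', W', h₁, -, -, h₂⟩ := hC.master_step hm hT hs
    exact ⟨b', _, v', x', M', W', h₁, h₂⟩
  · obtain ⟨M₀, rfl⟩ := Multiset.exists_cons_of_mem hmem
    rcases hC.workers _ hmem with ⟨w, rfl : y = _⟩ | ⟨w, hw, -⟩
    · obtain ⟨u', h₁, -, h₂⟩ := hC.resting_step hT hs
      exact ⟨b, _, v, x, _, W, h₁, .inl ⟨h₂, rfl⟩⟩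
    · obtain ⟨u', y', v', h₁, -, h₂, -⟩ := hC.running_step hlive hw hT hs
      exact ⟨b, _, v, x, _, W, h₁, .inl ⟨h₂, rfl⟩⟩

/-! ### Progress -/

theorem taus_head {A V S : Type*} {P : Spec A V S} {C C' C'' : Config A V S} {e : Event A}
    (hn : C.Next P e C') (he : e.vis = false) (ht : C'.Taus P C'') : C.Taus P C'' :=
  Relation.ReflTransGen.head ⟨e, hn, he⟩ ht

/-- A running worker can send its answer. -/
theorem SysState.running_progress {w : Worker m n}
    (hlive : ∀ w d, Live eff c (who w) ((c.work w).toProc (who w)) d) {d : D}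
    (hg : Go eff c (who w) (Set.range (.loc (who w))) (sendOut w) y d)
    (hC : SysState eff c C b q h v x M W) (hd : C.data (who w) = d) (hm : (u, y) ∈ M)
    (hy : Running w y) :
    ∃ C' h' M', C.Taus (spec eff c) C' ∧ SysState eff c C' b q h' v x M' W ∧
      C'.data .mas = C.data .mas ∧ occ (recvOut w) h' < occ (sendOut w) h' := by
  induction hg generalizing C h M u with
  | goal hg =>
    obtain ⟨e, r, s', ht, ha⟩ := hg C.data hd
    obtain ⟨T, hp, hT⟩ := hC.proc
    obtain ⟨M₀, rfl⟩ := Multiset.exists_cons_of_mem hm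
    obtain ⟨C', hn, hs, -⟩ := exists_next (u := u) hp (by rw [hT]; simp) ht
      (fun _ => by rw [ha]; exact respects_send)
    obtain ⟨u', y', v', h₁, h₂, h₃, -, -⟩ := hC.running_step hlive hy hT hs
    refine ⟨C', _, _, taus_head hn h₃ .refl, h₁, h₂, ?_⟩
    -- By the balance no more answers had been read than sent, so one further send makes the
    -- inequality strict.
    obtain ⟨i, o, -, h₄, -⟩ := hC.balanced w
    rw [ha]
    simp only [occ_cons, (sendOut_ne_recvOut _ _).symm, if_true, if_false]
    omega
  | @step y d y₁ d' k hk hne hst hg ih =>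
    obtain ⟨l, rfl⟩ := hk
    obtain ⟨e, r, s', v₁, ht, hs', ha, hv₁⟩ := hst C.data hd
    obtain ⟨T, hp, hT⟩ := hC.proc
    obtain ⟨M₀, rfl⟩ := Multiset.exists_cons_of_mem hm
    obtain ⟨C', hn, hs, rfl⟩ := exists_next (u := u) hp (by rw [hT]; simp) ht
      (fun h => (loc_notMem_H _ _ (ha ▸ h)).elim)
    obtain ⟨u', y', v', h₁, h₂, h₃, h₄, h₅⟩ := hC.running_step hlive hy hT hs
    rw [h₄, Multiset.mem_singleton, Prod.mk.injEq] at hv₁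
    obtain ⟨-, rfl⟩ := hv₁
    rcases h₅ with h₅ | ⟨-, h₅, -⟩
    · rw [ha] at h₅; cases h₅
    · obtain ⟨C'', h'', M'', g₁, g₂, g₃, g₄⟩ := ih h₁ hs' (Multiset.mem_cons_self _ _) h₅
      exact ⟨C'', h'', M'', taus_head hn h₃ g₁, g₂, g₃.trans h₂, g₄⟩

/-- A worker for which the Master waits can send its answer. -/
theorem SysState.answer (hlive : ∀ w d, Live eff c (who w) ((c.work w).toProc (who w)) d)
    {w : Worker m n} (hC : SysState eff c C b q h v x M W) (hw : w ∈ W) :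
    ∃ C' h' M', C.Taus (spec eff c) C' ∧ SysState eff c C' b q h' v x M' W ∧
      C'.data .mas = C.data .mas ∧ occ (recvOut w) h' < occ (sendOut w) h' := by
  have key : ∀ {C h M}, SysState eff c C b q h v x M W → (∃ p ∈ M, Running w p.2) →
      ∃ C' h' M', C.Taus (spec eff c) C' ∧ SysState eff c C' b q h' v x M' W ∧
        C'.data .mas = C.data .mas ∧ occ (recvOut w) h' < occ (sendOut w) h' := by
    rintro C h M hC ⟨⟨u, y⟩, hp, hy⟩
    have hl : RunLive eff c w y (C.data (who w)) := by
      rcases hC.workers _ hp with ⟨w', hw⟩ | ⟨w', h₁, h₂⟩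
      · exact (hy.ne_resting w' hw).elim
      · obtain rfl := hy.unique h₁
        exact h₂
    exact hC.running_progress hlive (hy.go hlive hl) rfl hp hy
  obtain ⟨i, o, h₁, h₂, h₃⟩ := hC.balanced w
  have h₄ := Multiset.count_pos.2 hw
  -- The worker is awaited, so its answer is under way, or a copy is running, or else its input is
  -- under way. In the last case a resting copy exists and reads the input first.
  by_cases ho : 0 < o
  · exact ⟨C, h, M, .refl, hC, rfl, by omega⟩
  by_cases hr : 0 < running w M
  · exact key hC (running_pos.1 hr)
  obtain ⟨⟨u, y⟩, hp, hy⟩ := hC.exists_worker w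
  obtain rfl : y = .var (resting w) :=
    hy.resolve_right fun h => hr (running_pos.2 ⟨_, hp, h⟩)
  obtain ⟨M₀, rfl⟩ := Multiset.exists_cons_of_mem hp
  obtain ⟨T, hp, hT⟩ := hC.proc
  have ht : Trans (spec eff c) (.var (resting w)) C.data ⟨[.first], recvIn w, true⟩
      (some (.loc .next (.var (working w)))) C.data := by
    refine .var ?_
    change Trans _ (eqn c _) _ _ _ _
    rw [eqn_resting]
    exact .seqFirst not_created_act (.act rfl)
  obtain ⟨C', hn, hs, -⟩ := exists_next (u := u) hp (by rw [hT]; simp) ht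
    (fun _ => respects_recvIn.2 (show occ _ _ < occ _ _ by omega))
  obtain ⟨u', g₁, g₂, g₃⟩ := hC.resting_step hT hs
  obtain ⟨C'', h'', M'', k₁, k₂, k₃, k₄⟩ := key g₁ ⟨_, Multiset.mem_cons_self _ _, .inl rfl⟩
  exact ⟨C'', h'', M'', taus_head hn g₃ k₁, k₂, k₃.trans (by rw [g₂]), k₄⟩

/-- The system can reach the visible event of its phase. -/
theorem SysState.progress (hm : MasterLive eff c)
    (hlive : ∀ w d, Live eff c (who w) ((c.work w).toProc (who w)) d) {d : D}
    (hg : Go eff c .mas masterActs (external b) x d)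
    (hC : SysState eff c C b q h v x M W) (hd : C.data .mas = d) :
    ∃ C₀ e C', C.Taus (spec eff c) C₀ ∧ C₀.Next (spec eff c) e C' ∧ e.vis = true := by
  induction hg generalizing C h v M W with
  | goal hg =>
    obtain ⟨e, r, s', ht, ha⟩ := hg C.data hd
    obtain ⟨T, hp, hT⟩ := hC.proc
    obtain ⟨C', hn, hs, -⟩ := exists_next (u := v) hp (by rw [hT]; simp) ht
      (fun h => (external_notMem_H _ (ha ▸ h)).elim)
    refine ⟨C, _, C', .refl, hn, ?_⟩
    rw [outer_vis_of_notMem]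
    · exact (hC.master.trans hm ht).1
    · change e.act ∉ I
      rw [ha]; exact external_notMem_I b
  | @step x d x₁ d' k hk hne hst hg ih =>
    -- Only the reading of an answer can be blocked. Before it, the worker concerned is made to
    -- answer, which affects neither the thread nor the data of the Master, so that the path in `hg`
    -- remains valid.
    have prep : ∃ C₁ h₁ M₁, C.Taus (spec eff c) C₁ ∧ SysState eff c C₁ b q h₁ v x M₁ W ∧
        C₁.data .mas = C.data .mas ∧ (k ∈ H → Respects Causality h₁ k) := by
      rcases hk with ⟨w, rfl | rfl⟩ | ⟨l, rfl⟩
      · exact ⟨C, h, M, .refl, hC, rfl, fun _ => respects_send⟩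
      · obtain ⟨e, r, s', v₁, ht, -, ha, -⟩ := hst C.data hd
        have hw : w ∈ W := by
          obtain ⟨-, ⟨w', -, he⟩ | ⟨b', W', -, -, -, -, -, -, hs, -⟩⟩ := hC.master.trans hm ht
          · exact (recvIn_ne_recvOut _ _ (he.symm.trans ha)).elim
          · rw [ha] at hs
            generalize hk : (recvOut w : Act m n L) = k at hs
            cases hs with
            | visible =>
              exact (external_notMem_H b (hk ▸ recvOut_mem_H w)).elim
            | ask => cases hk
            | collect =>
              rw [recvOut_inj] at hk
              rw [hk]; exact Multiset.mem_cons_self _ _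
            | compute => cases hk
        obtain ⟨C₁, h₁, M₁, g₁, g₂, g₃, g₄⟩ := hC.answer hlive hw
        exact ⟨C₁, h₁, M₁, g₁, g₂, g₃, fun _ => respects_recvOut.2 g₄⟩
      · exact ⟨C, h, M, .refl, hC, rfl, fun h => (loc_notMem_H _ _ h).elim⟩
    obtain ⟨C₁, h₁, M₁, ht₁, hC₁, hd₁, hR⟩ := prep
    obtain ⟨e, r, s', v₁, ht, hs', ha, hv₁⟩ := hst C₁.data (hd₁.trans hd)
    obtain ⟨T, hp, hT⟩ := hC₁.proc
    obtain ⟨C', hn, hs, rfl⟩ := exists_next (u := v) hp (by rw [hT]; simp) ht (by rwa [ha])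
    obtain ⟨b', v', x', M', W', g₁, -, g₂, g₃⟩ := hC₁.master_step hm hT hs
    -- The thread followed by `Go` is not a resting worker, hence it is the thread of the Master.
    obtain rfl := g₂ _ _ hv₁ hne
    rcases g₃ with ⟨g₃, rfl⟩ | ⟨g₃, -⟩
    · obtain ⟨C₀, e', C'', k₁, k₂, k₃⟩ := ih g₁ hs'
      exact ⟨C₀, e', C'', ht₁.trans (taus_head hn g₃ k₁), k₂, k₃⟩
    · exact ⟨C₁, _, C', ht₁, hn, g₃⟩

theorem SysState.not_final (hC : SysState eff c C b q h v x M W) : ¬ C.Final (spec eff c) := by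
  intro hf
  obtain ⟨T, hp, hT⟩ := hC.proc
  exact not_eps_sysTerm (v := v) (x := x) (by rw [hT]; simp) hC.master.not_eps (hf _ hp)

/-! ### The whole system -/

theorem map_snd_threads_actors : (actors : Proc m n L D).threads.map Prod.snd =
    .var .mas ::ₘ ↑((mapWorkers m n ++ redWorkers m n).map
      fun w => (.var (resting w) : Proc m n L D)) := by
  have : ((mapWorkers m n ++ redWorkers m n).map fun w => (.var (resting w) : Proc m n L D)) =
      List.ofFn (fun i => .var (.map i)) ++ List.ofFn (fun j => .var (.red j)) := by
    simp [mapWorkers, redWorkers, List.map_ofFn, Function.comp_def, resting]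
  rw [this, actors, map_snd_threads_parList]
  · rfl
  · intro x hx
    simp only [List.mem_cons, List.mem_append, List.mem_ofFn] at hx
    rcases hx with rfl | ⟨i, rfl⟩ | ⟨j, rfl⟩ <;> rfl

/-- The location and the past are arbitrary so that this applies both to the system itself and to
the copy of it that the specification reaches after the reply. -/
theorem SysState.start (hp : C.proc = some (sysTerm q 0 actors)) (ho : Ordered C.hist)
    (hb : ∀ e ∈ C.hist, e.vis = true → Before e.path q) :
    ∃ v x M, SysState eff c C false q 0 v x M 0 := by
  obtain ⟨⟨v, x⟩, M, hT, hx, hM⟩ := exists_of_map_eq_cons (map_snd_threads_actors (m := m) (n := n) (L := L) (D := D))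
  have hM' : ∀ p ∈ M, ∃ w, p.2 = .var (resting w) := by
    intro p hp
    have := Multiset.mem_map_of_mem Prod.snd hp
    rw [hM] at this
    obtain ⟨w, -, hw⟩ := List.mem_map.1 (Multiset.mem_coe.1 this)
    exact ⟨w, hw.symm⟩
  refine ⟨v, x, M, ⟨_, hp, hT⟩, ?_, fun p hp => .inl (hM' p hp), ?_, ?_, ho, fun e he hv =>
    (hb e he hv).append_right v⟩
  · rw [show x = _ from hx]; exact .idle
  · intro w
    have : (.var (resting w) : Proc m n L D) ∈ M.map Prod.snd := by
      rw [hM]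
      refine List.mem_map.2 ⟨w, ?_, rfl⟩
      cases w <;> simp [mapWorkers, redWorkers, List.mem_ofFn]
    obtain ⟨p, hp, hw⟩ := Multiset.mem_map.1 this
    exact ⟨p, hp, .inl hw⟩
  · intro w
    exact ⟨0, 0, by simp [occ], by simp [occ], by simp [running_of_resting hM']⟩

/-- The first event of the system is visible. -/
theorem vis_of_next_system {s : Data m n D}
    (hn : (Config.init system s).Next (spec eff c) e C') : e.vis = true := by
  obtain ⟨u, y, e₀, r, hs, rfl⟩ :=
    exists_threadStep (q := []) (h := 0) (T := actors) (C := Config.init system s) rfl hn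
  have hy := Multiset.mem_map_of_mem Prod.snd hs.mem
  rw [map_snd_threads_actors] at hy
  rcases Multiset.mem_cons.1 hy with rfl | hy
  · have ht := hs.trans
    cases ht with
    | var ht =>
      obtain ⟨rfl, -, -⟩ := act_seq_trans ht
      exact outer_vis_of_notMem (external_notMem_I false)
  · obtain ⟨w, -, rfl⟩ := List.mem_map.1 (Multiset.mem_coe.1 hy)
    obtain ⟨hv, ha, -⟩ := resting_trans hs.trans
    -- Nothing has been sent yet, so the encapsulation blocks the read of a worker.
    have hR := hs.respects hv (by rw [ha]; exact recvIn_mem_H w)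
    rw [ha, respects_recvIn] at hR
    simp at hR

end Configurations

/-! ### The system and its specification under one alternating invariant. -/

section Serving

variable {m n : ℕ} {L D : Type*} {eff : L → D → Set D} {c : Code m n L D}

variable (eff c) in
/-- The configurations of the system and of its specification, in the idle phase `false` and the busy
phase `true`. -/
inductive Serving : Bool → Config (Act m n L) (Var m n) (Data m n D) → Prop
  | sys {C b q h v x M W} : SysState eff c C b q h v x M W → Serving b C
  | idle (s) : Serving false (.init (serve system) s)
  | busy {C} : C.proc = some (.loc .next (.seq (snd .out (.dout .mas)) system)) →
      Ordered C.hist → (∀ e ∈ C.hist, e.vis = true → Before e.path [.next]) → Serving true C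

theorem isAlternating_serving (hm : MasterLive eff c)
    (hlive : ∀ w d, Live eff c (who w) ((c.work w).toProc (who w)) d) :
    IsAlternating (spec eff c) external (Serving eff c) where
  ordered := by
    rintro b C (hC | s | ⟨-, ho, -⟩)
    · exact hC.ordered
    · exact .nil
    · exact ho
  step := by
    rintro b C e C' (hC | s | ⟨hp, ho, hb⟩) hn
    · obtain ⟨b', h', v', x', M', W', hC', ⟨he, rfl⟩ | ⟨he, ha, rfl⟩⟩ := hC.step hm hlive hn
      · exact .inl ⟨he, .sys hC'⟩
      · exact .inr ⟨he, ha, .sys hC'⟩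
    · obtain ⟨X, ⟨⟩, ht, hh⟩ := hn
      obtain ⟨rfl, -, hr⟩ := act_seq_trans ht
      refine .inr ⟨rfl, rfl, .busy hr ?_ ?_⟩
      · rw [hh]; exact List.pairwise_singleton _ _
      · rw [hh]
        intro e he _
        obtain rfl := List.mem_singleton.1 he
        exact ⟨[], [], [], rfl, rfl⟩
    · obtain ⟨X, hX, ht, hh⟩ := hn
      obtain rfl := Option.some_injective _ (hp.symm.trans hX)
      generalize hr : C'.proc = r at ht
      cases ht with
      | loc ht =>
        obtain ⟨rfl, -, rfl⟩ := act_seq_trans ht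
        refine .inr ⟨rfl, rfl, ?_⟩
        -- After request and reply the specification has become the system below two `next`
        -- wrappers, with an empty encapsulation history.
        have hp' : C'.proc = some (sysTerm [.next, .next] 0 actors) := hr
        obtain ⟨v, x, M, hC'⟩ := SysState.start (eff := eff) (c := c) hp' (by
          rw [hh]
          refine ordered_snoc ho fun _ e' he' hv' => Before.not_indep ?_
          exact (hb e' he' hv').append_right [.first]) (by
          rw [hh]
          intro e he hv
          rcases List.mem_append.1 he with he | he
          · exact (hb e he hv).append_right [.next]
          · obtain rfl := List.mem_singleton.1 he
            exact ⟨[.next], [], [], rfl, rfl⟩)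
        exact .sys hC'
  progress := by
    rintro b C (hC | s | ⟨hp, ho, hb⟩)
    · exact hC.progress hm hlive (hC.master.go hm) rfl
    · exact ⟨_, _, ⟨_, s, _⟩, .refl, ⟨_, rfl, .seqFirst not_created_act (.act rfl), rfl⟩, rfl⟩
    · exact ⟨_, _, ⟨_, C.data, _⟩, .refl,
        ⟨_, hp, .loc (.seqFirst not_created_act (.act rfl)), rfl⟩, rfl⟩
  not_final := by
    rintro b C (hC | s | ⟨hp, ho, hb⟩) hf
    · exact hC.not_final hf
    · have := hf _ rfl
      cases this with | seq h _ => cases h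
    · have := hf _ hp
      cases this with | loc h => cases h with | seq h _ => cases h

end Serving

end MapReduce

/-! ### The Map-Reduce theorem. -/

theorem mainTheorem1 {L D : Type*} (m n : ℕ) (eff : L → D → Set D) (c : MapReduce.Code m n L D)
    (hmas1 : APTC.CanAlwaysFinish (MapReduce.spec eff c) (c.mas1.toProc .mas))
    (hmas5 : APTC.CanAlwaysFinish (MapReduce.spec eff c) (c.mas5.toProc .mas))
    (hmas9 : APTC.CanAlwaysFinish (MapReduce.spec eff c) (c.mas9.toProc .mas))
    (hmap : ∀ i, APTC.CanAlwaysFinish (MapReduce.spec eff c) ((c.map i).toProc (.map i)))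
    (hred : ∀ j, APTC.CanAlwaysFinish (MapReduce.spec eff c) ((c.red j).toProc (.red j))) :
    APTC.RBS (MapReduce.spec eff c) MapReduce.system (MapReduce.serve MapReduce.system) ∧
    APTC.RBP (MapReduce.spec eff c) MapReduce.system (MapReduce.serve MapReduce.system) ∧
    APTC.RBHP (MapReduce.spec eff c) MapReduce.system (MapReduce.serve MapReduce.system) := by
  have hm : MapReduce.MasterLive eff c :=
    ⟨MapReduce.live_toProc hmas1, MapReduce.live_toProc hmas5, MapReduce.live_toProc hmas9⟩
  have hlive : ∀ w d, MapReduce.Live eff c (MapReduce.who w)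
      ((c.work w).toProc (MapReduce.who w)) d := by
    rintro (i | j) d
    · exact MapReduce.live_toProc (hmap i) d
    · exact MapReduce.live_toProc (hred j) d
  have hI := MapReduce.isAlternating_serving hm hlive
  have hx : ∀ s, MapReduce.Serving eff c false (.init MapReduce.system s) := fun s => by
    obtain ⟨v, x, M, hC⟩ := MapReduce.SysState.start (eff := eff) (c := c) (q := [])
      (C := APTC.Config.init MapReduce.system s) rfl .nil nofun
    exact .sys hC
  have hy : ∀ s, MapReduce.Serving eff c false (.init (MapReduce.serve MapReduce.system) s) :=
    .idle
  have hvx : ∀ s e C', (APTC.Config.init MapReduce.system s).Next (MapReduce.spec eff c) e C' →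
      e.vis = true := fun _ _ _ hn => MapReduce.vis_of_next_system hn
  have hvy : ∀ s e C', (APTC.Config.init (MapReduce.serve MapReduce.system) s).Next
      (MapReduce.spec eff c) e C' → e.vis = true := by
    rintro s e C' ⟨X, ⟨⟩, ht, -⟩
    obtain ⟨rfl, -, -⟩ := MapReduce.act_seq_trans ht
    rfl
  exact ⟨hI.rbs hx hy hvx hvy, hI.rbp hx hy hvx hvy, hI.rbhp hx hy hvx hvy⟩
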